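/- Let $D=(\alpha_1,\dots,\alpha_c)$ be a database of string pairs $\alpha_i=(\alpha_{i,1},\alpha_{i,2})$, let $N=\sum_i(|\alpha_{i,1}|+|\alpha_{i,2}|)$ be its size, and suppose $N\ge 2$ and $c\le N$ (the latter holds, for instance, when no pair consists of two empty strings). In the two-dimensional substring indexing problem $D$ is preprocessed, and a query $(\sigma_1,\sigma_2)$ asks to report every index $i$ such that $\sigma_1$ is a substring of $\alpha_{i,1}$ and $\sigma_2$ is a substring of $\alpha_{i,2}$; let $output$ be the number of these indices. On a word RAM whose word size $w$ satisfies $w\ge c_0\log_2 N$ for a suitable absolute constant $c_0$, where each letter and the length of each query string fit into one word, the problem can be solved using $O(N\log N)$ words of space with worst-case query time $$O\Big(|\sigma_1|+|\sigma_2|+\big(\sqrt{N\log N\cdot\max(1,output)}+output\big)\log^2 N\Big).$$ That is, there are one fixed query program and absolute constants such that for every $D$ and $w$ as above there is a memory of $O(N\log N)$ words (index and working space together, the read-only query strings not counted), prepared from $D$, from which the program answers every query within this number of steps, reporting each index of the answer exactly once, and leaves the memory in a state that again serves all queries within the same bounds. -/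

import Mathlib

/-! ### The word RAM -/

namespace WordRAM

/-- The binary operations of the machine. -/
inductive BinOp
  | add | sub | mul | div | mod | and | or | xor | shl | shr

/-- The value of a binary operation, before it is reduced modulo `2 ^ w`.
(Subtraction is truncated at `0`, and division by `0` gives `0`.) -/
def BinOp.eval : BinOp → ℕ → ℕ → ℕ
  | .add, a, b => a + b
  | .sub, a, b => a - b
  | .mul, a, b => a * b
  | .div, a, b => a / b
  | .mod, a, b => a % b
  | .and, a, b => a &&& b
  | .or, a, b => a ||| b
  | .xor, a, b => a ^^^ b
  | .shl, a, b => a <<< b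
  | .shr, a, b => a >>> b

/-- Instructions. The arguments `d a b s` are names of registers; `t` is a position in the
program; the flag `k` selects the first (`false`) or the second (`true`) query string. -/
inductive Instr
  /-- `R[d] := n` -/
  | const (d n : ℕ)
  /-- `R[d] := R[a] op R[b]` -/
  | op (o : BinOp) (d a b : ℕ)
  /-- `R[d] := Mem[R[a]]` -/
  | load (d a : ℕ)
  /-- `Mem[R[a]] := R[s]` -/
  | store (a s : ℕ)
  /-- `R[d] :=` the letter at position `R[a]` of the selected query string -/
  | letter (k : Bool) (d a : ℕ)
  /-- `R[d] :=` the length of the selected query string -/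
  | length (k : Bool) (d : ℕ)
  /-- append `R[s]` to the output -/
  | report (s : ℕ)
  /-- go to `t` if `R[a] < R[b]` -/
  | jumpLT (a b t : ℕ)
  /-- go to `t` if `R[a] = R[b]` -/
  | jumpEQ (a b t : ℕ)
  /-- stop -/
  | halt

/-- A program is a finite list of instructions. -/
abbrev Program := List Instr

/-- What stays fixed during a run: the word size `w` in bits, the number `M` of memory cells
(addresses `0, …, M - 1`), and the two query strings, which are read-only. -/
structure Env where
  w : ℕ
  M : ℕ
  query₁ : List ℕ
  query₂ : List ℕ

/-- The query string selected by a flag. -/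
def Env.query (E : Env) : Bool → List ℕ
  | false => E.query₁
  | true => E.query₂

/-- A configuration: program counter, registers, memory, and the numbers reported so far
(the latest one first). -/
structure Config where
  pc : ℕ
  reg : ℕ → ℕ
  mem : ℕ → ℕ
  out : List ℕ

/-- The configuration at the start of a query: the registers are `0`, nothing is reported. -/
def Config.start (m : ℕ → ℕ) : Config where
  pc := 0
  reg := fun _ => 0
  mem := m
  out := []

/-- Write a number into a register, reduced modulo `2 ^ w`, and go to the next instruction. -/
def Config.write (E : Env) (c : Config) (d n : ℕ) : Config :=
  { c with pc := c.pc + 1, reg := Function.update c.reg d (n % 2 ^ E.w) }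

/-- Execution of one instruction. There is no next configuration after `halt`, nor after a fault:
an access outside the `M` memory cells, or beyond the end of a query string. -/
def Instr.exec (E : Env) (c : Config) : Instr → Option Config
  | .const d n => some (c.write E d n)
  | .op o d a b => some (c.write E d (o.eval (c.reg a) (c.reg b)))
  | .load d a => if c.reg a < E.M then some (c.write E d (c.mem (c.reg a))) else none
  | .store a s =>
      if c.reg a < E.M then
        some { c with pc := c.pc + 1, mem := Function.update c.mem (c.reg a) (c.reg s) }
      else none
  | .letter k d a => ((E.query k)[c.reg a]?).map (fun x => c.write E d x)
  | .length k d => some (c.write E d (E.query k).length)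
  | .report s => some { c with pc := c.pc + 1, out := c.reg s :: c.out }
  | .jumpLT a b t => some { c with pc := if c.reg a < c.reg b then t else c.pc + 1 }
  | .jumpEQ a b t => some { c with pc := if c.reg a = c.reg b then t else c.pc + 1 }
  | .halt => none

/-- One step of a program. Running off the end of the program is a fault. -/
def step (P : Program) (E : Env) (c : Config) : Option Config :=
  (P[c.pc]?).bind (fun i => i.exec E c)

/-- The configuration after exactly `t` steps, if no halt or fault comes before. -/
def run (P : Program) (E : Env) : ℕ → Config → Option Config
  | 0, c => some c
  | t + 1, c => (step P E c).bind (run P E t)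

/-- From `c` the program arrives after exactly `t` steps at a `halt` instruction,
in configuration `c'`. -/
def HaltsIn (P : Program) (E : Env) (c : Config) (t : ℕ) (c' : Config) : Prop :=
  run P E t c = some c' ∧ P[c'.pc]? = some Instr.halt

end WordRAM

/-! ### Two-dimensional substring indexing -/

namespace SubstringIndexing

/-- A database: a finite sequence of string pairs. A letter is a natural number, a string is a
list of letters. -/
abbrev Database := List (List ℕ × List ℕ)

/-- The size of a database: the total length of its strings. -/
def Database.size (D : Database) : ℕ :=
  (D.map (fun p => p.1.length + p.2.length)).sum

/-- The (0-based) indices of the pairs of `D` whose first component contains `σ₁` as a substring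
and whose second component contains `σ₂` as a substring. -/
def answer (D : Database) (σ₁ σ₂ : List ℕ) : Finset ℕ :=
  (Finset.range D.length).filter
    (fun i => ∃ p, D[i]? = some p ∧ σ₁ <:+: p.1 ∧ σ₂ <:+: p.2)

/-- Every letter of the string fits into a word of `w` bits. -/
def FitsWord (w : ℕ) (s : List ℕ) : Prop := ∀ x ∈ s, x < 2 ^ w

/-- `m` is an index for the database `D`: a memory of `M` words of `w` bits from which `P` answers
every query correctly. Here `σ₁, σ₂` run through all strings whose letters and length fit into a
word; the run reports each index of the answer exactly once and nothing else, takes at most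
`T σ₁ σ₂` steps, and leaves the memory in a state of `S`. With `S` a set of indices this makes
the structure able to answer any number of queries one after the other. -/
structure IsIndex (P : WordRAM.Program) (D : Database) (w M : ℕ) (T : List ℕ → List ℕ → ℝ)
    (S : Set (ℕ → ℕ)) (m : ℕ → ℕ) : Prop where
  word : ∀ a < M, m a < 2 ^ w
  query : ∀ σ₁ σ₂ : List ℕ, FitsWord w σ₁ → FitsWord w σ₂ →
    σ₁.length < 2 ^ w → σ₂.length < 2 ^ w →
    ∃ (t : ℕ) (c : WordRAM.Config),
      WordRAM.HaltsIn P ⟨w, M, σ₁, σ₂⟩ (WordRAM.Config.start m) t c ∧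
      c.out.Nodup ∧ c.out.toFinset = answer D σ₁ σ₂ ∧
      (t : ℝ) ≤ T σ₁ σ₂ ∧
      c.mem ∈ S

end SubstringIndexing

/-! Take all suffixes of all first components, each coloured by the index of its pair, in the order
of a search tree. The suffixes that start with `σ₁` are consecutive, so their colours fill an
interval of an array `A₁`; the second components give `A₂` in the same way. A substring is a prefix
of a suffix (`exists_stringItems_iff`), so a query asks for the colours that occur both in an
interval of `A₁` and in an interval of `A₂`. Both arrays together have `N + 2c` entries, at most
`3N`.

The intervals come from a ternary search tree with path compression. Each round of the descent
consumes a letter of the query or halves the number of candidates, which gives `O(|σ| + log N)`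
rounds (`Trie.descend`). The skipped letters are compared afterwards with a single candidate, since
all candidates agree up to the length of the query (`searchCmd_spec`).

The common colours are found in a binary tree on the colours, balanced by their numbers of
occurrences and hence of logarithmic height (`exists_colorTree`). A node whose subtree has the
colours `Γ`, with `n` occurrences in both arrays, can test in `O(√n log N)` steps whether some
colour of `Γ` is common. For this, the positions with colours in `Γ` are cut into blocks of length
about `√n`. Less than a block sticks out at either end of an interval; these positions are tried one
by one, by binary search in the list of positions of their colour in the other array. For the whole
blocks a table of prefix counts of equally coloured pairs, with `O(n)` entries, decides by inclusion
and exclusion whether such a pair exists (`test_iff`). The walk enters a subtree only if its test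
succeeds (`ColorTree.walk`).

Let `k` be the output size. A visited node contains a reported colour, or is the root or the child
of a node that does. On one level at most `k` nodes contain a reported colour, and their weights add
up to `O(N)`; by Cauchy–Schwarz the sum of their `√n` is `O(√(N k))`. Summing over the levels and
multiplying by the cost of a binary search gives `√(N k) log² N` (`ColorTree.cost_le`), which is
even better than required. Each occurrence contributes to one record on each level, so the space is
`O(N log N)` (`ColorTree.space_le`).

Queries never write to the memory, so one memory serves all of them. The program is written in a
small structured language whose rules bound results and step counts together (`Ev`). -/

/-! ### A structured language for programs that only read the memory -/

namespace WordRAM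

/-- Structured commands that leave the memory unchanged. -/
inductive Cmd
  | skip
  | const (d n : ℕ)
  | op (o : BinOp) (d a b : ℕ)
  | load (d a : ℕ)
  | letter (k : Bool) (d a : ℕ)
  | length (k : Bool) (d : ℕ)
  | report (s : ℕ)
  | seq (s s' : Cmd)
  /-- if `R[a] < R[b]` then `s` else `s'` -/
  | ite (a b : ℕ) (s s' : Cmd)
  /-- while `R[a] < R[b]` do `s` -/
  | loop (a b : ℕ) (s : Cmd)

namespace Cmd

/-- Commands one after the other. -/
def block : List Cmd → Cmd
  | [] => skip
  | s :: l => seq s (block l)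

/-- The number of instructions of a compiled command. -/
def size : Cmd → ℕ
  | skip => 0
  | seq s s' => s.size + s'.size
  | ite _ _ s s' => s.size + s'.size + 2
  | loop _ _ s => s.size + 3
  | _ => 1

/-- The code of a command, to be placed at position `o` of a program. -/
def compile : Cmd → ℕ → Program
  | skip, _ => []
  | const d n, _ => [.const d n]
  | op o d a b, _ => [.op o d a b]
  | load d a, _ => [.load d a]
  | letter k d a, _ => [.letter k d a]
  | length k d, _ => [.length k d]
  | report s, _ => [.report s]
  | seq s s', o => s.compile o ++ s'.compile (o + s.size)
  | ite a b s s', o =>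
      .jumpLT a b (o + (s'.size + 2)) :: (s'.compile (o + 1) ++
        .jumpEQ 0 0 (o + (s.size + s'.size + 2)) :: s.compile (o + (s'.size + 2)))
  | loop a b s, o =>
      .jumpLT a b (o + 2) :: .jumpEQ 0 0 (o + (s.size + 3)) :: (s.compile (o + 2) ++
        [.jumpEQ 0 0 o])

theorem length_compile (s : Cmd) : ∀ o, (s.compile o).length = s.size := by
  induction s <;> intro o <;> (simp_all [compile, size]; try omega)

end Cmd

/-- The part of a configuration that commands can change. -/
structure State where
  reg : ℕ → ℕ
  out : List ℕ

/-- Assign a value to a register. -/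
def State.set (σ : State) (d x : ℕ) : State := ⟨Function.update σ.reg d x, σ.out⟩

@[simp] theorem State.set_reg (σ : State) (d x r : ℕ) :
    (σ.set d x).reg r = if r = d then x else σ.reg r := by
  simp [State.set, Function.update_apply]

@[simp] theorem State.set_out (σ : State) (d x : ℕ) : (σ.set d x).out = σ.out := rfl

/-- `Exec E m s σ t σ'`: with the memory `m`, the command `s` leads from `σ` to `σ'`
in `t` steps. -/
inductive Exec (E : Env) (m : ℕ → ℕ) : Cmd → State → ℕ → State → Prop
  | skip (σ) : Exec E m .skip σ 0 σ
  | const (d n σ) : Exec E m (.const d n) σ 1 (σ.set d (n % 2 ^ E.w))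
  | op (o d a b σ) :
      Exec E m (.op o d a b) σ 1 (σ.set d (o.eval (σ.reg a) (σ.reg b) % 2 ^ E.w))
  | load (d a σ) : σ.reg a < E.M →
      Exec E m (.load d a) σ 1 (σ.set d (m (σ.reg a) % 2 ^ E.w))
  | letter (k d a σ x) : (E.query k)[σ.reg a]? = some x →
      Exec E m (.letter k d a) σ 1 (σ.set d (x % 2 ^ E.w))
  | length (k d σ) :
      Exec E m (.length k d) σ 1 (σ.set d ((E.query k).length % 2 ^ E.w))
  | report (s σ) : Exec E m (.report s) σ 1 ⟨σ.reg, σ.reg s :: σ.out⟩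
  | seq {s s' σ t σ' t' σ''} : Exec E m s σ t σ' → Exec E m s' σ' t' σ'' →
      Exec E m (.seq s s') σ (t + t') σ''
  | ite_pos {a b s s' σ t σ'} : σ.reg a < σ.reg b → Exec E m s σ t σ' →
      Exec E m (.ite a b s s') σ (t + 1) σ'
  | ite_neg {a b s s' σ t σ'} : ¬ σ.reg a < σ.reg b → Exec E m s' σ t σ' →
      Exec E m (.ite a b s s') σ (t + 2) σ'
  | loop_pos {a b s σ t σ' t' σ''} : σ.reg a < σ.reg b → Exec E m s σ t σ' →
      Exec E m (.loop a b s) σ' t' σ'' → Exec E m (.loop a b s) σ (t + 2 + t') σ''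
  | loop_neg {a b s σ} : ¬ σ.reg a < σ.reg b → Exec E m (.loop a b s) σ 2 σ

theorem run_add (P : Program) (E : Env) (t t' : ℕ) (c c' : Config)
    (h : run P E t c = some c') : run P E (t + t') c = run P E t' c' := by
  induction t generalizing c with
  | zero => simp only [run, Option.some.injEq] at h; simp [h]
  | succ t ih =>
    rw [Nat.add_right_comm]
    simp only [run] at h ⊢
    cases hs : step P E c with
    | none => simp [hs] at h
    | some d => simp only [hs, Option.bind_some] at h ⊢; exact ih d h

theorem run_one (P : Program) (E : Env) (c : Config) (i : Instr) (h : P[c.pc]? = some i) :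
    run P E 1 c = i.exec E c := by
  simp only [run, step, h, Option.bind_some]
  cases i.exec E c <;> rfl

/-- A compiled command does what the command means. -/
theorem Exec.run {E : Env} {m : ℕ → ℕ} {s : Cmd} {σ σ' : State} {t : ℕ}
    (h : Exec E m s σ t σ') : ∀ (P : Program) (o : ℕ),
      (∀ i < s.size, P[o + i]? = (s.compile o)[i]?) →
      run P E t ⟨o, σ.reg, m, σ.out⟩ = some ⟨o + s.size, σ'.reg, m, σ'.out⟩ := by
  induction h with
  | skip σ => intro P o _; simp [WordRAM.run, Cmd.size]
  | const d n σ =>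
    intro P o hP
    rw [run_one P E _ (.const d n) (by simpa [Cmd.size, Cmd.compile] using hP 0)]
    simp [Instr.exec, Config.write, Cmd.size, State.set]
  | op p d a b σ =>
    intro P o hP
    rw [run_one P E _ (.op p d a b) (by simpa [Cmd.size, Cmd.compile] using hP 0)]
    simp [Instr.exec, Config.write, Cmd.size, State.set]
  | load d a σ h =>
    intro P o hP
    rw [run_one P E _ (.load d a) (by simpa [Cmd.size, Cmd.compile] using hP 0)]
    simp [Instr.exec, Config.write, Cmd.size, State.set, h]
  | letter k d a σ x h =>
    intro P o hP
    rw [run_one P E _ (.letter k d a) (by simpa [Cmd.size, Cmd.compile] using hP 0)]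
    simp [Instr.exec, Config.write, Cmd.size, State.set, h]
  | length k d σ =>
    intro P o hP
    rw [run_one P E _ (.length k d) (by simpa [Cmd.size, Cmd.compile] using hP 0)]
    simp [Instr.exec, Config.write, Cmd.size, State.set]
  | report s σ =>
    intro P o hP
    rw [run_one P E _ (.report s) (by simpa [Cmd.size, Cmd.compile] using hP 0)]
    simp [Instr.exec, Cmd.size]
  | @seq s s' σ t σ' t' σ'' _ _ ih ih' =>
    intro P o hP
    simp only [Cmd.size] at hP ⊢
    rw [run_add P E t t' _ _ (ih P o ?_), ih' P (o + s.size) ?_, Nat.add_assoc]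
    · intro i hi
      have := hP (s.size + i) (by omega)
      rw [Cmd.compile, List.getElem?_append_right (by simp [Cmd.length_compile]),
        Cmd.length_compile, Nat.add_sub_cancel_left, ← Nat.add_assoc] at this
      exact this
    · intro i hi
      rw [hP i (by omega), Cmd.compile, List.getElem?_append_left (by simpa [Cmd.length_compile])]
  | @ite_pos a b s s' σ t σ' h _ ih =>
    intro P o hP
    simp only [Cmd.size] at hP ⊢
    rw [Nat.add_comm t 1, run_add P E 1 t _ ⟨o + (s'.size + 2), σ.reg, m, σ.out⟩,
      ih P (o + (s'.size + 2)) ?_]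
    · simp only [Option.some.injEq, Config.mk.injEq, and_true]; omega
    · intro i hi
      have := hP (s'.size + 2 + i) (by omega)
      rw [← Nat.add_assoc] at this
      rw [this, Cmd.compile, show s'.size + 2 + i = (s'.size + (1 + i)) + 1 by omega,
        List.getElem?_cons_succ, List.getElem?_append_right (by simp [Cmd.length_compile]),
        Cmd.length_compile, Nat.add_sub_cancel_left, Nat.add_comm 1 i, List.getElem?_cons_succ]
    · rw [run_one P E _ (.jumpLT a b (o + (s'.size + 2)))
        (by simpa [Cmd.compile] using hP 0 (by omega))]
      simp [Instr.exec, h]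
  | @ite_neg a b s s' σ t σ' h _ ih =>
    intro P o hP
    simp only [Cmd.size] at hP ⊢
    -- A register equals itself, so `jumpEQ 0 0` is an unconditional jump. Here it leads over the
    -- code of the other branch and is the second of the two extra steps.
    rw [show t + 2 = 1 + (t + 1) by omega,
      run_add P E 1 (t + 1) _ ⟨o + 1, σ.reg, m, σ.out⟩,
      run_add P E t 1 _ _ (ih P (o + 1) ?_),
      run_one P E _ (.jumpEQ 0 0 (o + (s.size + s'.size + 2)))]
    · simp [Instr.exec]
    · have := hP (s'.size + 1) (by omega)
      rw [Cmd.compile, List.getElem?_cons_succ,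
        List.getElem?_append_right (by simp [Cmd.length_compile]), Cmd.length_compile,
        Nat.sub_self, List.getElem?_cons_zero] at this
      rw [← this]
      show P[o + 1 + s'.size]? = _
      congr 1; omega
    · intro i hi
      have := hP (i + 1) (by omega)
      rw [Cmd.compile, List.getElem?_cons_succ,
        List.getElem?_append_left (by simpa [Cmd.length_compile])] at this
      rw [← this]; congr 1; omega
    · rw [run_one P E _ (.jumpLT a b (o + (s'.size + 2)))
        (by simpa [Cmd.compile] using hP 0 (by omega))]
      simp [Instr.exec, h]
  | @loop_pos a b s σ t σ' t' σ'' h _ _ ih ih' =>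
    intro P o hP
    have hP' := hP
    simp only [Cmd.size] at hP
    rw [show t + 2 + t' = 1 + (t + (1 + t')) by omega,
      run_add P E 1 _ _ ⟨o + 2, σ.reg, m, σ.out⟩,
      run_add P E t _ _ _ (ih P (o + 2) ?_),
      run_add P E 1 _ _ ⟨o, σ'.reg, m, σ'.out⟩, ih' P o hP']
    · rw [run_one P E _ (.jumpEQ 0 0 o)]
      · simp [Instr.exec]
      · have := hP (s.size + 2) (by omega)
        rw [Cmd.compile, List.getElem?_cons_succ, List.getElem?_cons_succ,
          List.getElem?_append_right (by simp [Cmd.length_compile]), Cmd.length_compile,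
          Nat.sub_self, List.getElem?_cons_zero] at this
        rw [← this]
        show P[o + 2 + s.size]? = _
        congr 1; omega
    · intro i hi
      have := hP (i + 2) (by omega)
      rw [Cmd.compile, List.getElem?_cons_succ, List.getElem?_cons_succ,
        List.getElem?_append_left (by simpa [Cmd.length_compile])] at this
      rw [← this]; congr 1; omega
    · rw [run_one P E _ (.jumpLT a b (o + 2))
        (by simpa [Cmd.compile] using hP 0 (by omega))]
      simp [Instr.exec, h]
  | @loop_neg a b s σ h =>
    intro P o hP
    simp only [Cmd.size] at hP ⊢
    rw [show (2 : ℕ) = 1 + 1 from rfl,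
      run_add P E 1 1 _ ⟨o + 1, σ.reg, m, σ.out⟩,
      run_one P E _ (.jumpEQ 0 0 (o + (s.size + 3)))]
    · simp [Instr.exec]
    · have := hP 1 (by omega)
      rwa [Cmd.compile, List.getElem?_cons_succ, List.getElem?_cons_zero] at this
    · rw [run_one P E _ (.jumpLT a b (o + 2))
        (by simpa [Cmd.compile] using hP 0 (by omega))]
      simp [Instr.exec, h]

/-- A command, followed by `halt`, as a program. -/
def Cmd.program (s : Cmd) : Program := s.compile 0 ++ [.halt]

theorem Exec.haltsIn {E : Env} {m : ℕ → ℕ} {s : Cmd} {t : ℕ} {σ' : State}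
    (h : Exec E m s ⟨fun _ => 0, []⟩ t σ') :
    HaltsIn s.program E (Config.start m) t ⟨s.size, σ'.reg, m, σ'.out⟩ := by
  constructor
  · have := h.run s.program 0 (fun i hi => by
      rw [Cmd.program, Nat.zero_add, List.getElem?_append_left (by simpa [Cmd.length_compile])])
    simpa [Config.start] using this
  · simp [Cmd.program, Cmd.length_compile]

/-- `Ev E m s σ Q`: the command `s`, started in `σ`, terminates, and the number of steps and the
final state satisfy `Q`. -/
def Ev (E : Env) (m : ℕ → ℕ) (s : Cmd) (σ : State) (Q : ℕ → State → Prop) : Prop :=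
  ∃ t σ', Exec E m s σ t σ' ∧ Q t σ'

/-! ### Rules that prove termination, result and running time together -/

namespace Ev

variable {E : Env} {m : ℕ → ℕ} {s s' : Cmd} {σ : State} {Q Q' : ℕ → State → Prop} {d a b x : ℕ}

theorem mono (h : Ev E m s σ Q) (hQ : ∀ t σ', Q t σ' → Q' t σ') : Ev E m s σ Q' := by
  obtain ⟨t, σ', h, hq⟩ := h
  exact ⟨t, σ', h, hQ _ _ hq⟩

theorem skip (h : Q 0 σ) : Ev E m .skip σ Q := ⟨_, _, .skip σ, h⟩

/-- In this rule and in those for `op`, `load`, `letter` and `length` the size bound removes the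
reduction modulo `2 ^ E.w`. Later proofs compute with plain natural numbers. -/
theorem const {n : ℕ} (hn : n < 2 ^ E.w) (h : Q 1 (σ.set d n)) : Ev E m (.const d n) σ Q :=
  ⟨_, _, .const d n σ, by rwa [Nat.mod_eq_of_lt hn]⟩

theorem op {o : BinOp} (x : ℕ) (hx : o.eval (σ.reg a) (σ.reg b) = x) (hlt : x < 2 ^ E.w)
    (h : Q 1 (σ.set d x)) : Ev E m (.op o d a b) σ Q :=
  ⟨_, _, .op o d a b σ, by rwa [hx, Nat.mod_eq_of_lt hlt]⟩

theorem load (x : ℕ) (ha : σ.reg a < E.M) (hx : m (σ.reg a) = x) (hlt : x < 2 ^ E.w)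
    (h : Q 1 (σ.set d x)) : Ev E m (.load d a) σ Q :=
  ⟨_, _, .load d a σ ha, by rwa [hx, Nat.mod_eq_of_lt hlt]⟩

theorem letter {k : Bool} (x : ℕ) (hx : (E.query k)[σ.reg a]? = some x) (hlt : x < 2 ^ E.w)
    (h : Q 1 (σ.set d x)) : Ev E m (.letter k d a) σ Q :=
  ⟨_, _, .letter k d a σ x hx, by rwa [Nat.mod_eq_of_lt hlt]⟩

theorem length {k : Bool} (hlt : (E.query k).length < 2 ^ E.w)
    (h : Q 1 (σ.set d (E.query k).length)) : Ev E m (.length k d) σ Q :=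
  ⟨_, _, .length k d σ, by rwa [Nat.mod_eq_of_lt hlt]⟩

theorem report (h : Q 1 ⟨σ.reg, σ.reg a :: σ.out⟩) : Ev E m (.report a) σ Q :=
  ⟨_, _, .report a σ, h⟩

theorem nil (h : Q 0 σ) : Ev E m (.block []) σ Q := skip h

/-- The postcondition of the head is the claim about the tail, with the elapsed steps carried along.
A block is thus verified by symbolic execution, instruction by instruction. -/
theorem cons {l : List Cmd}
    (h : Ev E m s σ fun t σ' => Ev E m (.block l) σ' fun t' => Q (t + t')) :
    Ev E m (.block (s :: l)) σ Q := by
  obtain ⟨t, σ', h, t', σ'', h', hq⟩ := h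
  exact ⟨_, _, .seq h h', hq⟩

theorem ite (h : σ.reg a < σ.reg b → Ev E m s σ fun t => Q (t + 1))
    (h' : ¬ σ.reg a < σ.reg b → Ev E m s' σ fun t => Q (t + 2)) : Ev E m (.ite a b s s') σ Q := by
  by_cases hlt : σ.reg a < σ.reg b
  · obtain ⟨t, σ', h, hq⟩ := h hlt
    exact ⟨_, _, .ite_pos hlt h, hq⟩
  · obtain ⟨t, σ', h, hq⟩ := h' hlt
    exact ⟨_, _, .ite_neg hlt h, hq⟩

/-- A loop with an invariant `I n`, where `n` bounds the number of the remaining rounds. -/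
theorem loop (I : ℕ → State → Prop) (K n : ℕ) (h0 : I n σ)
    (hs : ∀ n σ, I n σ → σ.reg a < σ.reg b →
      1 ≤ n ∧ Ev E m s σ fun t σ' => t ≤ K ∧ I (n - 1) σ')
    (hQ : ∀ n' t σ', t ≤ n * (K + 2) + 2 → I n' σ' → ¬ σ'.reg a < σ'.reg b → Q t σ') :
    Ev E m (.loop a b s) σ Q := by
  suffices H : ∃ t σ', Exec E m (.loop a b s) σ t σ' ∧
      t ≤ n * (K + 2) + 2 ∧ (∃ n', I n' σ') ∧ ¬ σ'.reg a < σ'.reg b by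
    obtain ⟨t, σ', h, ht, ⟨n', hn'⟩, hlt⟩ := H
    exact ⟨t, σ', h, hQ n' t σ' ht hn' hlt⟩
  clear hQ
  induction n generalizing σ with
  | zero =>
    by_cases hlt : σ.reg a < σ.reg b
    · have := (hs 0 σ h0 hlt).1; omega
    · exact ⟨2, σ, .loop_neg hlt, by omega, ⟨0, h0⟩, hlt⟩
  | succ n ih =>
    by_cases hlt : σ.reg a < σ.reg b
    · obtain ⟨-, t, σ', h, ht, hI⟩ := hs (n + 1) σ h0 hlt
      obtain ⟨t', σ'', h', ht', hI', hlt'⟩ := ih hI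
      refine ⟨_, _, .loop_pos hlt h h', ?_, hI', hlt'⟩
      rw [Nat.succ_mul]; omega
    · exact ⟨2, σ, .loop_neg hlt, by omega, ⟨_, h0⟩, hlt⟩

end Ev

end WordRAM

namespace WordRAM

/-! ### Sorted lists in the memory -/

/-- The memory `m` of `M` cells holds the list `l` from address `p` on. -/
def Stored (m : ℕ → ℕ) (M p : ℕ) (l : List ℕ) : Prop :=
  p + l.length ≤ M ∧ ∀ i (h : i < l.length), m (p + i) = l[i]

theorem Stored.append_iff {m : ℕ → ℕ} {M p : ℕ} {l l' : List ℕ} :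
    Stored m M p (l ++ l') ↔ Stored m M p l ∧ Stored m M (p + l.length) l' := by
  constructor
  · rintro ⟨h, h'⟩
    rw [List.length_append] at h
    refine ⟨⟨by omega, fun i hi => ?_⟩, ⟨by omega, fun i hi => ?_⟩⟩
    · rw [h' i (by rw [List.length_append]; omega), List.getElem_append_left hi]
    · rw [Nat.add_assoc, h' (l.length + i) (by rw [List.length_append]; omega),
        List.getElem_append_right (by omega)]
      simp
  · rintro ⟨⟨h, h1⟩, ⟨h', h2⟩⟩
    refine ⟨by rw [List.length_append]; omega, fun i hi => ?_⟩
    by_cases hlt : i < l.length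
    · rw [h1 i hlt, List.getElem_append_left hlt]
    · rw [List.length_append] at hi
      rw [List.getElem_append_right (by omega), ← h2 (i - l.length) (by omega)]
      congr 1; omega

theorem Stored.cons_iff {m : ℕ → ℕ} {M p x : ℕ} {l : List ℕ} :
    Stored m M p (x :: l) ↔ (p < M ∧ m p = x) ∧ Stored m M (p + 1) l := by
  rw [show x :: l = [x] ++ l from rfl, Stored.append_iff]
  refine and_congr ⟨fun h => ⟨by simpa using h.1, by simpa using h.2 0 (by simp)⟩, fun h => ?_⟩
    Iff.rfl
  refine ⟨by simpa using h.1, fun i hi => ?_⟩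
  obtain rfl : i = 0 := by simpa using hi
  simpa using h.2

/-- The number of elements of `l` below `x`. -/
def rk (l : List ℕ) (x : ℕ) : ℕ := l.countP (· < x)

theorem rk_le (l : List ℕ) (x : ℕ) : rk l x ≤ l.length := List.countP_le_length

theorem rk_mono (l : List ℕ) {x y : ℕ} (h : x ≤ y) : rk l x ≤ rk l y :=
  List.countP_mono_left fun z _ hz => by simp only [decide_eq_true_eq] at hz ⊢; omega

/-- In an increasing list the elements below `x` form an initial segment, so their number is also
the index at which they end. -/
theorem getElem_lt_iff_lt_rk {l : List ℕ} (hl : l.Pairwise (· < ·)) (x : ℕ) :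
    ∀ (i : ℕ) (h : i < l.length), l[i] < x ↔ i < rk l x := by
  induction l with
  | nil => intro i h; simp at h
  | cons y l ih =>
    intro i h
    rw [List.pairwise_cons] at hl
    have key : ¬ y < x → rk (y :: l) x = 0 := by
      intro hy
      rw [rk, List.countP_eq_zero]
      intro z hz
      rcases List.mem_cons.1 hz with rfl | hz
      · simpa using hy
      · have := hl.1 z hz; simp only [decide_eq_true_eq]; omega
    by_cases hy : y < x
    · have h1 : rk (y :: l) x = rk l x + 1 := by simp [rk, hy]
      cases i with
      | zero => simp [h1, hy]
      | succ i =>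
        rw [List.getElem_cons_succ, ih hl.2, h1]; omega
    · rw [key hy]
      cases i with
      | zero => simpa using hy
      | succ i =>
        have := hl.1 _ (List.getElem_mem (l := l) (n := i) (by simpa using h))
        rw [List.getElem_cons_succ]; omega

/-- The exit condition of the binary search, that everything before `k` is below `x` and nothing
from `k` on, determines `k`. -/
theorem eq_rk {l : List ℕ} (hl : l.Pairwise (· < ·)) {x k : ℕ} (hk : k ≤ l.length)
    (h : ∀ i (hi : i < l.length), l[i] < x ↔ i < k) : k = rk l x := by
  have hr := rk_le l x
  rcases lt_trichotomy k (rk l x) with h' | h' | h'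
  · have := (h k (by omega)).1 ((getElem_lt_iff_lt_rk hl x k (by omega)).2 h'); omega
  · exact h'
  · have := (getElem_lt_iff_lt_rk hl x (rk l x) (by omega)).1 ((h _ (by omega)).2 h'); omega

/-- Reduces the question whether a list meets an interval to two ranks, hence to two binary
searches. The difference of the counts is the number of elements in the interval, so no order is
needed. -/
theorem rk_lt_rk_iff (l : List ℕ) (a b : ℕ) : rk l a < rk l b ↔ ∃ x ∈ l, a ≤ x ∧ x < b := by
  constructor
  · intro h
    by_contra hne
    push Not at hne
    refine absurd (List.countP_mono_left (l := l) (p := (· < b)) (q := (· < a)) ?_) (by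
      simpa [rk] using h)
    intro x hx hb
    simp only [decide_eq_true_eq] at hb ⊢
    by_contra ha
    exact absurd (hne x hx (by omega)) (by omega)
  · rintro ⟨x, hx, ha, hb⟩
    obtain ⟨s, t, rfl⟩ := List.append_of_mem hx
    have h1 := rk_mono s (show a ≤ b by omega)
    have h2 := rk_mono t (show a ≤ b by omega)
    simp only [rk, List.countP_append, List.countP_cons] at *
    simp only [decide_eq_true hb, decide_eq_false (show ¬ x < a by omega)]
    simp; omega

/-- The memory holds the sorted list `l`, preceded by its length, from address `p` on. -/
def SortedAt (m : ℕ → ℕ) (M p : ℕ) (l : List ℕ) : Prop :=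
  Stored m M p (l.length :: l) ∧ l.Pairwise (· < ·)

/-- The cells of the memory hold words, and addresses fit into words generously. -/
structure Sound (E : Env) (m : ℕ → ℕ) : Prop where
  word : ∀ a < E.M, m a < 2 ^ E.w
  addr : 2 * E.M < 2 ^ E.w
  large : 8 ≤ E.M

/-- Binary search in the sorted list at address `R[1]`: the number of elements below `R[2]` is
computed in `R[0]`. -/
def rankCmd : Cmd := .block [
  .load 3 1, .const 6 1, .const 7 2, .const 0 0,
  .loop 0 3 (.block [
    .op .add 4 0 3, .op .div 4 4 7, .op .add 5 1 4, .op .add 5 5 6, .load 5 5,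
    .ite 5 2 (.op .add 0 4 6) (.op .or 3 4 4)])]

/-- The gap `hi - lo` halves in each round, so the exponent `n` in `hi - lo < 2 ^ n` bounds the
remaining rounds. As everywhere in the program, `or` of a register with itself is a move. Registers
from `8` on are untouched, which lets callers keep their data there. -/
theorem rankCmd_spec {E : Env} {m : ℕ → ℕ} (hS : Sound E m) {σ : State} {p x L : ℕ} {l : List ℕ}
    (hl : SortedAt m E.M p l) (h1 : σ.reg 1 = p) (h2 : σ.reg 2 = x) (hL : l.length < 2 ^ L) :
    Ev E m rankCmd σ fun t σ' => t ≤ 10 * L + 6 ∧ σ'.reg 0 = rk l x ∧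
      (∀ r, 8 ≤ r → σ'.reg r = σ.reg r) ∧ σ'.out = σ.out := by
  obtain ⟨hl, hs⟩ := hl
  obtain ⟨⟨hp, hlen⟩, hl⟩ := Stored.cons_iff.1 hl
  obtain ⟨hM, hl⟩ := hl
  have hw := hS.addr
  have h8 := hS.large
  refine Ev.cons (Ev.load l.length (by omega) (by rw [h1, hlen]) (by omega) ?_)
  refine Ev.cons (Ev.const (by omega) (Ev.cons (Ev.const (by omega) (Ev.cons
    (Ev.const (by omega) (Ev.cons ?_))))))
  refine Ev.loop (fun n σ' => ∃ lo hi, σ'.reg 0 = lo ∧ σ'.reg 3 = hi ∧ σ'.reg 1 = p ∧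
    σ'.reg 2 = x ∧ σ'.reg 6 = 1 ∧ σ'.reg 7 = 2 ∧ lo ≤ hi ∧ hi ≤ l.length ∧ hi - lo < 2 ^ n ∧
    (∀ i (h : i < l.length), i < lo → l[i] < x) ∧
    (∀ i (h : i < l.length), hi ≤ i → ¬ l[i] < x) ∧
    (∀ r, 8 ≤ r → σ'.reg r = σ.reg r) ∧ σ'.out = σ.out) 8 L ?_ ?_ ?_
  · refine ⟨0, l.length, by simp, by simp, by simp [h1], by simp [h2], by simp, by simp,
      by omega, le_rfl, by omega, by simp, fun i h h' => by omega, fun r hr => ?_, rfl⟩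
    simp only [State.set_reg]
    rw [if_neg, if_neg, if_neg, if_neg] <;> omega
  · rintro n τ ⟨lo, hi, e0, e3, e1, e2, e6, e7, hlh, hhl, hn, hlo, hhi, hr, ho⟩ hlt
    have hmid : (lo + hi) / 2 < hi := by omega
    refine ⟨?_, ?_⟩
    · rcases n with _ | n
      · simp at hn; omega
      · omega
    obtain ⟨n, rfl⟩ : ∃ k, n = k + 1 := by
      rcases n with _ | n
      · simp at hn; omega
      · exact ⟨n, rfl⟩
    rw [pow_succ] at hn
    have hval := hl ((lo + hi) / 2) (by omega)
    refine Ev.cons (Ev.op (lo + hi) (by simp [BinOp.eval, e0, e3]) (by omega) ?_)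
    refine Ev.cons (Ev.op ((lo + hi) / 2) (by simp [BinOp.eval, e7]) (by omega) ?_)
    refine Ev.cons (Ev.op (p + (lo + hi) / 2) (by simp [BinOp.eval, e1]) (by omega) ?_)
    refine Ev.cons (Ev.op (p + (lo + hi) / 2 + 1) (by simp [BinOp.eval, e6]) (by omega) ?_)
    refine Ev.cons (Ev.load (l[(lo + hi) / 2]'(by omega)) (by simp; omega) ?_ ?_ ?_)
    · rw [← hval]; simp; congr 1; omega
    · rw [← hval]; exact hS.word _ (by omega)
    have hmono : ∀ (i j : ℕ) (hi : i < l.length) (hj : j < l.length), i ≤ j → l[i] ≤ l[j] := by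
      intro i j hi hj hij
      rcases hij.eq_or_lt with rfl | hij
      · exact le_rfl
      · exact (List.pairwise_iff_getElem.1 hs i j hi hj hij).le
    refine Ev.cons (Ev.ite (fun hc => ?_) (fun hc => ?_))
    · simp [e2] at hc
      refine Ev.op ((lo + hi) / 2 + 1) (by simp [BinOp.eval, e6]) (by omega) (Ev.nil ?_)
      refine ⟨by omega, (lo + hi) / 2 + 1, hi, by simp, by simp [e3], by simp [e1], by simp [e2],
        by simp [e6], by simp [e7], by omega, hhl, by simp only [Nat.add_sub_cancel]; omega,
        fun i h h' => ?_, hhi, fun r hr' => ?_, by simp [ho]⟩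
      · exact (hmono i ((lo + hi) / 2) h (by omega) (by omega)).trans_lt hc
      · simp only [State.set_reg]
        rw [if_neg, if_neg, if_neg, if_neg, if_neg, if_neg] <;> first | omega | exact hr r hr'
    · simp [e2] at hc
      refine Ev.op ((lo + hi) / 2) (by simp [BinOp.eval]) (by omega) (Ev.nil ?_)
      refine ⟨by omega, lo, (lo + hi) / 2, by simp [e0], by simp, by simp [e1], by simp [e2],
        by simp [e6], by simp [e7], by omega, by omega, by simp only [Nat.add_sub_cancel]; omega,
        hlo, fun i h h' => ?_, fun r hr' => ?_, by simp [ho]⟩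
      · exact not_lt.2 (hc.trans (hmono ((lo + hi) / 2) i (by omega) h (by omega)))
      · simp only [State.set_reg]
        rw [if_neg, if_neg, if_neg, if_neg, if_neg, if_neg] <;> first | omega | exact hr r hr'
  · rintro n' t τ ht ⟨lo, hi, e0, e3, e1, e2, e6, e7, hlh, hhl, hn, hlo, hhi, hr, ho⟩ hlt
    refine Ev.nil ⟨by omega, ?_, hr, ho⟩
    rw [e0]
    exact eq_rk hs (by omega) fun i hi' => ⟨fun h => by
      by_contra hge; exact hhi i hi' (by omega) h, fun h => hlo i hi' h⟩

/-- If the sorted list at address `R[10]` has an element `x` with `R[11] ≤ x < R[12]`, then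
set the flag `R[13]`. -/
def checkCmd : Cmd := .block [
  .op .or 1 10 10, .op .or 2 11 11, rankCmd, .op .or 8 0 0,
  .op .or 1 10 10, .op .or 2 12 12, rankCmd, .ite 8 0 (.const 13 1) .skip]

/-- The flag is only ever set, never cleared, so that repeated checks accumulate a disjunction. -/
theorem checkCmd_spec {E : Env} {m : ℕ → ℕ} (hS : Sound E m) {σ : State} {p a b L : ℕ}
    {l : List ℕ} (hl : SortedAt m E.M p l) (hp : σ.reg 10 = p) (ha : σ.reg 11 = a)
    (hb : σ.reg 12 = b) (haw : a < 2 ^ E.w) (hbw : b < 2 ^ E.w) (hL : l.length < 2 ^ L) :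
    Ev E m checkCmd σ fun t σ' => t ≤ 20 * L + 20 ∧
      (0 < σ'.reg 13 ↔ 0 < σ.reg 13 ∨ ∃ x ∈ l, a ≤ x ∧ x < b) ∧
      (∀ r, 9 ≤ r → r ≠ 13 → σ'.reg r = σ.reg r) ∧ σ'.out = σ.out := by
  have hw := hS.addr
  have h8 := hS.large
  have hpM := (Stored.cons_iff.1 hl.1).1.1
  have hlM := (Stored.cons_iff.1 hl.1).2.1
  have hra := rk_le l a
  refine Ev.cons (Ev.op p (by simp [BinOp.eval, hp]) (by omega) ?_)
  refine Ev.cons (Ev.op a (by simp [BinOp.eval, ha]) (by omega) ?_)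
  refine Ev.cons ((rankCmd_spec hS hl (by simp) (by simp; rfl) hL).mono ?_)
  rintro t1 σ1 ⟨ht1, h1, hk1, ho1⟩
  refine Ev.cons (Ev.op (rk l a) (by simp [BinOp.eval, h1]) (by omega) ?_)
  refine Ev.cons (Ev.op p (by simp [BinOp.eval, hk1, hp]) (by omega) ?_)
  refine Ev.cons (Ev.op b (by simp [BinOp.eval, hk1, hb]) (by omega) ?_)
  refine Ev.cons ((rankCmd_spec hS hl (by simp) (by simp; rfl) hL).mono ?_)
  rintro t2 σ2 ⟨ht2, h2, hk2, ho2⟩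
  have e8 : σ2.reg 8 = rk l a := by simp [hk2]
  have hfr : ∀ r, 9 ≤ r → σ2.reg r = σ.reg r := by
    intro r hr
    rw [hk2 r (by omega)]
    simp only [State.set_reg]
    rw [if_neg, if_neg, if_neg, hk1 r (by omega)] <;> try omega
    simp only [State.set_reg]
    rw [if_neg, if_neg] <;> omega
  have ho : σ2.out = σ.out := by rw [ho2]; simpa using ho1
  refine Ev.cons (Ev.ite (fun hc => ?_) (fun hc => ?_))
  · rw [e8, h2, rk_lt_rk_iff] at hc
    refine Ev.const (by omega) (Ev.nil ⟨by omega, by simp [hc], fun r hr hr' => ?_, by simp [ho]⟩)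
    simp [hr', hfr r hr]
  · rw [e8, h2, rk_lt_rk_iff] at hc
    refine Ev.skip (Ev.nil ⟨by omega, by simp [hc, hfr], fun r hr hr' => ?_, ho⟩)
    exact hfr r hr

/-- Apply `checkCmd` to the sorted lists whose addresses are at the positions `i` with
`R[15] ≤ i < R[16]` of the list at address `R[14]`. -/
def scanCmd : Cmd :=
  .loop 15 16 (.block [.op .add 10 14 15, .load 10 10, checkCmd, .const 9 1, .op .add 15 15 9])

theorem scanCmd_spec {E : Env} {m : ℕ → ℕ} (hS : Sound E m) {σ : State} {p i j a b L : ℕ}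
    {ps : List ℕ} {g : ℕ → List ℕ} (hps : Stored m E.M p ps)
    (hg : ∀ k (h : k < ps.length), SortedAt m E.M ps[k] (g k) ∧ (g k).length < 2 ^ L)
    (h14 : σ.reg 14 = p) (h15 : σ.reg 15 = i) (h16 : σ.reg 16 = j) (ha : σ.reg 11 = a)
    (hb : σ.reg 12 = b) (haw : a < 2 ^ E.w) (hbw : b < 2 ^ E.w) (hj : j ≤ ps.length) :
    Ev E m scanCmd σ fun t σ' => t ≤ (j - i) * (20 * L + 26) + 2 ∧
      (0 < σ'.reg 13 ↔ 0 < σ.reg 13 ∨ ∃ k, i ≤ k ∧ k < j ∧ ∃ x ∈ g k, a ≤ x ∧ x < b) ∧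
      (∀ r, 16 ≤ r ∨ r = 11 ∨ r = 12 ∨ r = 14 → σ'.reg r = σ.reg r) ∧ σ'.out = σ.out := by
  have hw := hS.addr
  have h8 := hS.large
  have hpM := hps.1
  -- The alternative `i' = i` covers an empty range with `j < i`. It does occur: in `sideCmd` the
  -- last boundary can lie beyond the end of the interval.
  refine Ev.loop (fun n τ => ∃ i', τ.reg 15 = i' ∧ i ≤ i' ∧ j - i' ≤ n ∧ (i' ≤ j ∨ i' = i) ∧
    (0 < τ.reg 13 ↔ 0 < σ.reg 13 ∨ ∃ k, i ≤ k ∧ k < i' ∧ ∃ x ∈ g k, a ≤ x ∧ x < b) ∧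
    (∀ r, 16 ≤ r ∨ r = 11 ∨ r = 12 ∨ r = 14 → τ.reg r = σ.reg r) ∧ τ.out = σ.out)
    (20 * L + 24) (j - i) ?_ ?_ ?_
  · refine ⟨i, h15, le_rfl, le_rfl, .inr rfl, ?_, fun _ _ => rfl, rfl⟩
    refine ⟨.inl, ?_⟩
    rintro (h | ⟨k, h, h', -⟩)
    · exact h
    · omega
  · rintro n τ ⟨i', e15, hii, hn, hij, hf, hr, ho⟩ hlt
    rw [e15, hr 16 (by simp), h16] at hlt
    refine ⟨by omega, ?_⟩
    obtain ⟨hgk, hgl⟩ := hg i' (by omega)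
    have hgM := (Stored.cons_iff.1 hgk.1).1.1
    refine Ev.cons (Ev.op (p + i') (by simp [BinOp.eval, hr, h14, e15]) (by omega) ?_)
    refine Ev.cons (Ev.load (ps[i']'(by omega)) (by simp; omega)
      (by simpa using hps.2 i' (by omega)) (by omega) ?_)
    refine Ev.cons ((checkCmd_spec hS hgk (a := a) (b := b) (by simp) (by simp [hr, ha])
      (by simp [hr, hb]) haw hbw hgl).mono ?_)
    rintro t1 σ1 ⟨ht1, h1, hk1, ho1⟩
    refine Ev.cons (Ev.const (by omega) ?_)
    refine Ev.cons (Ev.op (i' + 1) (by simp [BinOp.eval, hk1, e15]) (by omega) (Ev.nil ?_))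
    refine ⟨by clear h1 hf; omega, i' + 1, by simp, by clear h1 hf; omega, by clear h1 hf; omega,
      by clear h1 hf; omega, ?_, fun r hr' => ?_,
      by simpa [ho] using ho1⟩
    · simp only [State.set_reg, Nat.reduceEqDiff, if_false] at h1 ⊢
      rw [h1, hf, or_assoc]
      refine or_congr Iff.rfl ⟨?_, ?_⟩
      · rintro (⟨k, h, h', hx⟩ | hx)
        · exact ⟨k, h, by omega, hx⟩
        · exact ⟨i', hii, by omega, hx⟩
      · rintro ⟨k, h, h', hx⟩
        rcases (Nat.lt_succ_iff.1 h').eq_or_lt with rfl | h'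
        · exact .inr hx
        · exact .inl ⟨k, h, h', hx⟩
    · simp only [State.set_reg]
      rw [if_neg, if_neg, hk1] <;> try omega
      simp only [State.set_reg]
      rw [if_neg, if_neg, hr r hr'] <;> omega
  · rintro n t τ ht ⟨i', e15, hii, hn, hij, hf, hr, ho⟩ hlt
    rw [e15, hr 16 (by simp), h16] at hlt
    refine ⟨by simpa using ht, ?_, hr, ho⟩
    rw [hf]
    refine or_congr Iff.rfl ⟨?_, ?_⟩
    · rintro ⟨k, h, h', hx⟩
      exact ⟨k, h, by omega, hx⟩
    · rintro ⟨k, h, h', hx⟩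
      exact ⟨k, h, by omega, hx⟩

end WordRAM

namespace WordRAM

/-! ### The emptiness test of a block of colours -/

/-- `R[d] := max R[d] R[b]` -/
def maxCmd (d b : ℕ) : Cmd := .ite d b (.op .or d b b) .skip

/-- `R[d] := min R[d] R[b]` -/
def minCmd (d b : ℕ) : Cmd := .ite b d (.op .or d b b) .skip

theorem State.set_self (σ : State) (d : ℕ) : σ.set d (σ.reg d) = σ := by
  simp [State.set]

theorem maxCmd_spec {E : Env} {m : ℕ → ℕ} {σ : State} {d b x y : ℕ} {Q : ℕ → State → Prop}
    (hx : σ.reg d = x) (hy : σ.reg b = y) (hb : y < 2 ^ E.w)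
    (h : ∀ t ≤ 3, Q t (σ.set d (max x y))) : Ev E m (maxCmd d b) σ Q := by
  subst hx hy
  refine Ev.ite (fun hc => ?_) (fun hc => ?_)
  · refine Ev.op (σ.reg b) (by simp [BinOp.eval]) hb ?_
    have := h 2 (by omega)
    rwa [max_eq_right hc.le] at this
  · refine Ev.skip ?_
    have := h 2 (by omega)
    rwa [max_eq_left (not_lt.1 hc), State.set_self] at this

theorem minCmd_spec {E : Env} {m : ℕ → ℕ} {σ : State} {d b x y : ℕ} {Q : ℕ → State → Prop}
    (hx : σ.reg d = x) (hy : σ.reg b = y) (hb : y < 2 ^ E.w)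
    (h : ∀ t ≤ 3, Q t (σ.set d (min x y))) : Ev E m (minCmd d b) σ Q := by
  subst hx hy
  refine Ev.ite (fun hc => ?_) (fun hc => ?_)
  · refine Ev.op (σ.reg b) (by simp [BinOp.eval]) hb ?_
    have := h 2 (by omega)
    rwa [min_eq_right hc.le] at this
  · refine Ev.skip ?_
    have := h 2 (by omega)
    rwa [min_eq_left (not_lt.1 hc), State.set_self] at this

/-- `R[18]` is the address of a sorted list `l` that is followed by the addresses of further
sorted lists, `[R[19], R[20])` cuts an interval out of `l`, and `R[21]` is a block length.
Compute the first and the last boundary between blocks inside of the interval in `R[22]` and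
`R[23]`, and apply `checkCmd` to the lists that belong to the elements of the interval before the
first and after the last boundary. -/
def sideCmd : Cmd := .block [
  .op .or 1 18 18, .op .or 2 19 19, rankCmd, .op .or 24 0 0,
  .op .or 1 18 18, .op .or 2 20 20, rankCmd, .op .or 25 0 0,
  .const 26 1, .op .add 22 24 21, .op .sub 22 22 26, .op .div 22 22 21,
  .op .div 23 25 21, maxCmd 23 22,
  .load 14 18, .op .add 14 14 18, .op .add 14 14 26,
  .op .or 15 24 24, .op .mul 16 22 21, minCmd 16 25, scanCmd,
  .op .mul 15 23 21, .op .or 16 25 25, scanCmd]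

set_option maxHeartbeats 400000 in
-- Rounding `ra` up and `rb` down to multiples of `B` leaves fewer than `B` elements on either side,
-- hence at most `2 * B` checks. If no boundary lies inside the interval, the first scan stops at
-- `rb` and covers everything; the maximum in `ib` then makes the range of whole blocks empty.
theorem sideCmd_spec {E : Env} {m : ℕ → ℕ} (hS : Sound E m) {σ : State}
    {p a b a' b' B L ra rb ia ib : ℕ} {l ps : List ℕ} {g : ℕ → List ℕ}
    (hl : Stored m E.M p (l.length :: (l ++ ps))) (hs : l.Pairwise (· < ·))
    (hlen : ps.length = l.length) (hL : l.length < 2 ^ L)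
    (hg : ∀ k (h : k < ps.length), SortedAt m E.M ps[k] (g k) ∧ (g k).length < 2 ^ L)
    (h18 : σ.reg 18 = p) (h19 : σ.reg 19 = a) (h20 : σ.reg 20 = b) (h11 : σ.reg 11 = a')
    (h12 : σ.reg 12 = b') (h21 : σ.reg 21 = B) (haw : a < 2 ^ E.w) (hbw : b < 2 ^ E.w)
    (haw' : a' < 2 ^ E.w) (hbw' : b' < 2 ^ E.w) (hB : 0 < B) (hBM : B ≤ E.M) (hab : a ≤ b)
    (hra : ra = rk l a) (hrb : rb = rk l b) (hia : ia = (ra + B - 1) / B)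
    (hib : ib = max (rb / B) ia) :
    Ev E m sideCmd σ fun t σ' => t ≤ 2 * B * (20 * L + 26) + 20 * L + 50 ∧
      σ'.reg 22 = ia ∧ σ'.reg 23 = ib ∧
      (0 < σ'.reg 13 ↔ 0 < σ.reg 13 ∨ ∃ k, (ra ≤ k ∧ k < min (ia * B) rb ∨ ib * B ≤ k ∧ k < rb) ∧
        ∃ x ∈ g k, a' ≤ x ∧ x < b') ∧
      (∀ r, 27 ≤ r ∨ r = 11 ∨ r = 12 ∨ r = 18 ∨ r = 21 → σ'.reg r = σ.reg r) ∧
      σ'.out = σ.out := by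
  have hw := hS.addr
  have h8 := hS.large
  obtain ⟨⟨hpM, hmp⟩, hl1⟩ := Stored.cons_iff.1 hl
  obtain ⟨hl2, hps⟩ := Stored.append_iff.1 hl1
  have hsort : SortedAt m E.M p l := ⟨Stored.cons_iff.2 ⟨⟨hpM, hmp⟩, hl2⟩, hs⟩
  have hlM := hl2.1
  have hpsM := hps.1
  have hral : ra ≤ l.length := hra ▸ rk_le l a
  have hrbl : rb ≤ l.length := hrb ▸ rk_le l b
  have hrab : ra ≤ rb := by rw [hra, hrb]; exact rk_mono l hab
  have hia1 : ia * B ≤ ra + B - 1 := by rw [hia]; exact Nat.div_mul_le_self _ _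
  have hia2 : ra ≤ ia * B := by
    have := Nat.lt_div_mul_add (a := ra + B - 1) hB
    rw [← hia] at this; omega
  have hia3 : ia ≤ ia * B := Nat.le_mul_of_pos_right _ hB
  have hrb1 : rb / B * B ≤ rb := Nat.div_mul_le_self _ _
  have hrb2 : rb < rb / B * B + B := Nat.lt_div_mul_add hB
  have hrb3 : rb / B ≤ rb := Nat.div_le_self _ _
  have hib1 : ib * B = max (rb / B * B) (ia * B) := by rw [hib, max_mul_of_nonneg _ _ hB.le]
  have hib2 : ib ≤ ib * B := Nat.le_mul_of_pos_right _ hB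
  have b1 : (min (ia * B) rb - ra) * (20 * L + 26) ≤ B * (20 * L + 26) :=
    Nat.mul_le_mul_right _ (by omega)
  have b2 : (rb - ib * B) * (20 * L + 26) ≤ B * (20 * L + 26) :=
    Nat.mul_le_mul_right _ (by omega)
  refine Ev.cons (Ev.op p (by simp [BinOp.eval, h18]) (by omega) ?_)
  refine Ev.cons (Ev.op a (by simp [BinOp.eval, h19]) (by omega) ?_)
  refine Ev.cons ((rankCmd_spec hS hsort (by simp) (by simp; rfl) hL).mono ?_)
  rintro t1 σ1 ⟨ht1, e1, hk1, ho1⟩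
  simp only [State.set_reg] at hk1
  refine Ev.cons (Ev.op ra (by simp [BinOp.eval, e1, hra]) (by omega) ?_)
  refine Ev.cons (Ev.op p (by simp [BinOp.eval, hk1, h18]) (by omega) ?_)
  refine Ev.cons (Ev.op b (by simp [BinOp.eval, hk1, h20]) (by omega) ?_)
  refine Ev.cons ((rankCmd_spec hS hsort (by simp) (by simp; rfl) hL).mono ?_)
  rintro t2 σ2 ⟨ht2, e2, hk2, ho2⟩
  simp only [State.set_reg] at hk2
  refine Ev.cons (Ev.op rb (by simp [BinOp.eval, e2, hrb]) (by omega) ?_)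
  refine Ev.cons (Ev.const (by omega) ?_)
  refine Ev.cons (Ev.op (ra + B) (by simp [BinOp.eval, hk1, hk2, h21]) (by omega) ?_)
  refine Ev.cons (Ev.op (ra + B - 1) (by simp [BinOp.eval]) (by omega) ?_)
  refine Ev.cons (Ev.op ia (by simp [BinOp.eval, hk1, hk2, h21, hia]) (by omega) ?_)
  refine Ev.cons (Ev.op (rb / B) (by simp [BinOp.eval, hk1, hk2, h21]) (by omega) ?_)
  refine Ev.cons (maxCmd_spec (x := rb / B) (y := ia) (by simp) (by simp) (by omega) ?_)
  intro t3 ht3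
  rw [← hib]
  refine Ev.cons (Ev.load l.length (by simp [hk1, hk2, h18, hpM])
    (by simp [hk1, hk2, h18, hmp]) (by omega) ?_)
  refine Ev.cons (Ev.op (l.length + p) (by simp [BinOp.eval, hk1, hk2, h18]) (by omega) ?_)
  refine Ev.cons (Ev.op (l.length + p + 1) (by simp [BinOp.eval]) (by omega) ?_)
  refine Ev.cons (Ev.op ra (by simp [BinOp.eval, hk2]) (by omega) ?_)
  refine Ev.cons (Ev.op (ia * B) (by simp [BinOp.eval, hk1, hk2, h21]) (by omega) ?_)
  refine Ev.cons (minCmd_spec (x := ia * B) (y := rb) (by simp) (by simp) (by omega) ?_)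
  intro t4 ht4
  have hps' : Stored m E.M (l.length + p + 1) ps := by
    rwa [show l.length + p + 1 = p + 1 + l.length by omega]
  refine Ev.cons ((scanCmd_spec hS (i := ra) (j := min (ia * B) rb) (a := a') (b := b')
    hps' hg (by simp) (by simp) (by simp) (by simp [hk1, hk2, h11])
    (by simp [hk1, hk2, h12]) haw' hbw' (by omega)).mono ?_)
  rintro t5 σ5 ⟨ht5, e5, hk5, ho5⟩
  simp only [State.set_reg] at hk5
  refine Ev.cons (Ev.op (ib * B) (by simp [BinOp.eval, hk5, hk1, hk2, h21]) (by omega) ?_)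
  refine Ev.cons (Ev.op rb (by simp [BinOp.eval, hk5]) (by omega) ?_)
  refine Ev.cons ((scanCmd_spec hS (i := ib * B) (j := rb) (a := a') (b := b')
    hps' hg (by simp [hk5]) (by simp) (by simp) (by simp [hk1, hk2, hk5, h11])
    (by simp [hk1, hk2, hk5, h12]) haw' hbw' (by omega)).mono ?_)
  rintro t6 σ6 ⟨ht6, e6, hk6, ho6⟩
  simp only [State.set_reg] at hk6
  refine Ev.nil ⟨?_, by simp [hk6, hk5], by simp [hk6, hk5], ?_, ?_, ?_⟩
  · replace ht5 := ht5.trans (Nat.add_le_add_right b1 2)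
    replace ht6 := ht6.trans (Nat.add_le_add_right b2 2)
    rw [Nat.mul_assoc]
    clear * - ht1 ht2 ht3 ht4 ht5 ht6
    generalize B * (20 * L + 26) = Z at *
    linarith
  · have f1 : σ1.reg 13 = σ.reg 13 := hk1 13 (by norm_num)
    have f2 : σ2.reg 13 = σ1.reg 13 := hk2 13 (by norm_num)
    simp only [State.set_reg, Nat.reduceEqDiff, if_false, f2, f1] at e5 e6
    refine e6.trans ((or_congr e5 Iff.rfl).trans (or_assoc.trans ?_))
    refine or_congr Iff.rfl ⟨?_, ?_⟩
    · rintro (⟨k, h, h', hx⟩ | ⟨k, h, h', hx⟩)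
      · exact ⟨k, .inl ⟨h, h'⟩, hx⟩
      · exact ⟨k, .inr ⟨h, h'⟩, hx⟩
    · rintro ⟨k, ⟨h, h'⟩ | ⟨h, h'⟩, hx⟩
      · exact .inl ⟨k, h, h', hx⟩
      · exact .inr ⟨k, h, h', hx⟩
  · clear e5 e6
    intro r hr
    have hne : ∀ s ∈ [1, 2, 14, 15, 16, 22, 23, 24, 25, 26], r ≠ s := by
      intro s hs
      simp only [List.mem_cons, List.not_mem_nil, or_false] at hs
      omega
    simp only [List.mem_cons, forall_eq_or_imp, List.not_mem_nil, false_imp_iff, implies_true,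
      and_true] at hne
    rw [hk6 r (by omega), if_neg hne.2.2.2.2.1, if_neg hne.2.2.2.1, hk5 r (by omega)]
    simp only [hne, if_false]
    rw [hk2 r (by omega)]
    simp only [hne, if_false]
    rw [hk1 r (by omega)]
    simp only [hne, if_false]
  · rw [ho6]; simp only [State.set_out]; rw [ho5]; simp only [State.set_out]
    rw [ho2]; simp only [State.set_out]; rw [ho1]; simp only [State.set_out]

end WordRAM

/-! ### Reading a node record: corner counts and the complete test -/

namespace WordRAM

theorem State.set_set (σ : State) (d x y : ℕ) : (σ.set d x).set d y = σ.set d y := by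
  simp [State.set]

/-- Load the entry at position `k` of the record at address `R[34]` into `R[d]`. -/
def fieldCmd (d k : ℕ) : Cmd := .block [.const 27 k, .op .add 27 34 27, .load d 27]

theorem fieldCmd_spec {E : Env} {m : ℕ → ℕ} (hS : Sound E m) {σ : State} {d k p x : ℕ}
    {r : List ℕ} {Q : ℕ → State → Prop} (hr : Stored m E.M p r) (hx : r[k]? = some x)
    (hp : σ.reg 34 = p) (h : Q 3 ((σ.set 27 (p + k)).set d x)) : Ev E m (fieldCmd d k) σ Q := by
  obtain ⟨hk, rfl⟩ := List.getElem?_eq_some_iff.1 hx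
  have hM := hr.1
  have hw := hS.addr
  have hm := hr.2 k hk
  refine Ev.cons (Ev.const (by omega) ?_)
  refine Ev.cons (Ev.op (p + k) (by simp [BinOp.eval, hp]) (by omega) ?_)
  refine Ev.cons (Ev.load r[k] (by simp; omega) (by simpa using hm)
    (hm ▸ hS.word _ (by omega)) (Ev.nil ?_))
  rwa [State.set_set]

/-- The part of `testCmd` that looks up the prefix counts at the corners of the block rectangle
given by `R[35], R[36]` and `R[22], R[23]`. -/
def cornerCmd : Cmd := .block [
  fieldCmd 37 8, fieldCmd 38 9,
  .op .mul 39 36 38, .op .add 39 39 37, .op .mul 40 35 38, .op .add 40 40 37,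
  .op .add 41 39 23, .load 41 41, .op .add 42 40 22, .load 42 42, .op .add 41 41 42,
  .op .add 42 40 23, .load 42 42, .op .add 43 39 22, .load 43 43, .op .add 42 42 43,
  .ite 42 41 (.const 13 1) .skip]

/-- Four entries of a row-major table with stride `st` are compared as two sums, which avoids
truncated subtraction. The factor `2` in the hypothesis on `F` is there because these sums must fit
into words. -/
theorem cornerCmd_spec {E : Env} {m : ℕ → ℕ} (hS : Sound E m) {σ : State}
    {p tb st ia ib ja jb : ℕ} {r : List ℕ} {F : ℕ → ℕ → ℕ}
    (hr : Stored m E.M p r) (h8 : r[8]? = some tb) (h9 : r[9]? = some st)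
    (hp : σ.reg 34 = p) (h35 : σ.reg 35 = ia) (h36 : σ.reg 36 = ib) (h22 : σ.reg 22 = ja)
    (h23 : σ.reg 23 = jb)
    (hF : ∀ i ∈ [ia, ib], ∀ j ∈ [ja, jb], i * st + tb + j < E.M ∧ m (i * st + tb + j) = F i j ∧
      2 * F i j < 2 ^ E.w) :
    Ev E m cornerCmd σ fun t σ' => t ≤ 23 ∧
      (0 < σ'.reg 13 ↔ 0 < σ.reg 13 ∨ F ia jb + F ib ja < F ib jb + F ia ja) ∧
      (∀ r, r ∉ [13, 27, 37, 38, 39, 40, 41, 42, 43] → σ'.reg r = σ.reg r) ∧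
      σ'.out = σ.out := by
  have hw := hS.addr
  have hl := hS.large
  simp only [List.mem_cons, List.not_mem_nil, or_false, forall_eq_or_imp, forall_eq] at hF
  obtain ⟨⟨⟨aa, ab, ac⟩, ⟨ba, bb, bc⟩⟩, ⟨ca, cb, cc⟩, ⟨da, db, dc⟩⟩ := hF
  refine Ev.cons (fieldCmd_spec hS hr h8 hp ?_)
  refine Ev.cons (fieldCmd_spec hS hr h9 (by simp [hp]) ?_)
  refine Ev.cons (Ev.op (ib * st) (by simp [BinOp.eval, h36]) (by omega) ?_)
  refine Ev.cons (Ev.op (ib * st + tb) (by simp [BinOp.eval]) (by omega) ?_)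
  refine Ev.cons (Ev.op (ia * st) (by simp [BinOp.eval, h35]) (by omega) ?_)
  refine Ev.cons (Ev.op (ia * st + tb) (by simp [BinOp.eval]) (by omega) ?_)
  refine Ev.cons (Ev.op (ib * st + tb + jb) (by simp [BinOp.eval, h23]) (by omega) ?_)
  refine Ev.cons (Ev.load (F ib jb) (by simpa using da) (by simpa using db) (by omega) ?_)
  refine Ev.cons (Ev.op (ia * st + tb + ja) (by simp [BinOp.eval, h22]) (by omega) ?_)
  refine Ev.cons (Ev.load (F ia ja) (by simpa using aa) (by simpa using ab) (by omega) ?_)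
  refine Ev.cons (Ev.op (F ib jb + F ia ja) (by simp [BinOp.eval]) (by omega) ?_)
  refine Ev.cons (Ev.op (ia * st + tb + jb) (by simp [BinOp.eval, h23]) (by omega) ?_)
  refine Ev.cons (Ev.load (F ia jb) (by simpa using ba) (by simpa using bb) (by omega) ?_)
  refine Ev.cons (Ev.op (ib * st + tb + ja) (by simp [BinOp.eval, h22]) (by omega) ?_)
  refine Ev.cons (Ev.load (F ib ja) (by simpa using ca) (by simpa using cb) (by omega) ?_)
  refine Ev.cons (Ev.op (F ia jb + F ib ja) (by simp [BinOp.eval]) (by omega) ?_)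
  refine Ev.cons (Ev.ite (fun hc => ?_) (fun hc => ?_))
  · simp at hc
    refine Ev.const (by omega) (Ev.nil ⟨by norm_num, by simp [hc], fun r hr => ?_, by simp⟩)
    simp only [List.mem_cons, List.not_mem_nil, or_false, not_or] at hr
    simp only [State.set_reg, hr, if_false]
  · simp at hc
    refine Ev.skip (Ev.nil ⟨by norm_num, by simp [hc], fun r hr => ?_, by simp⟩)
    simp only [List.mem_cons, List.not_mem_nil, or_false, not_or] at hr
    simp only [State.set_reg, hr, if_false]

/-- For the record at address `R[34]` set the flag `R[13]` if some colour of the record occurs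
both in the first interval `[R[30], R[31])` and in the second interval `[R[32], R[33])`. -/
def testCmd : Cmd := .block [
  .const 13 0, fieldCmd 18 5, fieldCmd 21 7,
  .op .or 19 30 30, .op .or 20 31 31, .op .or 11 32 32, .op .or 12 33 33, sideCmd,
  .op .or 35 22 22, .op .or 36 23 23,
  fieldCmd 18 6,
  .op .or 19 32 32, .op .or 20 33 33, .op .or 11 30 30, .op .or 12 31 31, sideCmd,
  cornerCmd]

/-- A sorted list `l` at address `p`, followed by the addresses of the sorted lists `g`. -/
structure PointersAt (E : Env) (m : ℕ → ℕ) (L p : ℕ) (l : List ℕ) (g : ℕ → List ℕ) : Prop where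
  sorted : l.Pairwise (· < ·)
  length_lt : l.length < 2 ^ L
  stored : ∃ ps : List ℕ, ps.length = l.length ∧ Stored m E.M p (l.length :: (l ++ ps)) ∧
    ∀ k (h : k < ps.length), SortedAt m E.M ps[k] (g k) ∧ (g k).length < 2 ^ L

/-- The first block boundary at or after `ra`. -/
def firstBoundary (B ra : ℕ) : ℕ := (ra + B - 1) / B

/-- The last block boundary at or before `rb`, if it is not before the first one. -/
def lastBoundary (B ra rb : ℕ) : ℕ := max (rb / B) (firstBoundary B ra)

/-- Rounding up can overshoot `n / B` by one. Boundary indices therefore run from `0` to `n / B +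
1`, which is why the tables have `n / B + 2` rows or columns. -/
theorem firstBoundary_le {B ra n : ℕ} (hB : 0 < B) (h : ra ≤ n) :
    firstBoundary B ra ≤ n / B + 1 := by
  rw [← Nat.add_div_right n hB]
  exact Nat.div_le_div_right (by omega)

theorem lastBoundary_le {B ra rb n : ℕ} (hB : 0 < B) (h : ra ≤ n) (h' : rb ≤ n) :
    lastBoundary B ra rb ≤ n / B + 1 :=
  max_le ((Nat.div_le_div_right h').trans (Nat.le_succ _)) (firstBoundary_le hB h)

/-- Position `k` of the interval `[ra, rb)` is not between two block boundaries inside of it. -/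
def Fringe (B ra rb k : ℕ) : Prop :=
  ra ≤ k ∧ k < min (firstBoundary B ra * B) rb ∨ lastBoundary B ra rb * B ≤ k ∧ k < rb

/-- An operational statement about arbitrary lists `g₁`, `g₂` and an arbitrary table `F`: the
disjuncts are the two fringe scans and the corner comparison. What they say about colours is the
content of `test_iff`. -/
theorem testCmd_spec {E : Env} {m : ℕ → ℕ} (hS : Sound E m) {σ : State}
    {p q₁ q₂ a₁ b₁ a₂ b₂ B L tb st : ℕ} {r l₁ l₂ : List ℕ} {g₁ g₂ : ℕ → List ℕ} {F : ℕ → ℕ → ℕ}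
    (hr : Stored m E.M p r) (h5 : r[5]? = some q₁) (h6 : r[6]? = some q₂) (h7 : r[7]? = some B)
    (h8 : r[8]? = some tb) (h9 : r[9]? = some st)
    (hl₁ : PointersAt E m L q₁ l₁ g₁) (hl₂ : PointersAt E m L q₂ l₂ g₂)
    (hF : ∀ i ≤ l₁.length / B + 1, ∀ j ≤ l₂.length / B + 1,
      i * st + tb + j < E.M ∧ m (i * st + tb + j) = F i j ∧ 2 * F i j < 2 ^ E.w)
    (h34 : σ.reg 34 = p) (h30 : σ.reg 30 = a₁) (h31 : σ.reg 31 = b₁) (h32 : σ.reg 32 = a₂)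
    (h33 : σ.reg 33 = b₂) (hab₁ : a₁ ≤ b₁) (hab₂ : a₂ ≤ b₂) (hb₁ : b₁ < 2 ^ E.w)
    (hb₂ : b₂ < 2 ^ E.w) (hB : 0 < B) (hBM : B ≤ E.M) :
    Ev E m testCmd σ fun t σ' => t ≤ 4 * B * (20 * L + 26) + 40 * L + 150 ∧
      (0 < σ'.reg 13 ↔
        (∃ k, Fringe B (rk l₁ a₁) (rk l₁ b₁) k ∧ ∃ x ∈ g₁ k, a₂ ≤ x ∧ x < b₂) ∨
        (∃ k, Fringe B (rk l₂ a₂) (rk l₂ b₂) k ∧ ∃ x ∈ g₂ k, a₁ ≤ x ∧ x < b₁) ∨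
        F (firstBoundary B (rk l₁ a₁)) (lastBoundary B (rk l₂ a₂) (rk l₂ b₂)) +
          F (lastBoundary B (rk l₁ a₁) (rk l₁ b₁)) (firstBoundary B (rk l₂ a₂)) <
        F (lastBoundary B (rk l₁ a₁) (rk l₁ b₁)) (lastBoundary B (rk l₂ a₂) (rk l₂ b₂)) +
          F (firstBoundary B (rk l₁ a₁)) (firstBoundary B (rk l₂ a₂))) ∧
      (∀ r, (28 ≤ r ∧ r ≤ 34) ∨ 44 ≤ r → σ'.reg r = σ.reg r) ∧ σ'.out = σ.out := by
  have hw := hS.addr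
  have hl := hS.large
  obtain ⟨hs₁, hL₁, ps₁, hlen₁, hst₁, hg₁⟩ := hl₁
  obtain ⟨hs₂, hL₂, ps₂, hlen₂, hst₂, hg₂⟩ := hl₂
  have hia := firstBoundary_le hB (rk_le l₁ a₁)
  have hib := lastBoundary_le hB (rk_le l₁ a₁) (rk_le l₁ b₁)
  have hja := firstBoundary_le hB (rk_le l₂ a₂)
  have hjb := lastBoundary_le hB (rk_le l₂ a₂) (rk_le l₂ b₂)
  have hM₁ := hst₁.1
  have hM₂ := hst₂.1
  simp only [List.length_cons, List.length_append] at hM₁ hM₂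
  have hd₁ := Nat.div_le_self l₁.length B
  have hd₂ := Nat.div_le_self l₂.length B
  refine Ev.cons (Ev.const (by omega) ?_)
  refine Ev.cons (fieldCmd_spec hS hr h5 (by simp [h34]) ?_)
  refine Ev.cons (fieldCmd_spec hS hr h7 (by simp [h34]) ?_)
  refine Ev.cons (Ev.op a₁ (by simp [BinOp.eval, h30]) (by omega) ?_)
  refine Ev.cons (Ev.op b₁ (by simp [BinOp.eval, h31]) (by omega) ?_)
  refine Ev.cons (Ev.op a₂ (by simp [BinOp.eval, h32]) (by omega) ?_)
  refine Ev.cons (Ev.op b₂ (by simp [BinOp.eval, h33]) (by omega) ?_)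
  refine Ev.cons ((sideCmd_spec hS hst₁ hs₁ hlen₁ hL₁ hg₁ (a := a₁) (b := b₁) (a' := a₂)
    (b' := b₂) (B := B) (by simp) (by simp) (by simp) (by simp) (by simp) (by simp) (by omega)
    hb₁ (by omega) hb₂ hB hBM hab₁ rfl rfl rfl rfl).mono ?_)
  rintro t1 σ1 ⟨ht1, e1, e1', f1, hk1, ho1⟩
  simp only [State.set_reg] at hk1
  refine Ev.cons (Ev.op (firstBoundary B (rk l₁ a₁)) (by simp [BinOp.eval, e1, firstBoundary])
    (by omega) ?_)
  refine Ev.cons (Ev.op (lastBoundary B (rk l₁ a₁) (rk l₁ b₁))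
    (by simp [BinOp.eval, e1', firstBoundary, lastBoundary]) (by omega) ?_)
  refine Ev.cons (fieldCmd_spec hS hr h6 (by simp [hk1, h34]) ?_)
  refine Ev.cons (Ev.op a₂ (by simp [BinOp.eval, hk1, h32]) (by omega) ?_)
  refine Ev.cons (Ev.op b₂ (by simp [BinOp.eval, hk1, h33]) (by omega) ?_)
  refine Ev.cons (Ev.op a₁ (by simp [BinOp.eval, hk1, h30]) (by omega) ?_)
  refine Ev.cons (Ev.op b₁ (by simp [BinOp.eval, hk1, h31]) (by omega) ?_)
  refine Ev.cons ((sideCmd_spec hS hst₂ hs₂ hlen₂ hL₂ hg₂ (a := a₂) (b := b₂) (a' := a₁)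
    (b' := b₁) (B := B) (by simp) (by simp) (by simp) (by simp) (by simp) (by simp [hk1])
    (by omega) hb₂ (by omega) hb₁ hB hBM hab₂ rfl rfl rfl rfl).mono ?_)
  rintro t2 σ2 ⟨ht2, e2, e2', f2, hk2, ho2⟩
  simp only [State.set_reg] at hk2
  refine Ev.cons ((cornerCmd_spec hS hr h8 h9 (by simp [hk2, hk1, h34]) (by simp [hk2]; rfl)
    (by simp [hk2]; rfl) e2 e2' (F := F) ?_).mono ?_)
  · intro i hi j hj
    simp only [List.mem_cons, List.not_mem_nil, or_false] at hi hj
    refine hF i ?_ j ?_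
    · rcases hi with rfl | rfl
      exacts [hia, hib]
    · rcases hj with rfl | rfl
      exacts [hja, hjb]
  rintro t3 σ3 ⟨ht3, f3, hk3, ho3⟩
  refine Ev.nil ⟨by linarith, ?_, ?_, ?_⟩
  · clear hF hg₁ hg₂
    simp only [State.set_reg, Nat.reduceEqDiff, if_false, if_true, lt_irrefl, false_or]
      at f1 f2
    refine f3.trans ((or_congr (f2.trans (or_congr f1 Iff.rfl)) Iff.rfl).trans or_assoc)
  · intro r hr
    have hne : ∀ s ∈ [11, 12, 13, 18, 19, 20, 21, 27, 35, 36, 37, 38, 39, 40, 41, 42, 43],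
        r ≠ s := by
      intro s hs
      simp only [List.mem_cons, List.not_mem_nil, or_false] at hs
      omega
    simp only [List.mem_cons, forall_eq_or_imp, List.not_mem_nil, false_imp_iff, implies_true,
      and_true] at hne
    rw [hk3 r (by simp [hne]), hk2 r (by omega)]
    simp only [hne, if_false]
    rw [hk1 r (by omega)]
    simp only [hne, if_false]
  · rw [ho3, ho2]; simp only [State.set_out]; rw [ho1]; simp only [State.set_out]

end WordRAM

namespace SubstringIndexing

open WordRAM

/-! ### Positions of colours in an array -/

/-- The positions of the array `A` whose colour is in `Γ`. -/
def pos (A Γ : List ℕ) : List ℕ :=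
  (List.range A.length).filter fun p => decide (A.getD p 0 ∈ Γ)

theorem mem_pos {A Γ : List ℕ} {p : ℕ} : p ∈ pos A Γ ↔ p < A.length ∧ A.getD p 0 ∈ Γ := by
  simp [pos]

theorem pairwise_pos (A Γ : List ℕ) : (pos A Γ).Pairwise (· < ·) :=
  List.pairwise_lt_range.filter _

theorem length_pos_le (A Γ : List ℕ) : (pos A Γ).length ≤ A.length :=
  (List.length_filter_le _ _).trans List.length_range.le

/-- The colour `x` occurs in the interval `[a, b)` of the array `A`. -/
def Occurs (A : List ℕ) (a b x : ℕ) : Prop := ∃ p ∈ pos A [x], a ≤ p ∧ p < b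

instance (A : List ℕ) (a b x : ℕ) : Decidable (Occurs A a b x) :=
  inferInstanceAs (Decidable (∃ p ∈ pos A [x], a ≤ p ∧ p < b))

/-- The colour at the `k`-th position whose colour is in `Γ`. -/
def col (A Γ : List ℕ) (k : ℕ) : ℕ := A.getD ((pos A Γ).getD k 0) 0

theorem col_mem {A Γ : List ℕ} {k : ℕ} (h : k < (pos A Γ).length) : col A Γ k ∈ Γ := by
  rw [col, List.getD_eq_getElem _ _ h]
  exact (mem_pos.1 (List.getElem_mem h)).2

/-- Restricting the array to the positions with colours in `Γ` preserves the order, so an interval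
of positions becomes an interval of ranks. Blocks are cut in terms of these ranks. -/
theorem occurs_iff {A Γ : List ℕ} {a b x : ℕ} (hx : x ∈ Γ) :
    Occurs A a b x ↔ ∃ k, rk (pos A Γ) a ≤ k ∧ k < rk (pos A Γ) b ∧ col A Γ k = x := by
  constructor
  · rintro ⟨p, hp, ha, hb⟩
    rw [mem_pos, List.mem_singleton] at hp
    obtain ⟨k, hk, rfl⟩ := List.getElem_of_mem (mem_pos.2 ⟨hp.1, hp.2 ▸ hx⟩ : p ∈ pos A Γ)
    refine ⟨k, ?_, ?_, ?_⟩
    · by_contra h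
      exact absurd ((getElem_lt_iff_lt_rk (pairwise_pos A Γ) a k hk).2 (by omega)) (by omega)
    · exact (getElem_lt_iff_lt_rk (pairwise_pos A Γ) b k hk).1 hb
    · rw [col, List.getD_eq_getElem _ _ hk, hp.2]
  · rintro ⟨k, ha, hb, hc⟩
    have hk : k < (pos A Γ).length := hb.trans_le (rk_le _ _)
    rw [col, List.getD_eq_getElem _ _ hk] at hc
    refine ⟨(pos A Γ)[k], mem_pos.2 ⟨(mem_pos.1 (List.getElem_mem hk)).1, List.mem_singleton.2 hc⟩, ?_, ?_⟩
    · by_contra h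
      exact absurd ((getElem_lt_iff_lt_rk (pairwise_pos A Γ) a k hk).1 (by omega)) (by omega)
    · exact (getElem_lt_iff_lt_rk (pairwise_pos A Γ) b k hk).2 hb

/-- Whether the `s`-th position in `A₁` and the `t`-th position in `A₂` have the same colour. -/
def samePair (A₁ A₂ Γ : List ℕ) (s t : ℕ) : ℕ :=
  if s < (pos A₁ Γ).length ∧ t < (pos A₂ Γ).length ∧ col A₁ Γ s = col A₂ Γ t then 1 else 0

/-- The number of pairs of positions with the same colour before two block boundaries. -/
def prefixCount (A₁ A₂ Γ : List ℕ) (B i j : ℕ) : ℕ :=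
  ∑ s ∈ Finset.range (i * B), ∑ t ∈ Finset.range (j * B), samePair A₁ A₂ Γ s t

theorem sum_range_ite_lt_le (k n c : ℕ) :
    ∑ t ∈ Finset.range k, (if t < n then c else 0) ≤ n * c := by
  rw [← Finset.sum_filter, Finset.sum_const, smul_eq_mul]
  refine Nat.mul_le_mul_right _ ((Finset.card_le_card (t := Finset.range n) ?_).trans
    (Finset.card_range n).le)
  intro t ht
  simpa using (Finset.mem_filter.1 ht).2

/-- Since `samePair` is `0` beyond the last position, only genuine pairs count, even if `i * B`
exceeds the number of positions. The bound makes the table entries fit into words. -/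
theorem prefixCount_le (A₁ A₂ Γ : List ℕ) (B i j : ℕ) :
    prefixCount A₁ A₂ Γ B i j ≤ A₁.length * A₂.length := by
  refine le_trans (Finset.sum_le_sum fun s _ => ?_)
    (sum_range_ite_lt_le (i * B) A₁.length A₂.length)
  by_cases hs : s < (pos A₁ Γ).length
  · rw [if_pos (hs.trans_le (length_pos_le _ _))]
    refine le_trans (Finset.sum_le_sum fun t _ => ?_)
      ((sum_range_ite_lt_le (j * B) A₂.length 1).trans (by simp))
    have := length_pos_le A₂ Γ
    rw [samePair]
    split_ifs <;> omega
  · rw [Finset.sum_eq_zero fun t _ => by rw [samePair, if_neg fun h => hs h.1]]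
    exact Nat.zero_le _

/-- Inclusion and exclusion for a rectangle, rearranged so that no natural number is subtracted. -/
theorem sum_range_rectangle (e : ℕ → ℕ → ℕ) {i i' j j' : ℕ} (hi : i ≤ i') (hj : j ≤ j') :
    ∑ s ∈ Finset.range i', ∑ t ∈ Finset.range j', e s t +
        ∑ s ∈ Finset.range i, ∑ t ∈ Finset.range j, e s t =
      ∑ s ∈ Finset.range i, ∑ t ∈ Finset.range j', e s t +
        ∑ s ∈ Finset.range i', ∑ t ∈ Finset.range j, e s t +
        ∑ s ∈ Finset.Ico i i', ∑ t ∈ Finset.Ico j j', e s t := by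
  have h1 := fun s => Finset.sum_range_add_sum_Ico (e s) hj
  have h2 := fun f : ℕ → ℕ => Finset.sum_range_add_sum_Ico f hi
  simp only [← h1, ← h2, Finset.sum_add_distrib]
  ring

/-- The difference of the two sides is the number of equally coloured pairs in the rectangle of
whole blocks, so strictness means that there is one. -/
theorem prefixCount_lt_iff (A₁ A₂ Γ : List ℕ) {B i i' j j' : ℕ} (hi : i ≤ i') (hj : j ≤ j') :
    prefixCount A₁ A₂ Γ B i j' + prefixCount A₁ A₂ Γ B i' j <
        prefixCount A₁ A₂ Γ B i' j' + prefixCount A₁ A₂ Γ B i j ↔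
      ∃ s t, i * B ≤ s ∧ s < i' * B ∧ j * B ≤ t ∧ t < j' * B ∧ s < (pos A₁ Γ).length ∧
        t < (pos A₂ Γ).length ∧ col A₁ Γ s = col A₂ Γ t := by
  have := sum_range_rectangle (samePair A₁ A₂ Γ) (Nat.mul_le_mul_right B hi)
    (Nat.mul_le_mul_right B hj)
  simp only [prefixCount]
  rw [this, Nat.lt_add_right_iff_pos, Nat.pos_iff_ne_zero, Ne, Finset.sum_eq_zero_iff]
  simp only [Finset.sum_eq_zero_iff, Finset.mem_Ico, samePair]
  push Not
  constructor
  · rintro ⟨s, hs, t, ht, h⟩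
    exact ⟨s, t, hs.1, hs.2, ht.1, ht.2, by by_contra hc; exact h (if_neg hc)⟩
  · rintro ⟨s, t, h1, h2, h3, h4, h5⟩
    exact ⟨s, ⟨h1, h2⟩, t, ⟨h3, h4⟩, by rw [if_pos h5]; exact one_ne_zero⟩

theorem firstBoundary_mul_ge {B : ℕ} (hB : 0 < B) (ra : ℕ) : ra ≤ firstBoundary B ra * B := by
  have := Nat.lt_div_mul_add (a := ra + B - 1) hB
  rw [firstBoundary]; omega

theorem firstBoundary_le_lastBoundary (B ra rb : ℕ) :
    firstBoundary B ra ≤ lastBoundary B ra rb := le_max_right _ _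

theorem mem_Ico_of_fringe {B ra rb k : ℕ} (hB : 0 < B) (h : Fringe B ra rb k) : ra ≤ k ∧ k < rb := by
  have h1 := firstBoundary_mul_ge hB ra
  have h2 : firstBoundary B ra * B ≤ lastBoundary B ra rb * B :=
    Nat.mul_le_mul_right _ (firstBoundary_le_lastBoundary _ _ _)
  rcases h with h | h <;> omega

theorem not_fringe {B ra rb k : ℕ} (h : ¬ Fringe B ra rb k) (ha : ra ≤ k) (hb : k < rb) :
    firstBoundary B ra * B ≤ k ∧ k < lastBoundary B ra rb * B := by
  simp only [Fringe, not_or, not_and, not_lt] at h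
  have := h.1 ha
  exact ⟨by omega, by by_contra hc; exact absurd (h.2 (by omega)) (by omega)⟩

/-- If the maximum in `lastBoundary` is attained by the first boundary, the two hypotheses
contradict each other; otherwise `k` lies before `rb` rounded down. -/
theorem lt_of_lt_lastBoundary_mul {B ra rb k : ℕ} (h : k < lastBoundary B ra rb * B)
    (h' : firstBoundary B ra * B ≤ k) : k < rb := by
  have h1 := Nat.div_mul_le_self rb B
  rw [lastBoundary, max_mul_of_nonneg _ _ (Nat.zero_le B)] at h
  omega

/-- What `testCmd` looks at is enough to see whether there is a common colour. -/
theorem test_iff (A₁ A₂ Γ : List ℕ) {B : ℕ} (hB : 0 < B) (a₁ b₁ a₂ b₂ : ℕ) :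
    ((∃ k, Fringe B (rk (pos A₁ Γ) a₁) (rk (pos A₁ Γ) b₁) k ∧ Occurs A₂ a₂ b₂ (col A₁ Γ k)) ∨
      (∃ k, Fringe B (rk (pos A₂ Γ) a₂) (rk (pos A₂ Γ) b₂) k ∧ Occurs A₁ a₁ b₁ (col A₂ Γ k)) ∨
      prefixCount A₁ A₂ Γ B (firstBoundary B (rk (pos A₁ Γ) a₁))
          (lastBoundary B (rk (pos A₂ Γ) a₂) (rk (pos A₂ Γ) b₂)) +
        prefixCount A₁ A₂ Γ B (lastBoundary B (rk (pos A₁ Γ) a₁) (rk (pos A₁ Γ) b₁))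
          (firstBoundary B (rk (pos A₂ Γ) a₂)) <
      prefixCount A₁ A₂ Γ B (lastBoundary B (rk (pos A₁ Γ) a₁) (rk (pos A₁ Γ) b₁))
          (lastBoundary B (rk (pos A₂ Γ) a₂) (rk (pos A₂ Γ) b₂)) +
        prefixCount A₁ A₂ Γ B (firstBoundary B (rk (pos A₁ Γ) a₁))
          (firstBoundary B (rk (pos A₂ Γ) a₂))) ↔
    ∃ x ∈ Γ, Occurs A₁ a₁ b₁ x ∧ Occurs A₂ a₂ b₂ x := by
  rw [prefixCount_lt_iff A₁ A₂ Γ (firstBoundary_le_lastBoundary _ _ _)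
    (firstBoundary_le_lastBoundary _ _ _)]
  constructor
  · rintro (⟨k, hk, ho⟩ | ⟨k, hk, ho⟩ | ⟨s, t, h1, h2, h3, h4, h5, h6, h7⟩)
    · obtain ⟨h, h'⟩ := mem_Ico_of_fringe hB hk
      have hm := col_mem (h'.trans_le (rk_le _ _))
      exact ⟨_, hm, (occurs_iff hm).2 ⟨k, h, h', rfl⟩, ho⟩
    · obtain ⟨h, h'⟩ := mem_Ico_of_fringe hB hk
      have hm := col_mem (h'.trans_le (rk_le _ _))
      exact ⟨_, hm, ho, (occurs_iff hm).2 ⟨k, h, h', rfl⟩⟩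
    · have hm := col_mem h5
      exact ⟨_, hm, (occurs_iff hm).2 ⟨s, (firstBoundary_mul_ge hB _).trans h1,
        lt_of_lt_lastBoundary_mul h2 h1, rfl⟩, (occurs_iff hm).2
        ⟨t, (firstBoundary_mul_ge hB _).trans h3, lt_of_lt_lastBoundary_mul h4 h3, h7.symm⟩⟩
  · rintro ⟨x, hx, h1, h2⟩
    obtain ⟨s, hs, hs', rfl⟩ := (occurs_iff hx).1 h1
    obtain ⟨t, ht, ht', hst⟩ := (occurs_iff hx).1 h2
    -- A common colour has a position `s` in the first and `t` in the second interval. If `s` or `t`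
    -- is in its fringe, a scan finds the colour; otherwise both are in whole blocks and the pair
    -- `(s, t)` is counted.
    by_cases hf : Fringe B (rk (pos A₁ Γ) a₁) (rk (pos A₁ Γ) b₁) s
    · exact .inl ⟨s, hf, h2⟩
    by_cases hf' : Fringe B (rk (pos A₂ Γ) a₂) (rk (pos A₂ Γ) b₂) t
    · exact .inr (.inl ⟨t, hf', hst ▸ h1⟩)
    obtain ⟨h3, h4⟩ := not_fringe hf hs hs'
    obtain ⟨h5, h6⟩ := not_fringe hf' ht ht'
    exact .inr (.inr ⟨s, t, h3, h4, h5, h6, hs'.trans_le (rk_le _ _), ht'.trans_le (rk_le _ _),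
      hst.symm⟩)

/-! ### The record of a node of the colour tree -/

/-- The length of the blocks into which the positions with colours in `Γ` are cut. -/
def blockLen (A₁ A₂ Γ : List ℕ) : ℕ := Nat.sqrt ((pos A₁ Γ).length + (pos A₂ Γ).length) + 1

theorem blockLen_pos (A₁ A₂ Γ : List ℕ) : 0 < blockLen A₁ A₂ Γ := Nat.succ_pos _

/-- The table of the prefix counts, row by row. -/
def countTable (A₁ A₂ Γ : List ℕ) (B m n : ℕ) : List ℕ :=
  (List.range (m * n)).map fun k => prefixCount A₁ A₂ Γ B (k / n) (k % n)

/-- The positions with colours in `Γ`, followed by pointers for their colours. -/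
def pointerList (A Γ : List ℕ) (o : ℕ → ℕ) : List ℕ :=
  (pos A Γ).length :: (pos A Γ ++ (pos A Γ).map fun p => o (A.getD p 0))

theorem length_pointerList (A Γ : List ℕ) (o : ℕ → ℕ) :
    (pointerList A Γ o).length = 2 * (pos A Γ).length + 1 := by
  simp [pointerList]; omega

/-- The record at address `p` for a node with colour `x`, where `Γ` are the colours of its
subtree, and `o₁ y`, `o₂ y` are the addresses of the lists of positions of the colour `y`. -/
def nodeBlock (A₁ A₂ : List ℕ) (o₁ o₂ : ℕ → ℕ) (Γ : List ℕ) (x p child skip : ℕ) : List ℕ :=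
  [child, skip, x, o₁ x, o₂ x, p + 10, p + 10 + (2 * (pos A₁ Γ).length + 1), blockLen A₁ A₂ Γ,
    p + 10 + (2 * (pos A₁ Γ).length + 1) + (2 * (pos A₂ Γ).length + 1),
    (pos A₂ Γ).length / blockLen A₁ A₂ Γ + 2] ++
  (pointerList A₁ Γ o₂ ++ (pointerList A₂ Γ o₁ ++
    countTable A₁ A₂ Γ (blockLen A₁ A₂ Γ) ((pos A₁ Γ).length / blockLen A₁ A₂ Γ + 2)
      ((pos A₂ Γ).length / blockLen A₁ A₂ Γ + 2)))

/-- The number of cells of a record. -/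
def nodeSize (A₁ A₂ Γ : List ℕ) : ℕ :=
  10 + ((2 * (pos A₁ Γ).length + 1) + ((2 * (pos A₂ Γ).length + 1) +
    ((pos A₁ Γ).length / blockLen A₁ A₂ Γ + 2) * ((pos A₂ Γ).length / blockLen A₁ A₂ Γ + 2)))

theorem length_nodeBlock (A₁ A₂ : List ℕ) (o₁ o₂ : ℕ → ℕ) (Γ : List ℕ) (x p c k : ℕ) :
    (nodeBlock A₁ A₂ o₁ o₂ Γ x p c k).length = nodeSize A₁ A₂ Γ := by
  simp only [nodeBlock, nodeSize, List.length_append, length_pointerList, countTable,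
    List.length_map, List.length_range]
  rfl

/-- With blocks of length about `√n` for `n = n₁ + n₂`, either side has at most `√n` full blocks, so
the table has at most `(√n + 2) ^ 2 = O(n)` entries. This choice balances the table against the
length of the fringe scans. -/
theorem nodeSize_le (A₁ A₂ Γ : List ℕ) :
    nodeSize A₁ A₂ Γ ≤ 60 * ((pos A₁ Γ).length + (pos A₂ Γ).length + 1) := by
  set n₁ := (pos A₁ Γ).length
  set n₂ := (pos A₂ Γ).length
  have hB : blockLen A₁ A₂ Γ = Nat.sqrt (n₁ + n₂) + 1 := rfl
  have hs := Nat.sqrt_le (n₁ + n₂)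
  have hs' : n₁ + n₂ < (Nat.sqrt (n₁ + n₂) + 1) * (Nat.sqrt (n₁ + n₂) + 1) :=
    Nat.lt_succ_sqrt (n₁ + n₂)
  have hd : ∀ n ≤ n₁ + n₂, n / blockLen A₁ A₂ Γ ≤ Nat.sqrt (n₁ + n₂) := by
    intro n hn
    rw [hB]
    exact Nat.lt_succ_iff.1 ((Nat.div_lt_iff_lt_mul (Nat.succ_pos _)).2 (hn.trans_lt hs'))
  have hm := Nat.mul_le_mul (Nat.add_le_add_right (hd n₁ (by omega)) 2)
    (Nat.add_le_add_right (hd n₂ (by omega)) 2)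
  have hself := Nat.sqrt_le_self (n₁ + n₂)
  simp only [nodeSize]
  nlinarith

/-- The colours that occur in both intervals. -/
def common (A₁ A₂ : List ℕ) (a₁ b₁ a₂ b₂ x : ℕ) : Bool :=
  decide (Occurs A₁ a₁ b₁ x ∧ Occurs A₂ a₂ b₂ x)

/-- The memory holds the lists of positions of the colours in `C`, and all relevant numbers fit
into words. -/
structure Indexed (E : Env) (m : ℕ → ℕ) (A₁ A₂ : List ℕ) (o₁ o₂ : ℕ → ℕ) (C : List ℕ) (L : ℕ) :
    Prop where
  sound : Sound E m
  pos_L : 0 < L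
  lt₁ : A₁.length < 2 ^ L
  lt₂ : A₂.length < 2 ^ L
  count : 2 * (A₁.length * A₂.length) < 2 ^ E.w
  occ₁ : ∀ x ∈ C, SortedAt m E.M (o₁ x) (pos A₁ [x])
  occ₂ : ∀ x ∈ C, SortedAt m E.M (o₂ x) (pos A₂ [x])

/-- The pointer of a position in `A` leads to the occurrences of its colour in the other array `A'`,
where the fringe scan has to look for it. -/
theorem pointersAt {E : Env} {m : ℕ → ℕ} {L p : ℕ} {A A' Γ : List ℕ} {o : ℕ → ℕ}
    (h : A.length < 2 ^ L) (h' : A'.length < 2 ^ L)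
    (ho : ∀ x ∈ Γ, SortedAt m E.M (o x) (pos A' [x]))
    (hst : Stored m E.M p (pointerList A Γ o)) :
    PointersAt E m L p (pos A Γ) fun k => pos A' [col A Γ k] := by
  refine ⟨pairwise_pos A Γ, (length_pos_le _ _).trans_lt h, _, List.length_map _, hst, ?_⟩
  intro k hk
  refine ⟨?_, (length_pos_le _ _).trans_lt h'⟩
  have hk' : k < (pos A Γ).length := by simpa using hk
  have := ho _ (col_mem hk')
  rw [List.getElem_map]
  rwa [col, List.getD_eq_getElem _ _ hk'] at this ⊢

/-- Visit the record at address `R[34]`, and move on to the next record. -/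
def visitCmd : Cmd := .block [
  testCmd, .const 28 0,
  .ite 28 13
    (.block [
      .const 13 0, fieldCmd 10 3, .op .or 11 30 30, .op .or 12 31 31, checkCmd,
      .ite 28 13
        (.block [
          .const 13 0, fieldCmd 10 4, .op .or 11 32 32, .op .or 12 33 33, checkCmd,
          .ite 28 13 (.block [fieldCmd 44 2, .report 44]) .skip])
        .skip,
      fieldCmd 34 0])
    (fieldCmd 34 1)]

/-- The test for the whole subtree chooses between the two pointers of the record. Only after a
positive test is the colour of the node itself looked up, in its own two lists of positions. -/
theorem visitCmd_spec {E : Env} {m : ℕ → ℕ} {A₁ A₂ C Γ : List ℕ} {o₁ o₂ : ℕ → ℕ}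
    {L x p child skip a₁ b₁ a₂ b₂ : ℕ} (H : Indexed E m A₁ A₂ o₁ o₂ C L) {σ : State}
    (hΓ : Γ ⊆ C) (hx : x ∈ Γ) (hst : Stored m E.M p (nodeBlock A₁ A₂ o₁ o₂ Γ x p child skip))
    (h34 : σ.reg 34 = p) (h30 : σ.reg 30 = a₁) (h31 : σ.reg 31 = b₁) (h32 : σ.reg 32 = a₂)
    (h33 : σ.reg 33 = b₂) (hab₁ : a₁ ≤ b₁) (hab₂ : a₂ ≤ b₂) (hb₁ : b₁ < 2 ^ E.w)
    (hb₂ : b₂ < 2 ^ E.w) :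
    Ev E m visitCmd σ fun t σ' => t ≤ 600 * (blockLen A₁ A₂ Γ * L) ∧
      σ'.reg 34 = (if Γ.any (common A₁ A₂ a₁ b₁ a₂ b₂) then child else skip) ∧
      σ'.out = (if common A₁ A₂ a₁ b₁ a₂ b₂ x then x :: σ.out else σ.out) ∧
      (∀ r, (30 ≤ r ∧ r ≤ 33) ∨ r = 45 → σ'.reg r = σ.reg r) := by
  have hS := H.sound
  have hw := hS.addr
  have hl := hS.large
  have hL := H.pos_L
  have hB := blockLen_pos A₁ A₂ Γ
  obtain ⟨hrec, hst⟩ := Stored.append_iff.1 hst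
  obtain ⟨hp₁, hst⟩ := Stored.append_iff.1 hst
  obtain ⟨hp₂, hT⟩ := Stored.append_iff.1 hst
  rw [length_pointerList] at hp₂ hT
  rw [length_pointerList] at hT
  have hBM : blockLen A₁ A₂ Γ ≤ E.M := by
    have := hT.1
    have := Nat.sqrt_le_self ((pos A₁ Γ).length + (pos A₂ Γ).length)
    rw [blockLen]; omega
  -- Two sides with at most `2 * B` checks each, and two more checks for the colour of the node. As
  -- `B` and `L` are positive, all terms are absorbed by `B * L`.
  have htime : 4 * blockLen A₁ A₂ Γ * (20 * L + 26) + 80 * L + 250 ≤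
      600 * (blockLen A₁ A₂ Γ * L) := by
    have : L ≤ blockLen A₁ A₂ Γ * L := Nat.le_mul_of_pos_left _ hB
    have : blockLen A₁ A₂ Γ ≤ blockLen A₁ A₂ Γ * L := Nat.le_mul_of_pos_right _ hL
    nlinarith
  refine Ev.cons ((testCmd_spec hS hrec rfl rfl rfl rfl rfl
    (pointersAt H.lt₁ H.lt₂ (fun y hy => H.occ₂ y (hΓ hy)) hp₁)
    (pointersAt H.lt₂ H.lt₁ (fun y hy => H.occ₁ y (hΓ hy)) hp₂)
    (F := prefixCount A₁ A₂ Γ (blockLen A₁ A₂ Γ)) ?_ h34 h30 h31 h32 h33 hab₁ hab₂ hb₁ hb₂ hB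
    hBM).mono ?_)
  · intro i hi j hj
    set n := (pos A₂ Γ).length / blockLen A₁ A₂ Γ + 2
    have hij : i * n + j < ((pos A₁ Γ).length / blockLen A₁ A₂ Γ + 2) * n :=
      calc i * n + j < i * n + n := by omega
        _ = (i + 1) * n := by ring
        _ ≤ _ := Nat.mul_le_mul_right _ (by omega)
    have hlen : i * n + j < (countTable A₁ A₂ Γ (blockLen A₁ A₂ Γ)
        ((pos A₁ Γ).length / blockLen A₁ A₂ Γ + 2) n).length := by simpa [countTable] using hij
    have hTM := hT.1
    have hv := hT.2 _ hlen
    simp only [List.length_cons, List.length_nil, Nat.zero_add, Nat.reduceAdd] at hTM hv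
    have hc := prefixCount_le A₁ A₂ Γ (blockLen A₁ A₂ Γ) i j
    have hcw := H.count
    refine ⟨by omega, ?_, by omega⟩
    rw [show i * n + (p + 10 + (2 * (pos A₁ Γ).length + 1) + (2 * (pos A₂ Γ).length + 1)) + j =
      p + 10 + (2 * (pos A₁ Γ).length + 1) + (2 * (pos A₂ Γ).length + 1) + (i * n + j) by omega,
      hv]
    simp only [countTable, List.getElem_map, List.getElem_range]
    have hjn : j < n := by omega
    -- Row-major order: `j < n`, so quotient and remainder of the index by `n` recover `i` and `j`.
    rw [Nat.mul_comm i n, Nat.mul_add_div (by omega), Nat.mul_add_mod, Nat.mod_eq_of_lt hjn,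
      Nat.div_eq_of_lt hjn, Nat.add_zero]
  rintro t1 σ1 ⟨ht1, hf, hk1, ho1⟩
  replace hf : 0 < σ1.reg 13 ↔ Γ.any (common A₁ A₂ a₁ b₁ a₂ b₂) = true := by
    rw [hf]
    refine (test_iff A₁ A₂ Γ hB a₁ b₁ a₂ b₂).trans ?_
    simp [common]
  refine Ev.cons (Ev.const (by omega) (Ev.cons (Ev.ite (fun hc => ?_) (fun hc => ?_))))
  · simp only [State.set_reg, if_true, Nat.reduceEqDiff, if_false] at hc
    rw [if_pos (hf.1 hc)]
    have hcx : common A₁ A₂ a₁ b₁ a₂ b₂ x = true ↔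
        Occurs A₁ a₁ b₁ x ∧ Occurs A₂ a₂ b₂ x := by simp [common]
    refine Ev.cons (Ev.const (by omega) ?_)
    refine Ev.cons (fieldCmd_spec hS hrec (x := o₁ x) rfl (by simp [hk1, h34]) ?_)
    refine Ev.cons (Ev.op a₁ (by simp [BinOp.eval, hk1, h30]) (by omega) ?_)
    refine Ev.cons (Ev.op b₁ (by simp [BinOp.eval, hk1, h31]) (by omega) ?_)
    refine Ev.cons ((checkCmd_spec hS (H.occ₁ x (hΓ hx)) (a := a₁) (b := b₁) (by simp) (by simp)
      (by simp) (by omega) hb₁ ((length_pos_le _ _).trans_lt H.lt₁)).mono ?_)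
    rintro t2 σ2 ⟨ht2, hf2, hk2, ho2⟩
    simp only [State.set_reg, Nat.reduceEqDiff, if_false, if_true, lt_irrefl, false_or] at hf2 hk2
    refine Ev.cons (Ev.ite (fun hc1 => ?_) (fun hc1 => ?_))
    · have hc1' : Occurs A₁ a₁ b₁ x := hf2.1 (by simpa [hk2] using hc1)
      refine Ev.cons (Ev.const (by omega) ?_)
      refine Ev.cons (fieldCmd_spec hS hrec (x := o₂ x) rfl (by simp [hk1, hk2, h34]) ?_)
      refine Ev.cons (Ev.op a₂ (by simp [BinOp.eval, hk1, hk2, h32]) (by omega) ?_)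
      refine Ev.cons (Ev.op b₂ (by simp [BinOp.eval, hk1, hk2, h33]) (by omega) ?_)
      refine Ev.cons ((checkCmd_spec hS (H.occ₂ x (hΓ hx)) (a := a₂) (b := b₂) (by simp)
        (by simp) (by simp) (by omega) hb₂ ((length_pos_le _ _).trans_lt H.lt₂)).mono ?_)
      rintro t3 σ3 ⟨ht3, hf3, hk3, ho3⟩
      simp only [State.set_reg, Nat.reduceEqDiff, if_false, if_true, lt_irrefl, false_or]
        at hf3 hk3
      refine Ev.cons (Ev.ite (fun hc2 => ?_) (fun hc2 => ?_))
      · have hc2' : Occurs A₂ a₂ b₂ x := hf3.1 (by simpa [hk2, hk3] using hc2)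
        rw [if_pos (hcx.2 ⟨hc1', hc2'⟩)]
        refine Ev.cons (fieldCmd_spec hS hrec (x := x) rfl (by simp [hk1, hk2, hk3, h34]) ?_)
        refine Ev.cons (Ev.report (Ev.nil (Ev.nil ?_)))
        refine Ev.cons (fieldCmd_spec hS hrec (x := child) rfl
          (by simp [hk1, hk2, hk3, h34]) (Ev.nil (Ev.nil ?_)))
        refine ⟨by linarith, by simp, by simp [ho3, ho2, ho1], fun r hr => ?_⟩
        have hne : ∀ s ∈ [10, 11, 12, 13, 27, 28, 34, 44], r ≠ s := by
          intro s hs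
          simp only [List.mem_cons, List.not_mem_nil, or_false] at hs
          clear hf hcx hf2 hf3
          omega
        simp only [List.mem_cons, forall_eq_or_imp, List.not_mem_nil, false_imp_iff,
          implies_true, and_true] at hne
        have h9 : 9 ≤ r := by clear hf hcx hf2 hf3; omega
        simp only [State.set_reg, hne, if_false]
        rw [hk3 r h9 hne.2.2.2.1]
        simp only [hne, if_false]
        rw [hk2 r h9 hne.2.2.2.1]
        simp only [hne, if_false]
        exact hk1 r (by clear hf hcx hf2 hf3; omega)
      · have hc2' : ¬ Occurs A₂ a₂ b₂ x := fun h => hc2 (by simpa [hk2, hk3] using hf3.2 h)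
        rw [if_neg (fun h => hc2' (hcx.1 h).2)]
        refine Ev.skip (Ev.nil (Ev.cons (fieldCmd_spec hS hrec (x := child) rfl
          (by simp [hk1, hk2, hk3, h34]) (Ev.nil (Ev.nil ?_)))))
        refine ⟨by linarith, by simp, by simp [ho3, ho2, ho1], fun r hr => ?_⟩
        have hne : ∀ s ∈ [10, 11, 12, 13, 27, 28, 34, 44], r ≠ s := by
          intro s hs
          simp only [List.mem_cons, List.not_mem_nil, or_false] at hs
          clear hf hcx hf2 hf3
          omega
        simp only [List.mem_cons, forall_eq_or_imp, List.not_mem_nil, false_imp_iff,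
          implies_true, and_true] at hne
        have h9 : 9 ≤ r := by clear hf hcx hf2 hf3; omega
        simp only [State.set_reg, hne, if_false]
        rw [hk3 r h9 hne.2.2.2.1]
        simp only [hne, if_false]
        rw [hk2 r h9 hne.2.2.2.1]
        simp only [hne, if_false]
        exact hk1 r (by clear hf hcx hf2 hf3; omega)
    · have hc1' : ¬ Occurs A₁ a₁ b₁ x := fun h => hc1 (by simpa [hk2] using hf2.2 h)
      rw [if_neg (fun h => hc1' (hcx.1 h).1)]
      refine Ev.skip (Ev.cons (fieldCmd_spec hS hrec (x := child) rfl
        (by simp [hk1, hk2, h34]) (Ev.nil (Ev.nil ?_))))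
      refine ⟨by linarith, by simp, by simp [ho2, ho1], fun r hr => ?_⟩
      have hne : ∀ s ∈ [10, 11, 12, 13, 27, 28, 34, 44], r ≠ s := by
        intro s hs
        simp only [List.mem_cons, List.not_mem_nil, or_false] at hs
        clear hf hcx hf2
        omega
      simp only [List.mem_cons, forall_eq_or_imp, List.not_mem_nil, false_imp_iff,
        implies_true, and_true] at hne
      have h9 : 9 ≤ r := by clear hf hcx hf2; omega
      simp only [State.set_reg, hne, if_false]
      rw [hk2 r h9 hne.2.2.2.1]
      simp only [hne, if_false]
      exact hk1 r (by clear hf hcx hf2; omega)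
  · simp only [State.set_reg, if_true, Nat.reduceEqDiff, if_false] at hc
    have hany : ¬ Γ.any (common A₁ A₂ a₁ b₁ a₂ b₂) = true := fun h => hc (hf.2 h)
    have hcx : ¬ common A₁ A₂ a₁ b₁ a₂ b₂ x = true := fun h =>
      hany (List.any_eq_true.2 ⟨x, hx, h⟩)
    rw [if_neg hany, if_neg hcx]
    refine fieldCmd_spec hS hrec (x := skip) rfl (by simp [hk1, h34]) (Ev.nil ?_)
    refine ⟨by linarith, by simp, by simp [ho1], fun r hr => ?_⟩
    have hne : ∀ s ∈ [27, 28, 34], r ≠ s := by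
      intro s hs
      simp only [List.mem_cons, List.not_mem_nil, or_false] at hs
      clear hf
      omega
    simp only [List.mem_cons, forall_eq_or_imp, List.not_mem_nil, false_imp_iff,
      implies_true, and_true] at hne
    simp only [State.set_reg, hne, if_false]
    exact hk1 r (by clear hf; omega)

end SubstringIndexing

/-! ### Partial runs of a loop, to be concatenated along a recursion on a tree -/

namespace WordRAM

/-- A number of rounds of the loop `while R[a] < R[b] do s`. -/
inductive Rounds (E : Env) (m : ℕ → ℕ) (a b : ℕ) (s : Cmd) : State → ℕ → State → Prop
  | refl (σ) : Rounds E m a b s σ 0 σ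
  | step {σ t σ' t' σ''} : σ.reg a < σ.reg b → Exec E m s σ t σ' → Rounds E m a b s σ' t' σ'' →
      Rounds E m a b s σ (t + 2 + t') σ''

namespace Rounds

variable {E : Env} {m : ℕ → ℕ} {a b : ℕ} {s : Cmd} {σ σ' σ'' : State} {t t' : ℕ}

theorem trans (h : Rounds E m a b s σ t σ') (h' : Rounds E m a b s σ' t' σ'') :
    Rounds E m a b s σ (t + t') σ'' := by
  induction h with
  | refl σ => simpa using h'
  | step hlt he _ ih => rw [Nat.add_assoc]; exact .step hlt he (ih h')

theorem exec (h : Rounds E m a b s σ t σ') (hlt : ¬ σ'.reg a < σ'.reg b) :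
    Exec E m (.loop a b s) σ (t + 2) σ' := by
  induction h with
  | refl σ => rw [Nat.zero_add]; exact .loop_neg hlt
  | step hlt' he _ ih => rw [Nat.add_assoc]; exact .loop_pos hlt' he (ih hlt)

end Rounds

end WordRAM

namespace SubstringIndexing

open WordRAM

/-! ### The colour tree -/

/-- Binary trees with a colour at each node. -/
inductive ColorTree
  | nil
  | node (x : ℕ) (l r : ColorTree)

namespace ColorTree

/-- The colours in preorder. -/
def colors : ColorTree → List ℕ
  | nil => []
  | node x l r => x :: (l.colors ++ r.colors)

/-- The height of the tree. -/
def height : ColorTree → ℕ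
  | nil => 0
  | node _ l r => max l.height r.height + 1

/-- The number of cells for the records of all nodes. -/
def space (A₁ A₂ : List ℕ) : ColorTree → ℕ
  | nil => 0
  | node x l r => nodeSize A₁ A₂ (node x l r).colors + (l.space A₁ A₂ + r.space A₁ A₂)

/-- The address of the first record of a tree at address `s`, if `q` is the address of the record
that follows the tree. -/
def entry : ColorTree → ℕ → ℕ → ℕ
  | nil, _, q => q
  | node _ _ _, s, _ => s

/-- The records of a tree in preorder, from address `s` on; `q` is the address of the record that
follows the tree. -/
def layout (A₁ A₂ : List ℕ) (o₁ o₂ : ℕ → ℕ) : ColorTree → ℕ → ℕ → List ℕ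
  | nil, _, _ => []
  | node x l r, s, q =>
    let sl := s + nodeSize A₁ A₂ (node x l r).colors
    let sr := sl + l.space A₁ A₂
    let pr := r.entry sr q
    nodeBlock A₁ A₂ o₁ o₂ (node x l r).colors x s (l.entry sl pr) q ++
      (l.layout A₁ A₂ o₁ o₂ sl pr ++ r.layout A₁ A₂ o₁ o₂ sr q)

/-- A bound for the number of steps that a query spends in a tree. -/
def cost (A₁ A₂ : List ℕ) (f : ℕ → Bool) (L : ℕ) : ColorTree → ℕ
  | nil => 0
  | node x l r => 600 * (blockLen A₁ A₂ (node x l r).colors * L) + 2 +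
      if (node x l r).colors.any f then l.cost A₁ A₂ f L + r.cost A₁ A₂ f L else 0

theorem length_layout (A₁ A₂ : List ℕ) (o₁ o₂ : ℕ → ℕ) (T : ColorTree) :
    ∀ s q, (T.layout A₁ A₂ o₁ o₂ s q).length = T.space A₁ A₂ := by
  induction T with
  | nil => intro s q; rfl
  | node x l r ihl ihr =>
    intro s q
    simp only [layout, space, List.length_append, length_nodeBlock, ihl, ihr]

/-- A single loop replaces the recursion, without a stack: each record knows the address `q` of the
record that follows its subtree in preorder, and `entry` passes through empty subtrees directly to
their successor. The rounds of the node and of its two subtrees are concatenated. -/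
theorem walk {E : Env} {m : ℕ → ℕ} {A₁ A₂ C : List ℕ} {o₁ o₂ : ℕ → ℕ} {L a₁ b₁ a₂ b₂ : ℕ}
    (H : Indexed E m A₁ A₂ o₁ o₂ C L) (hab₁ : a₁ ≤ b₁) (hab₂ : a₂ ≤ b₂) (hb₁ : b₁ < 2 ^ E.w)
    (hb₂ : b₂ < 2 ^ E.w) (T : ColorTree) : ∀ (s q : ℕ) (σ : State), T.colors ⊆ C → 0 < s →
      Stored m E.M s (T.layout A₁ A₂ o₁ o₂ s q) → σ.reg 34 = T.entry s q →
      σ.reg 30 = a₁ → σ.reg 31 = b₁ → σ.reg 32 = a₂ → σ.reg 33 = b₂ → σ.reg 45 = 0 →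
      ∃ t σ', Rounds E m 45 34 visitCmd σ t σ' ∧
        t ≤ T.cost A₁ A₂ (common A₁ A₂ a₁ b₁ a₂ b₂) L ∧ σ'.reg 34 = q ∧
        σ'.out = (T.colors.filter (common A₁ A₂ a₁ b₁ a₂ b₂)).reverse ++ σ.out ∧
        ∀ r, (30 ≤ r ∧ r ≤ 33) ∨ r = 45 → σ'.reg r = σ.reg r := by
  induction T with
  | nil =>
    intro s q σ _ _ _ h34 _ _ _ _ _
    exact ⟨0, σ, .refl σ, le_rfl, h34, rfl, fun _ _ => rfl⟩
  | node x l r ihl ihr =>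
    intro s q σ hC hs hst h34 h30 h31 h32 h33 h45
    obtain ⟨hn, hst⟩ := Stored.append_iff.1 hst
    obtain ⟨hl, hr⟩ := Stored.append_iff.1 hst
    rw [length_nodeBlock] at hl hr
    rw [length_layout] at hr
    obtain ⟨t, σ', he, ht, e34, ho, hk⟩ := visitCmd_spec H hC (List.mem_cons_self ..) hn h34 h30
      h31 h32 h33 hab₁ hab₂ hb₁ hb₂
    -- Register `45` holds `0`. Records have positive addresses, so the address `0` can mark the end
    -- of the walk.
    have hlt : σ.reg 45 < σ.reg 34 := by rw [h45, h34]; exact hs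
    have hfilter : ((node x l r).colors.filter (common A₁ A₂ a₁ b₁ a₂ b₂)).reverse ++ σ.out =
        (r.colors.filter (common A₁ A₂ a₁ b₁ a₂ b₂)).reverse ++
          ((l.colors.filter (common A₁ A₂ a₁ b₁ a₂ b₂)).reverse ++ σ'.out) := by
      rw [ho, colors, List.filter_cons, List.filter_append]
      split_ifs <;> simp
    rw [hfilter]
    by_cases hany : (node x l r).colors.any (common A₁ A₂ a₁ b₁ a₂ b₂) = true
    · rw [if_pos hany] at e34
      have hCl : l.colors ⊆ C := fun y hy =>
        hC (List.mem_cons_of_mem _ (List.mem_append_left _ hy))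
      have hCr : r.colors ⊆ C := fun y hy =>
        hC (List.mem_cons_of_mem _ (List.mem_append_right _ hy))
      obtain ⟨t₁, σ₁, he₁, ht₁, e34₁, ho₁, hk₁⟩ := ihl _ _ σ' hCl (by omega) hl e34
        (by rw [hk 30 (by simp), h30]) (by rw [hk 31 (by simp), h31])
        (by rw [hk 32 (by simp), h32]) (by rw [hk 33 (by simp), h33])
        (by rw [hk 45 (by simp), h45])
      obtain ⟨t₂, σ₂, he₂, ht₂, e34₂, ho₂, hk₂⟩ := ihr _ _ σ₁ hCr (by omega) hr e34₁
        (by rw [hk₁ 30 (by simp), hk 30 (by simp), h30])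
        (by rw [hk₁ 31 (by simp), hk 31 (by simp), h31])
        (by rw [hk₁ 32 (by simp), hk 32 (by simp), h32])
        (by rw [hk₁ 33 (by simp), hk 33 (by simp), h33])
        (by rw [hk₁ 45 (by simp), hk 45 (by simp), h45])
      refine ⟨_, σ₂, .step hlt he (he₁.trans he₂), ?_, e34₂, by rw [ho₂, ho₁], fun r hr => ?_⟩
      · rw [cost, if_pos hany]; omega
      · rw [hk₂ r hr, hk₁ r hr, hk r hr]
    · rw [if_neg hany] at e34
      refine ⟨_, σ', .step hlt he (.refl σ'), ?_, e34, ?_, hk⟩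
      · rw [cost, if_neg hany]; omega
      · have hnone : ∀ y ∈ (node x l r).colors, common A₁ A₂ a₁ b₁ a₂ b₂ y = false := by
          simpa using hany
        rw [List.filter_eq_nil_iff.2, List.filter_eq_nil_iff.2]
        · rfl
        · intro y hy
          simp [hnone y (List.mem_cons_of_mem _ (List.mem_append_left _ hy))]
        · intro y hy
          simp [hnone y (List.mem_cons_of_mem _ (List.mem_append_right _ hy))]

/-- A list of positive weights can be split at an element such that both parts have at most half
of the weight. -/
theorem exists_median (w : ℕ → ℕ) (Γ : List ℕ) (hne : Γ ≠ []) :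
    ∃ Γ₁ x Γ₂, Γ = Γ₁ ++ x :: Γ₂ ∧ 2 * (Γ₁.map w).sum ≤ (Γ.map w).sum ∧
      2 * (Γ₂.map w).sum ≤ (Γ.map w).sum := by
  -- The element to split at is the first one with which the prefix sum reaches half of the total.
  -- By minimality the part before it is light, and the part after it is what then remains.
  have hex : ∃ k, k < Γ.length ∧ (Γ.map w).sum ≤ 2 * ((Γ.take (k + 1)).map w).sum := by
    have := List.length_pos_iff.2 hne
    refine ⟨Γ.length - 1, by omega, ?_⟩
    rw [Nat.sub_add_cancel this, List.take_length]; omega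
  classical
  have hmin := fun j hj => Nat.find_min (m := j) hex hj
  obtain ⟨hk, hk2⟩ := Nat.find_spec hex
  set k := Nat.find hex
  have hsplit : Γ = Γ.take k ++ Γ[k] :: Γ.drop (k + 1) := by
    rw [List.cons_getElem_drop_succ, List.take_append_drop]
  refine ⟨Γ.take k, Γ[k], Γ.drop (k + 1), hsplit, ?_, ?_⟩
  · rcases Nat.eq_zero_or_pos k with h0 | h0
    · rw [h0]; simp
    · have := hmin (k - 1) (by omega)
      rw [Nat.sub_add_cancel h0] at this
      by_contra hc
      exact this ⟨by omega, by omega⟩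
  · have : (Γ.map w).sum = ((Γ.take (k + 1)).map w).sum + ((Γ.drop (k + 1)).map w).sum := by
      rw [← List.sum_append, ← List.map_append, List.take_append_drop]
    omega

/-- Splitting at a weighted median halves the weight on each level. All weights are positive, so a
list of total weight below `1` is empty and the recursion ends at height `0`. -/
theorem exists_colorTree (w : ℕ → ℕ) : ∀ (h : ℕ) (Γ : List ℕ), (∀ x ∈ Γ, 1 ≤ w x) →
    (Γ.map w).sum < 2 ^ h → ∃ T : ColorTree, T.colors.Perm Γ ∧ T.height ≤ h := by
  intro h
  induction h with
  | zero =>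
    intro Γ hw hsum
    cases Γ with
    | nil => exact ⟨nil, .refl _, le_rfl⟩
    | cons x Γ =>
      have := hw x (List.mem_cons_self ..)
      simp at hsum; omega
  | succ h ih =>
    intro Γ hw hsum
    rcases eq_or_ne Γ [] with rfl | hne
    · exact ⟨nil, .refl _, Nat.zero_le _⟩
    obtain ⟨Γ₁, x, Γ₂, rfl, h₁, h₂⟩ := exists_median w Γ hne
    rw [pow_succ] at hsum
    obtain ⟨T₁, hp₁, hh₁⟩ := ih Γ₁ (fun y hy => hw y (by simp [hy])) (by omega)
    obtain ⟨T₂, hp₂, hh₂⟩ := ih Γ₂ (fun y hy => hw y (by simp [hy])) (by omega)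
    refine ⟨node x T₁ T₂, ?_, ?_⟩
    · exact ((hp₁.append hp₂).cons x).trans List.perm_middle.symm
    · rw [height]; omega

end ColorTree

/-- The number of positions of a colour in both arrays. -/
def weight (A₁ A₂ : List ℕ) (x : ℕ) : ℕ := (pos A₁ [x]).length + (pos A₂ [x]).length

/-- A union bound over the colours of `Γ`; repeated colours do no harm. For the opposite estimate
`sum_length_pos_le` they have to be distinct. -/
theorem length_pos_le_sum (A : List ℕ) (Γ : List ℕ) :
    (pos A Γ).length ≤ (Γ.map fun x => (pos A [x]).length).sum := by
  induction Γ with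
  | nil => simp [pos]
  | cons x Γ ih =>
    rw [List.map_cons, List.sum_cons]
    refine le_trans ?_ (Nat.add_le_add_left ih _)
    have key : ∀ (f g : ℕ → Bool) (l : List ℕ), (l.filter fun p => f p || g p).length ≤
        (l.filter f).length + (l.filter g).length := by
      intro f g l
      induction l with
      | nil => simp
      | cons y l ih => cases hf : f y <;> cases hg : g y <;> simp [hf, hg] <;> omega
    have := key (fun p => decide (A.getD p 0 ∈ [x])) (fun p => decide (A.getD p 0 ∈ Γ))
      (List.range A.length)
    simp only [← Bool.decide_or, List.mem_singleton] at this
    simpa only [pos, List.mem_cons, List.not_mem_nil, or_false] using this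

theorem length_pos_add_le (A₁ A₂ Γ : List ℕ) :
    (pos A₁ Γ).length + (pos A₂ Γ).length ≤ (Γ.map (weight A₁ A₂)).sum := by
  have : (Γ.map (weight A₁ A₂)).sum = (Γ.map fun x => (pos A₁ [x]).length).sum +
      (Γ.map fun x => (pos A₂ [x]).length).sum := by
    induction Γ with
    | nil => rfl
    | cons x Γ ih => simp only [List.map_cons, List.sum_cons, ih, weight]; omega
  rw [this]
  exact Nat.add_le_add (length_pos_le_sum A₁ Γ) (length_pos_le_sum A₂ Γ)

/-! ### Space and query time of the colour tree -/

namespace ColorTree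

/-- Every occurrence is charged to at most one record on each level. The constant comes from `60 *
(n + 1) ≤ 120 * W`, valid since the weight `W` of a nonempty subtree is at least `1` and bounds `n`.
-/
theorem space_le (A₁ A₂ : List ℕ) (T : ColorTree) (hw : ∀ x ∈ T.colors, 1 ≤ weight A₁ A₂ x) :
    T.space A₁ A₂ ≤ 120 * (T.height * (T.colors.map (weight A₁ A₂)).sum) := by
  induction T with
  | nil => simp [space]
  | node x l r ihl ihr =>
    have hl := ihl fun y hy => hw y (List.mem_cons_of_mem _ (List.mem_append_left _ hy))
    have hr := ihr fun y hy => hw y (List.mem_cons_of_mem _ (List.mem_append_right _ hy))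
    have hx := hw x (List.mem_cons_self ..)
    have h1 := nodeSize_le A₁ A₂ (node x l r).colors
    have h2 := length_pos_add_le A₁ A₂ (node x l r).colors
    have hsum : ((node x l r).colors.map (weight A₁ A₂)).sum = weight A₁ A₂ x +
        ((l.colors.map (weight A₁ A₂)).sum + (r.colors.map (weight A₁ A₂)).sum) := by
      simp [colors]
    set W := ((node x l r).colors.map (weight A₁ A₂)).sum
    set Wl := (l.colors.map (weight A₁ A₂)).sum
    set Wr := (r.colors.map (weight A₁ A₂)).sum
    rw [space, height]
    have hl' : l.height * Wl ≤ max l.height r.height * Wl :=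
      Nat.mul_le_mul_right _ (le_max_left _ _)
    have hr' : r.height * Wr ≤ max l.height r.height * Wr :=
      Nat.mul_le_mul_right _ (le_max_right _ _)
    have hlr : max l.height r.height * Wl + max l.height r.height * Wr ≤
        max l.height r.height * W := by
      rw [← Nat.mul_add]
      exact Nat.mul_le_mul_left _ (by omega)
    rw [Nat.add_mul, Nat.one_mul]
    omega

/-- Cauchy–Schwarz for the vectors `(√a, √c)` and `(√b, √d)`. -/
theorem sqrt_mul_add_sqrt_mul_le {a b c d : ℝ} (ha : 0 ≤ a) (hb : 0 ≤ b) (hc : 0 ≤ c)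
    (hd : 0 ≤ d) : √(a * b) + √(c * d) ≤ √((a + c) * (b + d)) := by
  refine Real.le_sqrt_of_sq_le ?_
  have h1 := Real.sq_sqrt (mul_nonneg ha hb)
  have h2 := Real.sq_sqrt (mul_nonneg hc hd)
  have h3 : √(a * b) * √(c * d) = √(a * d) * √(c * b) := by
    rw [← Real.sqrt_mul (mul_nonneg ha hb), ← Real.sqrt_mul (mul_nonneg ha hd)]
    congr 1; ring
  have h4 := Real.sq_sqrt (mul_nonneg ha hd)
  have h5 := Real.sq_sqrt (mul_nonneg hc hb)
  nlinarith [sq_nonneg (√(a * d) - √(c * b))]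

/-- Induction with a potential. The term `√W` pays for a visited node whose test fails. If the test
succeeds, then `k ≥ 1`, and the new level of the height pays for the terms `√Wl` and `√Wr` of the
children, each at most `√(W * k)`; the main terms of the children combine by Cauchy–Schwarz. In
`1204`, `1200` comes from the `600` of a visit and the block length being at most `2 * √W`; the rest
covers the loop overhead. -/
theorem cost_le (A₁ A₂ : List ℕ) (f : ℕ → Bool) {L : ℕ} (hL : 0 < L) (T : ColorTree)
    (hw : ∀ x ∈ T.colors, 1 ≤ weight A₁ A₂ x) :
    (T.cost A₁ A₂ f L : ℝ) ≤ 1204 * L * (3 * T.height *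
      √((T.colors.map (weight A₁ A₂)).sum * (T.colors.filter f).length) +
      √(T.colors.map (weight A₁ A₂)).sum) := by
  induction T with
  | nil => rw [cost, Nat.cast_zero]; positivity
  | node x l r ihl ihr =>
    have hl := ihl fun y hy => hw y (List.mem_cons_of_mem _ (List.mem_append_left _ hy))
    have hr := ihr fun y hy => hw y (List.mem_cons_of_mem _ (List.mem_append_right _ hy))
    have hx := hw x (List.mem_cons_self ..)
    have h2 := length_pos_add_le A₁ A₂ (node x l r).colors
    have hsum : ((node x l r).colors.map (weight A₁ A₂)).sum = weight A₁ A₂ x +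
        ((l.colors.map (weight A₁ A₂)).sum + (r.colors.map (weight A₁ A₂)).sum) := by
      simp [colors]
    have hk : (l.colors.filter f).length + (r.colors.filter f).length ≤
        ((node x l r).colors.filter f).length := by
      rw [colors, List.filter_cons, List.filter_append]
      split_ifs <;> simp
    have hany : (node x l r).colors.any f = true → 1 ≤ ((node x l r).colors.filter f).length := by
      intro h
      obtain ⟨y, hy, hf⟩ := List.any_eq_true.1 h
      exact List.length_pos_of_mem (List.mem_filter.2 ⟨hy, hf⟩)
    set W := ((node x l r).colors.map (weight A₁ A₂)).sum
    set Wl := (l.colors.map (weight A₁ A₂)).sum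
    set Wr := (r.colors.map (weight A₁ A₂)).sum
    set k := ((node x l r).colors.filter f).length
    set kl := (l.colors.filter f).length
    set kr := (r.colors.filter f).length
    have hL' : (1 : ℝ) ≤ L := by exact_mod_cast hL
    have hW1 : (1 : ℝ) ≤ W := by exact_mod_cast (by omega : 1 ≤ W)
    have hsW : 1 ≤ √(W : ℝ) := Real.one_le_sqrt.2 hW1
    have hB : (blockLen A₁ A₂ (node x l r).colors : ℝ) ≤ 2 * √(W : ℝ) := by
      have : ((Nat.sqrt ((pos A₁ (node x l r).colors).length +
          (pos A₂ (node x l r).colors).length) : ℕ) : ℝ) ≤ √(W : ℝ) := by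
        refine Real.nat_sqrt_le_real_sqrt.trans (Real.sqrt_le_sqrt ?_)
        exact_mod_cast h2
      rw [blockLen]; push_cast; linarith
    have hnode : (600 * (blockLen A₁ A₂ (node x l r).colors * L) + 2 : ℝ) ≤
        1204 * L * √(W : ℝ) := by
      have h3 : (blockLen A₁ A₂ (node x l r).colors * L : ℝ) ≤ 2 * √(W : ℝ) * L :=
        mul_le_mul_of_nonneg_right hB (by linarith)
      have h4 : (1 : ℝ) ≤ √(W : ℝ) * L := by nlinarith
      nlinarith
    have hh : (0 : ℝ) ≤ (node x l r).height := Nat.cast_nonneg _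
    rw [cost]
    by_cases ha : (node x l r).colors.any f = true
    · rw [if_pos ha]
      have hk1 : (1 : ℝ) ≤ k := by exact_mod_cast hany ha
      have hlW : √(Wl : ℝ) ≤ √(W * k : ℝ) := Real.sqrt_le_sqrt (by
        have : (Wl : ℝ) ≤ W := by exact_mod_cast (by omega : Wl ≤ W)
        nlinarith)
      have hrW : √(Wr : ℝ) ≤ √(W * k : ℝ) := Real.sqrt_le_sqrt (by
        have : (Wr : ℝ) ≤ W := by exact_mod_cast (by omega : Wr ≤ W)
        nlinarith)
      have hcs : √(Wl * kl : ℝ) + √(Wr * kr : ℝ) ≤ √(W * k : ℝ) := by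
        refine (sqrt_mul_add_sqrt_mul_le (Nat.cast_nonneg _) (Nat.cast_nonneg _)
          (Nat.cast_nonneg _) (Nat.cast_nonneg _)).trans (Real.sqrt_le_sqrt ?_)
        have : (Wl + Wr : ℝ) ≤ W := by exact_mod_cast (by omega : Wl + Wr ≤ W)
        have : (kl + kr : ℝ) ≤ k := by exact_mod_cast hk
        gcongr
      have hhl : (l.height : ℝ) * √(Wl * kl : ℝ) ≤
          (max l.height r.height : ℕ) * √(Wl * kl : ℝ) := by
        gcongr; exact le_max_left _ _
      have hhr : (r.height : ℝ) * √(Wr * kr : ℝ) ≤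
          (max l.height r.height : ℕ) * √(Wr * kr : ℝ) := by
        gcongr; exact le_max_right _ _
      have hhm : ((max l.height r.height : ℕ) : ℝ) * (√(Wl * kl : ℝ) + √(Wr * kr : ℝ)) ≤
          (max l.height r.height : ℕ) * √(W * k : ℝ) := by gcongr
      have hc : (0 : ℝ) ≤ 1204 * L := by positivity
      have hfin : √(W : ℝ) + (3 * l.height * √(Wl * kl : ℝ) + √(Wl : ℝ)) +
          (3 * r.height * √(Wr * kr : ℝ) + √(Wr : ℝ)) ≤
          3 * (node x l r).height * √(W * k : ℝ) + √(W : ℝ) := by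
        rw [height]
        push_cast at hhl hhr hhm ⊢
        nlinarith [Real.sqrt_nonneg (W * k : ℝ)]
      have := mul_le_mul_of_nonneg_left hfin hc
      push_cast
      linarith
    · rw [if_neg ha]
      push_cast
      have : (0 : ℝ) ≤ 1204 * L * (3 * (node x l r).height * √(W * k : ℝ)) := by positivity
      linarith

theorem entry_le (A₁ A₂ : List ℕ) (T : ColorTree) {s q K : ℕ} (hs : s + T.space A₁ A₂ < K)
    (hq : q < K) : T.entry s q < K := by
  cases T with
  | nil => exact hq
  | node x l r => rw [entry]; omega

theorem forall_mem_nodeBlock_lt {A₁ A₂ : List ℕ} {o₁ o₂ : ℕ → ℕ} {Γ : List ℕ}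
    {x p child skip K : ℕ} (hp : p + nodeSize A₁ A₂ Γ < K) (hc : child < K) (hs : skip < K)
    (hx : x ∈ Γ) (hΓ : ∀ y ∈ Γ, y < K) (h₁ : ∀ y ∈ Γ, o₁ y < K) (h₂ : ∀ y ∈ Γ, o₂ y < K)
    (hA₁ : A₁.length < K) (hA₂ : A₂.length < K) (hA : A₁.length * A₂.length < K) :
    ∀ v ∈ nodeBlock A₁ A₂ o₁ o₂ Γ x p child skip, v < K := by
  have hlist : ∀ (A : List ℕ) (o : ℕ → ℕ), A.length < K → (∀ y ∈ Γ, o y < K) →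
      ∀ v ∈ pointerList A Γ o, v < K := by
    intro A o hA ho v hv
    rw [pointerList, List.mem_cons, List.mem_append, List.mem_map] at hv
    rcases hv with rfl | hv | ⟨q, hq, rfl⟩
    · exact (length_pos_le _ _).trans_lt hA
    · exact (mem_pos.1 hv).1.trans hA
    · exact ho _ (mem_pos.1 hq).2
  have hsq := Nat.sqrt_le_self ((pos A₁ Γ).length + (pos A₂ Γ).length)
  have hd := Nat.div_le_self (pos A₂ Γ).length (blockLen A₁ A₂ Γ)
  have hB : blockLen A₁ A₂ Γ = Nat.sqrt ((pos A₁ Γ).length + (pos A₂ Γ).length) + 1 := rfl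
  rw [nodeSize] at hp
  intro v hv
  rw [nodeBlock, List.mem_append, List.mem_append, List.mem_append] at hv
  rcases hv with hv | hv | hv | hv
  · simp only [List.mem_cons, List.not_mem_nil, or_false] at hv
    rcases hv with rfl | rfl | rfl | rfl | rfl | rfl | rfl | rfl | rfl | rfl
    · exact hc
    · exact hs
    · exact hΓ _ hx
    · exact h₁ _ hx
    · exact h₂ _ hx
    all_goals omega
  · exact hlist A₁ o₂ hA₁ h₂ v hv
  · exact hlist A₂ o₁ hA₂ h₁ v hv
  · rw [countTable, List.mem_map] at hv
    obtain ⟨k, -, rfl⟩ := hv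
    exact (prefixCount_le _ _ _ _ _ _).trans_lt hA

theorem forall_mem_layout_lt {A₁ A₂ : List ℕ} {o₁ o₂ : ℕ → ℕ} {K : ℕ} (hA₁ : A₁.length < K)
    (hA₂ : A₂.length < K) (hA : A₁.length * A₂.length < K) (T : ColorTree) :
    ∀ s q, s + T.space A₁ A₂ < K → q < K → (∀ y ∈ T.colors, y < K ∧ o₁ y < K ∧ o₂ y < K) →
      ∀ v ∈ T.layout A₁ A₂ o₁ o₂ s q, v < K := by
  induction T with
  | nil => intro s q _ _ _ v hv; simp [layout] at hv
  | node x l r ihl ihr =>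
    intro s q hs hq hT v hv
    rw [space] at hs
    have hr : r.entry (s + nodeSize A₁ A₂ (node x l r).colors + l.space A₁ A₂) q < K :=
      entry_le A₁ A₂ r (by omega) hq
    rw [layout, List.mem_append, List.mem_append] at hv
    rcases hv with hv | hv | hv
    · exact forall_mem_nodeBlock_lt (Γ := (node x l r).colors) (by omega) (entry_le A₁ A₂ l (by omega) hr) hq
        (List.mem_cons_self ..) (fun y hy => (hT y hy).1) (fun y hy => (hT y hy).2.1)
        (fun y hy => (hT y hy).2.2) hA₁ hA₂ hA v hv
    · exact ihl _ _ (by omega) hr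
        (fun y hy => hT y (List.mem_cons_of_mem _ (List.mem_append_left _ hy))) v hv
    · exact ihr _ _ (by omega) hq
        (fun y hy => hT y (List.mem_cons_of_mem _ (List.mem_append_right _ hy))) v hv

end ColorTree

end SubstringIndexing

namespace SubstringIndexing

open WordRAM

/-! ### The search tree of a list of strings -/

/-- A string that is stored at an address and belongs to a colour. -/
structure Item where
  color : ℕ
  addr : ℕ
  str : List ℕ

/-- Ternary search trees with path compression: at a node, the items share a prefix of length `ℓ`;
those of length `ℓ` are the own items of the node, the others are distributed according to the
comparison of their letter at position `ℓ` with `c`. -/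
inductive Trie
  | nil
  | node (ℓ c : ℕ) (own : List Item) (lt eq gt : Trie)

namespace Trie

/-- The items in the order of the tree. -/
def items : Trie → List Item
  | nil => []
  | node _ _ own lt eq gt => own ++ (lt.items ++ (eq.items ++ gt.items))

/-- The number of nodes. -/
def nodes : Trie → ℕ
  | nil => 0
  | node _ _ _ lt eq gt => 1 + (lt.nodes + (eq.nodes + gt.nodes))

/-- The tree is well-formed, its letters are below `K`, and `d` letters have been read before. -/
def Valid (K : ℕ) : Trie → ℕ → Prop
  | nil, _ => True
  | node ℓ c own lt eq gt, d =>
    d ≤ ℓ ∧ c < K ∧ (node ℓ c own lt eq gt).items ≠ [] ∧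
    (∃ p : List ℕ, p.length = ℓ ∧ ∀ it ∈ (node ℓ c own lt eq gt).items, p <+: it.str) ∧
    (∀ it ∈ own, it.str.length = ℓ) ∧
    (∀ it ∈ lt.items, ∃ y, it.str[ℓ]? = some y ∧ y < c) ∧
    (∀ it ∈ eq.items, it.str[ℓ]? = some c) ∧
    (∀ it ∈ gt.items, ∃ y, it.str[ℓ]? = some y ∧ c < y) ∧
    2 * lt.items.length ≤ (node ℓ c own lt eq gt).items.length ∧
    2 * gt.items.length ≤ (node ℓ c own lt eq gt).items.length ∧
    lt.Valid K ℓ ∧ eq.Valid K (ℓ + 1) ∧ gt.Valid K ℓ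

theorem prefix_concat {p s : List ℕ} {y : ℕ} (h : p <+: s) (hy : s[p.length]? = some y) :
    p ++ [y] <+: s := by
  obtain ⟨t, rfl⟩ := h
  cases t with
  | nil => simp at hy
  | cons z t =>
    obtain rfl : z = y := by simpa using hy
    exact ⟨t, by simp⟩

/-- A longest common prefix. -/
theorem exists_branching (it₀ : Item) (l : List Item) (h₀ : it₀ ∈ l) :
    ∀ (n : ℕ) (p : List ℕ), it₀.str.length - p.length = n → (∀ it ∈ l, p <+: it.str) →
      ∃ p' : List ℕ, p.length ≤ p'.length ∧ (∀ it ∈ l, p' <+: it.str) ∧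
        ((∃ it ∈ l, it.str.length = p'.length) ∨
          (∀ it ∈ l, it.str[p'.length]? ≠ none) ∧
            ∃ it ∈ l, ∃ it' ∈ l, it.str[p'.length]? ≠ it'.str[p'.length]?) := by
  intro n
  induction n with
  | zero =>
    intro p hn hp
    exact ⟨p, le_rfl, hp, .inl ⟨it₀, h₀, by have := (hp it₀ h₀).length_le; omega⟩⟩
  | succ n ih =>
    intro p hn hp
    by_cases hlen : ∃ it ∈ l, it.str.length = p.length
    · exact ⟨p, le_rfl, hp, .inl hlen⟩
    by_cases hdiff : ∃ it ∈ l, ∃ it' ∈ l, it.str[p.length]? ≠ it'.str[p.length]?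
    · refine ⟨p, le_rfl, hp, .inr ⟨fun it hit hnone => hlen ⟨it, hit, ?_⟩, hdiff⟩⟩
      have := List.getElem?_eq_none_iff.1 hnone
      have := (hp it hit).length_le
      omega
    -- All strings continue with the same letter, so the common prefix can be extended.
    · push Not at hdiff
      obtain ⟨y, hy⟩ : ∃ y, it₀.str[p.length]? = some y :=
        ⟨_, List.getElem?_eq_getElem (by omega)⟩
      obtain ⟨p', h1, h2, h3⟩ := ih (p ++ [y]) (by simp; omega)
        fun it hit => prefix_concat (hp it hit) ((hdiff it hit it₀ h₀).trans hy)
      exact ⟨p', by simp at h1; omega, h2, h3⟩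

/-- A median. -/
theorem exists_letter (xs : List ℕ) : ∃ c, 2 * xs.countP (· < c) ≤ xs.length ∧
    2 * xs.countP (c < ·) ≤ xs.length ∧ (c = 0 ∨ ∃ x ∈ xs, c ≤ x) := by
  have hex : ∃ c, xs.length ≤ 2 * xs.countP (· ≤ c) := by
    refine ⟨xs.sum, ?_⟩
    rw [List.countP_eq_length.2]
    · omega
    · intro x hx; simpa using List.le_sum_of_mem hx
  classical
  have hmin := fun j hj => Nat.find_min (m := j) hex hj
  have hc := Nat.find_spec hex
  set c := Nat.find hex
  have hlt : 0 < c → 2 * xs.countP (· < c) < xs.length := by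
    intro h0
    have := hmin (c - 1) (by omega)
    have he : xs.countP (· < c) = xs.countP (· ≤ c - 1) :=
      List.countP_congr fun x _ => by simp only [decide_eq_true_eq]; omega
    omega
  refine ⟨c, ?_, ?_, ?_⟩
  · rcases Nat.eq_zero_or_pos c with h0 | h0
    · simp [h0]
    · exact (hlt h0).le
  · have := List.length_eq_countP_add_countP (l := xs) (fun x => decide (x ≤ c))
    have he : xs.countP (c < ·) = xs.countP fun x => decide ¬ decide (x ≤ c) = true :=
      List.countP_congr fun x _ => by simp
    omega
  -- A positive median does not exceed all letters, since otherwise every letter would be below it.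
  -- This keeps `c` within a word.
  · rcases Nat.eq_zero_or_pos c with h0 | h0
    · exact .inl h0
    · right
      by_contra hne
      push Not at hne
      have := hlt h0
      rw [List.countP_eq_length.2 fun x hx => by simpa using hne x hx] at this
      omega

/-- Extend the common prefix as far as possible, then split at a median of the next letters: the
outer subtrees get at most half of the items, the middle one shares a further letter. The bound on
the nodes holds because every node owns an item or truly branches. -/
theorem exists_trie {K : ℕ} (hK : 0 < K) : ∀ (n : ℕ) (l : List Item), l.length = n →
    (∀ it ∈ l, ∀ x ∈ it.str, x < K) → ∀ p : List ℕ, (∀ it ∈ l, p <+: it.str) →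
      ∃ T : Trie, T.items.Perm l ∧ T.Valid K p.length ∧ T.nodes ≤ 2 * l.length - 1 := by
  intro n
  induction n using Nat.strong_induction_on with
  | _ n ih =>
  intro l hn hlK p hp
  rcases eq_or_ne l [] with rfl | hne
  · exact ⟨nil, .refl _, trivial, Nat.zero_le _⟩
  obtain ⟨it₀, h₀⟩ := List.exists_mem_of_ne_nil l hne
  obtain ⟨p', hpp, hp', hbranch⟩ := exists_branching it₀ l h₀ _ p rfl hp
  set ℓ := p'.length with hℓ
  let own := l.filter fun it => decide (it.str.length = ℓ)
  let rest := l.filter fun it => !decide (it.str.length = ℓ)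
  have hperm : (own ++ rest).Perm l := List.filter_append_perm _ l
  have hrest : ∀ it ∈ rest, it ∈ l ∧ ∃ y, it.str[ℓ]? = some y ∧ it.str.getD ℓ 0 = y := by
    intro it hit
    obtain ⟨hl, hlen⟩ := List.mem_filter.1 hit
    have := (hp' it hl).length_le
    have hlt : ℓ < it.str.length := by simp at hlen; omega
    exact ⟨hl, _, List.getElem?_eq_getElem hlt, List.getD_eq_getElem _ _ hlt⟩
  obtain ⟨c, hc1, hc2, hc3⟩ := exists_letter (rest.map fun it => it.str.getD ℓ 0)
  rw [List.countP_map, List.length_map] at hc1 hc2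
  let lt := rest.filter fun it => decide (it.str.getD ℓ 0 < c)
  let ge := rest.filter fun it => !decide (it.str.getD ℓ 0 < c)
  let eq := ge.filter fun it => decide (it.str.getD ℓ 0 = c)
  let gt := ge.filter fun it => !decide (it.str.getD ℓ 0 = c)
  have hperm2 : (lt ++ ge).Perm rest := List.filter_append_perm _ rest
  have hperm3 : (eq ++ gt).Perm ge := List.filter_append_perm _ ge
  have hpermAll : (own ++ (lt ++ (eq ++ gt))).Perm l :=
    (((hperm3.append_left lt).trans hperm2).append_left own).trans hperm
  have hltm : ∀ it ∈ lt, it ∈ l ∧ ∃ y, it.str[ℓ]? = some y ∧ y < c := by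
    intro it hit
    obtain ⟨hr, hlt⟩ := List.mem_filter.1 hit
    obtain ⟨hl, y, hy, hg⟩ := hrest it hr
    exact ⟨hl, y, hy, by rw [← hg]; simpa using hlt⟩
  have heqm : ∀ it ∈ eq, it ∈ l ∧ it.str[ℓ]? = some c := by
    intro it hit
    obtain ⟨hr, heq⟩ := List.mem_filter.1 hit
    obtain ⟨hl, y, hy, hg⟩ := hrest it (List.mem_filter.1 hr).1
    obtain rfl : y = c := by rw [← hg]; simpa using heq
    exact ⟨hl, hy⟩
  have hgtm : ∀ it ∈ gt, it ∈ l ∧ ∃ y, it.str[ℓ]? = some y ∧ c < y := by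
    intro it hit
    obtain ⟨hr, hneq⟩ := List.mem_filter.1 hit
    obtain ⟨hr, hnlt⟩ := List.mem_filter.1 hr
    obtain ⟨hl, y, hy, hg⟩ := hrest it hr
    rw [hg] at hneq hnlt
    simp at hneq hnlt
    exact ⟨hl, y, hy, by omega⟩
  have hrl : rest.length ≤ l.length := List.length_filter_le _ _
  have hlt2 : 2 * lt.length ≤ l.length := by
    rw [← List.countP_eq_length_filter]
    exact hc1.trans hrl
  have hgt2 : 2 * gt.length ≤ l.length := by
    have : gt.length = rest.countP ((fun x => decide (c < x)) ∘ fun it => it.str.getD ℓ 0) := by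
      rw [← List.countP_eq_length_filter, List.countP_filter]
      refine List.countP_congr fun it _ => ?_
      simp only [Function.comp, Bool.and_eq_true, Bool.not_eq_true', decide_eq_true_eq,
        decide_eq_false_iff_not]
      omega
    rw [this]
    exact hc2.trans hrl
  have hsum : own.length + (lt.length + (eq.length + gt.length)) = l.length := by
    simpa using hpermAll.length_eq
  have hpos : 0 < l.length := List.length_pos_iff.2 hne
  -- Without own items the strings differ at position `ℓ`, so the middle part is not everything.
  -- Neither outer part is more than half, so at least two parts are nonempty. This gives both
  -- termination and the count `2 * l.length - 1`.
  have hcase : 0 < own.length ∨ own.length = 0 ∧ eq.length < l.length := by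
    rcases hbranch with ⟨it, hit, hlen⟩ | ⟨-, it, hit, it', hit', hdiff⟩
    · exact .inl (List.length_pos_of_mem (List.mem_filter.2 ⟨hit, by simpa using hlen⟩))
    · rcases Nat.eq_zero_or_pos own.length with h | h
      · refine .inr ⟨h, ?_⟩
        by_contra hge
        have h1 : own = [] := List.eq_nil_of_length_eq_zero h
        have h2 : lt = [] := List.eq_nil_of_length_eq_zero (by omega)
        have h3 : gt = [] := List.eq_nil_of_length_eq_zero (by omega)
        rw [h1, h2, h3, List.nil_append, List.nil_append, List.append_nil] at hpermAll
        exact hdiff ((heqm it (hpermAll.mem_iff.2 hit)).2.trans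
          (heqm it' (hpermAll.mem_iff.2 hit')).2.symm)
      · exact .inl h
  have hcK : c < K := by
    rcases hc3 with rfl | ⟨x, hx, hcx⟩
    · exact hK
    · obtain ⟨it, hit, rfl⟩ := List.mem_map.1 hx
      obtain ⟨hl, y, hy, hg⟩ := hrest it hit
      rw [hg] at hcx
      exact hcx.trans_lt (hlK it hl y (List.mem_of_getElem? hy))
  obtain ⟨T₁, hT₁, hv₁, hn₁⟩ := ih lt.length (by omega) lt rfl
    (fun it hit => hlK it (hltm it hit).1) p' fun it hit => hp' it (hltm it hit).1
  obtain ⟨T₂, hT₂, hv₂, hn₂⟩ := ih eq.length (by omega) eq rfl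
    (fun it hit => hlK it (heqm it hit).1) (p' ++ [c]) fun it hit =>
      prefix_concat (hp' it (heqm it hit).1) (heqm it hit).2
  obtain ⟨T₃, hT₃, hv₃, hn₃⟩ := ih gt.length (by omega) gt rfl
    (fun it hit => hlK it (hgtm it hit).1) p' fun it hit => hp' it (hgtm it hit).1
  have hitems : (node ℓ c own T₁ T₂ T₃).items.Perm l :=
    ((hT₁.append (hT₂.append hT₃)).append_left own).trans hpermAll
  refine ⟨node ℓ c own T₁ T₂ T₃, hitems, ⟨hpp, hcK, ?_, ⟨p', rfl, fun it hit =>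
    hp' it (hitems.mem_iff.1 hit)⟩, ?_, ?_, ?_, ?_, ?_, ?_, hv₁, by simpa using hv₂, hv₃⟩, ?_⟩
  · rw [← List.length_pos_iff, hitems.length_eq]; exact hpos
  · intro it hit
    simpa using (List.mem_filter.1 hit).2
  · exact fun it hit => (hltm it (hT₁.mem_iff.1 hit)).2
  · exact fun it hit => (heqm it (hT₂.mem_iff.1 hit)).2
  · exact fun it hit => (hgtm it (hT₃.mem_iff.1 hit)).2
  · rw [hitems.length_eq, hT₁.length_eq]; exact hlt2
  · rw [hitems.length_eq, hT₃.length_eq]; exact hgt2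
  · rw [nodes]; omega

/-- The address of the record of a tree at address `s`; `z` stands for the empty tree. -/
def entry (z : ℕ) : Trie → ℕ → ℕ
  | nil, _ => z
  | node .., s => s

/-- The records of the nodes of a tree, from address `s` on, if its first item has number `a`. -/
def layout (z : ℕ) : Trie → ℕ → ℕ → List ℕ
  | nil, _, _ => []
  | node ℓ c own lt eq gt, s, a =>
    let s₁ := s + 8
    let s₂ := s₁ + 8 * lt.nodes
    let s₃ := s₂ + 8 * eq.nodes
    let a₁ := a + own.length
    let a₂ := a₁ + lt.items.length
    let a₃ := a₂ + eq.items.length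
    [ℓ, c, lt.entry z s₁, eq.entry z s₂, gt.entry z s₃,
      ((node ℓ c own lt eq gt).items.map Item.addr).headI, a,
      a + (node ℓ c own lt eq gt).items.length] ++
    (lt.layout z s₁ a₁ ++ (eq.layout z s₂ a₂ ++ gt.layout z s₃ a₃))

theorem length_layout (z : ℕ) (T : Trie) : ∀ s a, (T.layout z s a).length = 8 * T.nodes := by
  induction T with
  | nil => intro s a; rfl
  | node ℓ c own lt eq gt ih₁ ih₂ ih₃ =>
    intro s a
    simp only [layout, List.length_append, ih₁, ih₂, ih₃, nodes, List.length_cons,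
      List.length_nil]
    omega

theorem entry_lt {z s K : ℕ} (T : Trie) (hz : z < K) (hs : s + 8 * T.nodes < K) :
    T.entry z s < K := by
  cases T with
  | nil => exact hz
  | node ℓ c own lt eq gt => rw [entry]; omega

theorem forall_mem_layout_lt {z K : ℕ} (hz : z < K) (T : Trie) : ∀ s a d,
    T.Valid K d → s + 8 * T.nodes < K → a + T.items.length < K →
    (∀ it ∈ T.items, it.addr < K ∧ it.str.length < K) → ∀ v ∈ T.layout z s a, v < K := by
  induction T with
  | nil => intro s a d _ _ _ _ v hv; simp [layout] at hv
  | node ℓ c own lt eq gt ih₁ ih₂ ih₃ =>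
    intro s a d hV hs ha hit v hv
    obtain ⟨-, hc, hne, ⟨p, rfl, hp⟩, -, -, -, -, -, -, hv₁, hv₂, hv₃⟩ := hV
    obtain ⟨it₀, l, hl⟩ := List.exists_cons_of_ne_nil hne
    have h₀ : it₀ ∈ (node p.length c own lt eq gt).items := hl ▸ List.mem_cons_self ..
    have hpK := (hp it₀ h₀).length_le.trans_lt (hit it₀ h₀).2
    have haddr := (hit it₀ h₀).1
    rw [nodes] at hs
    have ha' := ha
    simp only [items, List.length_append] at ha'
    have hsub : ∀ it, it ∈ lt.items ∨ it ∈ eq.items ∨ it ∈ gt.items →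
        it.addr < K ∧ it.str.length < K := fun it h => hit it (by simp [items, h])
    rw [layout, List.mem_append, List.mem_append, List.mem_append] at hv
    rcases hv with hv | hv | hv | hv
    · simp only [List.mem_cons, List.not_mem_nil, or_false] at hv
      rcases hv with rfl | rfl | rfl | rfl | rfl | rfl | rfl | rfl
      · exact hpK
      · exact hc
      · exact entry_lt lt hz (by omega)
      · exact entry_lt eq hz (by omega)
      · exact entry_lt gt hz (by omega)
      · rw [hl]; exact haddr
      · omega
      · exact ha
    · exact ih₁ _ _ _ hv₁ (by omega) (by omega) (fun it h => hsub it (.inl h)) v hv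
    · exact ih₂ _ _ _ hv₂ (by omega) (by omega) (fun it h => hsub it (.inr (.inl h))) v hv
    · exact ih₃ _ _ _ hv₃ (by omega) (by omega) (fun it h => hsub it (.inr (.inr h))) v hv

end Trie

end SubstringIndexing

namespace SubstringIndexing

open WordRAM

/-! ### Searching a pattern -/

/-- One round of the descent in a search tree: `R[46]` is the address of the current record and
`R[47]` the number of letters that its items share. -/
def descendCmd (k : Bool) : Cmd := .block [
  .letter k 49 47, .op .add 50 46 53, .load 50 50,
  .ite 49 50 (.const 51 2) (.ite 50 49 (.const 51 4) (.const 51 3)),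
  .op .add 46 46 51, .load 46 46, .load 47 46]

/-- The child pointers are at offsets `2`, `3`, `4` of the record. The first entry of the child, its
prefix length, is fetched in advance, for it controls the loop. -/
theorem descendCmd_spec {E : Env} {m : ℕ → ℕ} (hS : Sound E m) {k : Bool} {σ : State}
    {v ℓ c p₁ p₂ p₃ y p : ℕ} {rec : List ℕ}
    (hst : Stored m E.M v (ℓ :: c :: p₁ :: p₂ :: p₃ :: rec)) (h46 : σ.reg 46 = v)
    (h47 : σ.reg 47 = ℓ) (h53 : σ.reg 53 = 1) (hy : (E.query k)[ℓ]? = some y) (hyw : y < 2 ^ E.w)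
    (hp : p = if y < c then p₁ else if c < y then p₃ else p₂) (hpM : p < E.M) :
    Ev E m (descendCmd k) σ fun t σ' => t ≤ 11 ∧ σ'.reg 46 = p ∧ σ'.reg 47 = m p ∧
      (∀ r, r < 46 ∨ 51 < r ∨ r = 48 → σ'.reg r = σ.reg r) ∧ σ'.out = σ.out := by
  have hw := hS.addr
  have hl := hS.large
  simp only [Stored.cons_iff, Nat.add_assoc, Nat.reduceAdd] at hst
  obtain ⟨⟨m0, h0⟩, ⟨m1, h1⟩, ⟨m2, h2⟩, ⟨m3, h3⟩, ⟨m4, h4⟩, -⟩ := hst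
  have hc := h1 ▸ hS.word _ m1
  have hmp := hS.word p hpM
  refine Ev.cons (Ev.letter y (by rw [h47]; exact hy) hyw ?_)
  refine Ev.cons (Ev.op (v + 1) (by simp [BinOp.eval, h46, h53]) (by omega) ?_)
  refine Ev.cons (Ev.load c (by simpa using m1) (by simpa using h1) hc ?_)
  have fin : ∀ (t d : ℕ), t ≤ 5 → d < E.M - v → m (v + d) = p → ∀ τ : State,
      τ = (((σ.set 49 y).set 50 (v + 1)).set 50 c).set 51 d →
      Ev E m (.block [.op .add 46 46 51, .load 46 46, .load 47 46]) τ fun t' σ' =>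
        1 + (1 + (1 + (t + t'))) ≤ 11 ∧ σ'.reg 46 = p ∧ σ'.reg 47 = m p ∧
        (∀ r, r < 46 ∨ 51 < r ∨ r = 48 → σ'.reg r = σ.reg r) ∧ σ'.out = σ.out := by
    rintro t d ht hd hm τ rfl
    refine Ev.cons (Ev.op (v + d) (by simp [BinOp.eval, h46]) (by omega) ?_)
    refine Ev.cons (Ev.load p (by simp; omega) (by simpa using hm) (by omega) ?_)
    refine Ev.cons (Ev.load (m p) (by simpa using hpM) (by simp) hmp (Ev.nil ?_))
    refine ⟨by omega, by simp, by simp, fun r hr => ?_, by simp⟩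
    have hne : ∀ s ∈ [46, 47, 49, 50, 51], r ≠ s := by
      intro s hs
      simp only [List.mem_cons, List.not_mem_nil, or_false] at hs
      omega
    simp only [List.mem_cons, forall_eq_or_imp, List.not_mem_nil, false_imp_iff,
      implies_true, and_true] at hne
    simp only [State.set_reg, hne, if_false]
  refine Ev.cons (Ev.ite (fun hc1 => ?_) (fun hc1 => ?_))
  · simp at hc1
    rw [if_pos hc1] at hp
    exact Ev.const (by omega) (fin _ 2 (by omega) (by omega) (by rw [h2, hp]) _ rfl)
  · simp at hc1
    rw [if_neg (by omega)] at hp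
    refine Ev.ite (fun hc2 => ?_) (fun hc2 => ?_)
    · simp at hc2
      rw [if_pos hc2] at hp
      exact Ev.const (by omega) (fin _ 4 (by omega) (by omega) (by rw [h4, hp]) _ rfl)
    · simp at hc2
      rw [if_neg (by omega)] at hp
      exact Ev.const (by omega) (fin _ 3 (by omega) (by omega) (by rw [h3, hp]) _ rfl)

/-- The record of the empty tree: no query string is longer than its first entry. -/
def sentinel (w : ℕ) : List ℕ := [2 ^ w - 1, 0, 0, 0, 0, 0, 0, 0]

theorem not_prefix_of_getElem?_ne {σ s : List ℕ} {i y : ℕ} (h : σ[i]? = some y)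
    (h' : s[i]? ≠ some y) : ¬ σ <+: s := by
  rintro ⟨t, rfl⟩
  apply h'
  rw [List.getElem?_append_left (List.getElem?_eq_some_iff.1 h).1, h]

/-- The descent ends at a record for the items that can start with the query string. -/
structure Found (E : Env) (m : ℕ → ℕ) (q : List ℕ) (its : List Item) (a z v : ℕ)
    (pre mid post : List Item) : Prop where
  split : its = pre ++ (mid ++ post)
  pre_not : ∀ it ∈ pre, ¬ q <+: it.str
  post_not : ∀ it ∈ post, ¬ q <+: it.str
  target : mid = [] ∧ v = z ∨ ∃ it₀ l, mid = it₀ :: l ∧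
    (∃ ℓ c p₁ p₂ p₃, Stored m E.M v
      [ℓ, c, p₁, p₂, p₃, it₀.addr, a + pre.length, a + pre.length + mid.length]) ∧
    ∃ p : List ℕ, q.length ≤ p.length ∧ ∀ it ∈ mid, p <+: it.str

/-- Passing from a subtree to its parent adds items that cannot start with the query on both sides;
the item numbers are already absolute. -/
theorem Found.extend {E : Env} {m : ℕ → ℕ} {q : List ℕ} {its : List Item} {a z v : ℕ}
    {pre mid post : List Item} (before after : List Item)
    (h : Found E m q its (a + before.length) z v pre mid post)
    (hb : ∀ it ∈ before, ¬ q <+: it.str) (ha : ∀ it ∈ after, ¬ q <+: it.str) :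
    Found E m q (before ++ (its ++ after)) a z v (before ++ pre) mid (post ++ after) := by
  obtain ⟨hs, h1, h2, h3⟩ := h
  refine ⟨by simp [hs], ?_, ?_, ?_⟩
  · intro it hit
    rcases List.mem_append.1 hit with h | h
    exacts [hb it h, h1 it h]
  · intro it hit
    rcases List.mem_append.1 hit with h | h
    exacts [h2 it h, ha it h]
  · simpa only [List.length_append, Nat.add_assoc] using h3

/-- The potential `|q| - d + h` drops in each round: the middle child raises `d`, an outer child has
at most half of the items and lowers `h`. A round costs `11` steps and `2` for the loop. Letters
inside compressed paths are not compared here, so the items found are only candidates. -/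
theorem Trie.descend {E : Env} {m : ℕ → ℕ} (hS : Sound E m) {k : Bool}
    (hqw : FitsWord E.w (E.query k)) (hql : (E.query k).length < 2 ^ E.w) {z K : ℕ}
    (hz : Stored m E.M z (sentinel E.w)) (T : Trie) : ∀ (d s a h : ℕ) (σ : State),
    T.Valid K d → Stored m E.M s (T.layout z s a) → T.items.length < 2 ^ h →
    σ.reg 46 = T.entry z s → σ.reg 47 = m (T.entry z s) → σ.reg 48 = (E.query k).length →
    σ.reg 53 = 1 → ∃ t σ' pre mid post, Rounds E m 47 48 (descendCmd k) σ t σ' ∧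
      t ≤ 13 * ((E.query k).length - d + h) ∧
      Found E m (E.query k) T.items a z (σ'.reg 46) pre mid post ∧
      ¬ σ'.reg 47 < σ'.reg 48 ∧
      (∀ r, r < 46 ∨ 51 < r ∨ r = 48 → σ'.reg r = σ.reg r) ∧ σ'.out = σ.out := by
  have hz0 : m z = 2 ^ E.w - 1 := by
    have := hz.2 0 (by simp [sentinel])
    simpa [sentinel] using this
  have hzM : z < E.M := by have := hz.1; simp [sentinel] at this; omega
  induction T with
  | nil =>
    intro d s a h σ _ _ _ h46 h47 h48 _
    rw [entry] at h46 h47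
    -- The sentinel holds `2 ^ E.w - 1`, which is not below the length of any admissible query, so
    -- the loop stops at an empty tree.
    refine ⟨0, σ, [], [], [], .refl σ, Nat.zero_le _, ⟨rfl, by simp, by simp, .inl ⟨rfl, h46⟩⟩,
      by omega, fun _ _ => rfl, rfl⟩
  | node ℓ c own lt eq gt ih₁ ih₂ ih₃ =>
    intro d s a h σ hV hst hh h46 h47 h48 h53
    obtain ⟨hd, hcK, hne, ⟨p, rfl, hp⟩, hown, hlt, heq, hgt, hlt2, hgt2, hv₁, hv₂, hv₃⟩ := hV
    obtain ⟨hrec, hst'⟩ := Stored.append_iff.1 hst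
    obtain ⟨hs₁, hst'⟩ := Stored.append_iff.1 hst'
    obtain ⟨hs₂, hs₃⟩ := Stored.append_iff.1 hst'
    simp only [length_layout, List.length_cons, List.length_nil, Nat.zero_add, Nat.reduceAdd]
      at hs₁ hs₂ hs₃
    obtain ⟨it₀, l, hl⟩ := List.exists_cons_of_ne_nil hne
    have hms : m s = p.length := (Stored.cons_iff.1 hrec).1.2
    rw [entry] at h46 h47
    rw [hms] at h47
    have hent : ∀ T' : Trie, ∀ s', s' + (T'.layout z s' a).length ≤ E.M →
        T'.entry z s' < E.M := by
      intro T' s' h'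
      cases T' with
      | nil => exact hzM
      | node => simp only [length_layout, nodes] at h'; rw [entry]; omega
    simp only [length_layout] at hent
    have hM₁ := hs₁.1
    have hM₂ := hs₂.1
    have hM₃ := hs₃.1
    simp only [length_layout] at hM₁ hM₂ hM₃
    -- If the query ends within the prefix shared at this node, nothing distinguishes its items any
    -- more and all of them stay candidates.
    by_cases hlen : (E.query k).length ≤ p.length
    · have : ((node p.length c own lt eq gt).items.map Item.addr).headI = it₀.addr := by
        rw [hl]; rfl
      rw [this, ← h46] at hrec
      exact ⟨0, σ, [], (node p.length c own lt eq gt).items, [], .refl σ, Nat.zero_le _,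
        ⟨by simp, by simp, by simp, .inr ⟨it₀, l, hl, ⟨_, _, _, _, _, hrec⟩, p, hlen, hp⟩⟩,
        by omega, fun _ _ => rfl, rfl⟩
    · have hyE := List.getElem?_eq_getElem (l := E.query k) (i := p.length) (by omega)
      set y := (E.query k)[p.length]'(by omega)
      have hyw : y < 2 ^ E.w := hqw y (List.getElem_mem _)
      have hlt47 : σ.reg 47 < σ.reg 48 := by omega
      have hpos : 0 < (node p.length c own lt eq gt).items.length := List.length_pos_iff.2 hne
      have hh0 : 1 ≤ h := by
        rcases Nat.eq_zero_or_pos h with rfl | h0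
        · rw [pow_zero] at hh; omega
        · exact h0
      obtain ⟨h, rfl⟩ : ∃ h', h = h' + 1 := ⟨h - 1, by omega⟩
      rw [pow_succ] at hh
      have hitems : (node p.length c own lt eq gt).items.length =
          own.length + (lt.items.length + (eq.items.length + gt.items.length)) := by
        simp [items]
      have hown' : ∀ it ∈ own, ¬ E.query k <+: it.str := fun it hit hpre => by
        have := hpre.length_le; rw [hown it hit] at this; omega
      have hlt' : ¬ y < c → ∀ it ∈ lt.items, ¬ E.query k <+: it.str := fun hc it hit => by
        obtain ⟨x, hx, hxc⟩ := hlt it hit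
        exact not_prefix_of_getElem?_ne hyE (by rw [hx]; simp; omega)
      have heq' : y ≠ c → ∀ it ∈ eq.items, ¬ E.query k <+: it.str := fun hc it hit =>
        not_prefix_of_getElem?_ne hyE (by rw [heq it hit]; simpa using hc.symm)
      have hgt' : ¬ c < y → ∀ it ∈ gt.items, ¬ E.query k <+: it.str := fun hc it hit => by
        obtain ⟨x, hx, hxc⟩ := hgt it hit
        exact not_prefix_of_getElem?_ne hyE (by rw [hx]; simp; omega)
      rcases lt_trichotomy y c with hc | hc | hc
      · obtain ⟨t, σ₁, he, ht, e46, e47, hk, ho⟩ := descendCmd_spec hS hrec h46 h47 h53 hyE hyw rfl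
          (by rw [if_pos hc]; exact hent _ _ hM₁)
        rw [if_pos hc] at e46 e47
        obtain ⟨t', σ₂, pre, mid, post, hR, ht', hF, hend, hk', ho'⟩ := ih₁ p.length _ _ h σ₁ hv₁
          hs₁ (by omega) e46 e47 (by rw [hk 48 (by simp), h48]) (by rw [hk 53 (by simp), h53])
        refine ⟨_, σ₂, _, mid, _, .step hlt47 he hR, by omega,
          hF.extend own (eq.items ++ gt.items) hown' ?_, hend,
          fun r hr => (hk' r hr).trans (hk r hr), ho'.trans ho⟩
        intro it hit
        rcases List.mem_append.1 hit with h | h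
        exacts [heq' hc.ne it h, hgt' (by omega) it h]
      · obtain ⟨t, σ₁, he, ht, e46, e47, hk, ho⟩ := descendCmd_spec hS hrec h46 h47 h53 hyE hyw rfl
          (by rw [if_neg (by omega), if_neg (by omega)]; exact hent _ _ hM₂)
        rw [if_neg (by omega), if_neg (by omega)] at e46 e47
        obtain ⟨t', σ₂, pre, mid, post, hR, ht', hF, hend, hk', ho'⟩ := ih₂ (p.length + 1) _ _
          (h + 1) σ₁ hv₂ hs₂ (by rw [pow_succ]; omega) e46 e47 (by rw [hk 48 (by simp), h48])
          (by rw [hk 53 (by simp), h53])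
        rw [Nat.add_assoc, ← List.length_append] at hF
        have := hF.extend (own ++ lt.items) gt.items ?_ (hgt' (by omega))
        · rw [List.append_assoc] at this
          exact ⟨_, σ₂, _, mid, _, .step hlt47 he hR, by omega, this, hend,
            fun r hr => (hk' r hr).trans (hk r hr), ho'.trans ho⟩
        · intro it hit
          rcases List.mem_append.1 hit with h | h
          exacts [hown' it h, hlt' (by omega) it h]
      · obtain ⟨t, σ₁, he, ht, e46, e47, hk, ho⟩ := descendCmd_spec hS hrec h46 h47 h53 hyE hyw rfl
          (by rw [if_neg (by omega), if_pos hc]; exact hent _ _ hM₃)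
        rw [if_neg (by omega), if_pos hc] at e46 e47
        obtain ⟨t', σ₂, pre, mid, post, hR, ht', hF, hend, hk', ho'⟩ := ih₃ p.length _ _ h σ₁ hv₃
          hs₃ (by omega) e46 e47 (by rw [hk 48 (by simp), h48]) (by rw [hk 53 (by simp), h53])
        rw [Nat.add_assoc, Nat.add_assoc, ← List.length_append, ← List.length_append] at hF
        have := hF.extend (own ++ (lt.items ++ eq.items)) [] ?_ (by simp)
        · simp only [List.append_assoc, List.append_nil] at this
          exact ⟨_, σ₂, _, mid, _, .step hlt47 he hR, by omega, this, hend,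
            fun r hr => (hk' r hr).trans (hk r hr), ho'.trans ho⟩
        · intro it hit
          rcases List.mem_append.1 hit with h | h
          · exact hown' it h
          · rcases List.mem_append.1 h with h | h
            exacts [hlt' (by omega) it h, heq' hc.ne' it h]

/-- Compare the query string with the text at address `R[50]`; if they differ, then
`R[56] := R[55]`. -/
def verifyCmd (k : Bool) : Cmd :=
  .loop 54 48 (.block [
    .letter k 51 54, .op .add 52 50 54, .load 52 52,
    .ite 51 52 (.op .or 56 55 55) (.ite 52 51 (.op .or 56 55 55) .skip),
    .op .add 54 54 53])

/-- A mismatch moves the right end of the interval to its left end and so empties it. The loop has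
no early exit; the invariant records whether the part read so far agrees. -/
theorem verifyCmd_spec {E : Env} {m : ℕ → ℕ} (hS : Sound E m) {k : Bool} {σ : State}
    (hqw : FitsWord E.w (E.query k)) {p a b : ℕ} {s : List ℕ} (hst : Stored m E.M p s)
    (hlen : (E.query k).length ≤ s.length) (ha : a < 2 ^ E.w)
    (h48 : σ.reg 48 = (E.query k).length) (h50 : σ.reg 50 = p) (h53 : σ.reg 53 = 1)
    (h54 : σ.reg 54 = 0) (h55 : σ.reg 55 = a) (h56 : σ.reg 56 = b) :
    Ev E m (verifyCmd k) σ fun t σ' => t ≤ 10 * (E.query k).length + 2 ∧ σ'.reg 55 = a ∧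
      σ'.reg 56 = (if E.query k <+: s then b else a) ∧
      (∀ r, r < 46 → σ'.reg r = σ.reg r) ∧ σ'.out = σ.out := by
  have hw := hS.addr
  have hl := hS.large
  have hM := hst.1
  refine Ev.loop (fun n τ => ∃ i, τ.reg 54 = i ∧ i ≤ (E.query k).length ∧
    (E.query k).length - i ≤ n ∧ τ.reg 48 = (E.query k).length ∧ τ.reg 50 = p ∧ τ.reg 53 = 1 ∧
    τ.reg 55 = a ∧ τ.reg 56 = (if (E.query k).take i <+: s then b else a) ∧
    (∀ r, r < 46 → τ.reg r = σ.reg r) ∧ τ.out = σ.out) 8 (E.query k).length ?_ ?_ ?_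
  · exact ⟨0, h54, Nat.zero_le _, by omega, h48, h50, h53, h55, by simpa using h56,
      fun _ _ => rfl, rfl⟩
  · rintro n τ ⟨i, e54, hi, hn, e48, e50, e53, e55, e56, hk, ho⟩ hlt
    rw [e54, e48] at hlt
    refine ⟨by omega, ?_⟩
    have hm := hst.2 i (by omega)
    have hsw := hS.word (p + i) (by omega)
    rw [hm] at hsw
    have htake : (E.query k).take (i + 1) <+: s ↔ (E.query k).take i <+: s ∧
        (E.query k)[i] = s[i]'(by omega) := by
      rw [List.take_add_one, List.getElem?_eq_getElem hlt, Option.toList_some]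
      constructor
      · intro h
        refine ⟨(List.prefix_append _ _).trans h, ?_⟩
        obtain ⟨t, ht⟩ := h
        have h1 := congrArg (fun l => l[i]?) ht
        simp only [List.append_assoc] at h1
        rw [List.getElem?_append_right (by simp), List.getElem?_eq_getElem (by omega : i < s.length)]
          at h1
        simpa [Nat.min_eq_left hlt.le] using h1
      · rintro ⟨h, he⟩
        refine Trie.prefix_concat h ?_
        rw [List.length_take, Nat.min_eq_left hlt.le, List.getElem?_eq_getElem (by omega), he]
    refine Ev.cons (Ev.letter (E.query k)[i] (by rw [e54]; exact List.getElem?_eq_getElem hlt)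
      (hqw _ (List.getElem_mem _)) ?_)
    refine Ev.cons (Ev.op (p + i) (by simp [BinOp.eval, e50, e54]) (by omega) ?_)
    refine Ev.cons (Ev.load (s[i]'(by omega)) (by simp; omega) (by simpa using hm) hsw ?_)
    have fin : ∀ (t : ℕ), t ≤ 4 → ∀ τ' : State, τ'.reg 54 = i → τ'.reg 48 = (E.query k).length →
        τ'.reg 50 = p → τ'.reg 53 = 1 → τ'.reg 55 = a →
        τ'.reg 56 = (if (E.query k).take (i + 1) <+: s then b else a) →
        (∀ r, r < 46 → τ'.reg r = τ.reg r) → τ'.out = τ.out →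
        Ev E m (.block [.op .add 54 54 53]) τ' fun t' σ' => 1 + (1 + (1 + (t + t'))) ≤ 8 ∧
          ∃ i, σ'.reg 54 = i ∧ i ≤ (E.query k).length ∧
          (E.query k).length - i ≤ n - 1 ∧ σ'.reg 48 = (E.query k).length ∧ σ'.reg 50 = p ∧
          σ'.reg 53 = 1 ∧ σ'.reg 55 = a ∧
          σ'.reg 56 = (if (E.query k).take i <+: s then b else a) ∧
          (∀ r, r < 46 → σ'.reg r = σ.reg r) ∧ σ'.out = σ.out := by
      intro t ht τ' f54 f48 f50 f53 f55 f56 fk fo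
      refine Ev.cons (Ev.op (i + 1) (by simp [BinOp.eval, f54, f53]) (by omega) (Ev.nil ?_))
      refine ⟨by omega, i + 1, by simp, by omega, by omega, by simp [f48], by simp [f50],
        by simp [f53], by simp [f55], by simp [f56], fun r hr => ?_, by simp [fo, ho]⟩
      rw [State.set_reg, if_neg (by omega), fk r hr, hk r hr]
    refine Ev.cons (Ev.ite (fun hc => ?_) (fun hc => ?_))
    · simp at hc
      refine Ev.op a (by simp [BinOp.eval, e55]) ha (fin _ (by omega) _ (by simp [e54])
        (by simp [e48]) (by simp [e50]) (by simp [e53]) (by simp [e55]) ?_ ?_ (by simp))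
      · rw [if_neg fun h => hc.ne (htake.1 h).2]; simp
      · intro r hr
        simp only [State.set_reg]
        rw [if_neg, if_neg, if_neg, if_neg] <;> omega
    · simp at hc
      refine Ev.ite (fun hc2 => ?_) (fun hc2 => ?_)
      · simp at hc2
        refine Ev.op a (by simp [BinOp.eval, e55]) ha (fin _ (by omega) _ (by simp [e54])
          (by simp [e48]) (by simp [e50]) (by simp [e53]) (by simp [e55]) ?_ ?_ (by simp))
        · rw [if_neg fun h => hc2.ne' (htake.1 h).2]; simp
        · intro r hr
          simp only [State.set_reg]
          rw [if_neg, if_neg, if_neg, if_neg] <;> omega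
      · simp at hc2
        have he : (E.query k)[i] = s[i]'(by omega) := le_antisymm hc2 hc
        refine Ev.skip (fin _ (by omega) _ (by simp [e54])
          (by simp [e48]) (by simp [e50]) (by simp [e53]) (by simp [e55]) ?_ ?_ (by simp))
        · simp only [htake, he, and_true]; simp [e56]
        · intro r hr
          simp only [State.set_reg]
          rw [if_neg, if_neg, if_neg] <;> omega
  · rintro n t τ ht ⟨i, e54, hi, hn, e48, e50, e53, e55, e56, hk, ho⟩ hlt
    obtain rfl : i = (E.query k).length := by omega
    rw [List.take_length] at e56
    exact ⟨by omega, e55, e56, hk, ho⟩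

/-- Search a query string in the tree whose address is in the memory cell `root`: the items that
start with the string are those with a number in `[R[55], R[56])`. -/
def searchCmd (k : Bool) (root : ℕ) : Cmd := .block [
  .length k 48, .const 49 root, .load 46 49, .load 47 46, .const 53 1,
  .loop 47 48 (descendCmd k),
  .const 51 6, .op .add 49 46 51, .load 55 49,
  .const 51 7, .op .add 49 46 51, .load 56 49,
  .const 54 0,
  .ite 55 56 (.block [.const 51 5, .op .add 49 46 51, .load 50 49, verifyCmd k]) .skip]

/-- All candidates share a prefix at least as long as the query, so either all of them start with
the query or none does. Comparing one of them decides which, and the answer is the whole interval or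
an empty one. -/
theorem searchCmd_spec {E : Env} {m : ℕ → ℕ} (hS : Sound E m) {k : Bool}
    (hqw : FitsWord E.w (E.query k)) (hql : (E.query k).length < 2 ^ E.w) {z K s root h : ℕ}
    (hz : Stored m E.M z (sentinel E.w)) {T : Trie} (hV : T.Valid K 0)
    (hst : Stored m E.M s (T.layout z s 0)) (hh : T.items.length < 2 ^ h)
    (hit : ∀ it ∈ T.items, Stored m E.M it.addr it.str) (hroot : root < E.M)
    (hmroot : m root = T.entry z s) (σ : State) :
    Ev E m (searchCmd k root) σ fun t σ' => t ≤ 23 * (E.query k).length + 13 * h + 30 ∧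
      (∃ a b, σ'.reg 55 = a ∧ σ'.reg 56 = b ∧ a ≤ b ∧ b < 2 ^ E.w ∧
        ∀ i, Occurs (T.items.map Item.color) a b i ↔
          ∃ it ∈ T.items, it.color = i ∧ E.query k <+: it.str) ∧
      (∀ r, r < 46 → σ'.reg r = σ.reg r) ∧ σ'.out = σ.out := by
  have hw := hS.addr
  have hl := hS.large
  have hentM : T.entry z s < E.M := by
    have h1 := hz.1
    have h2 := hst.1
    rw [Trie.length_layout] at h2
    simp only [sentinel, List.length_cons, List.length_nil] at h1
    cases T with
    | nil => rw [Trie.entry]; omega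
    | node => rw [Trie.nodes] at h2; rw [Trie.entry]; omega
  refine Ev.cons (Ev.length hql ?_)
  refine Ev.cons (Ev.const (by omega) ?_)
  refine Ev.cons (Ev.load (T.entry z s) (by simpa using hroot) (by simpa using hmroot)
    (by omega) ?_)
  refine Ev.cons (Ev.load (m (T.entry z s)) (by simpa using hentM) (by simp)
    (hS.word _ hentM) ?_)
  refine Ev.cons (Ev.const (by omega) (Ev.cons ?_))
  obtain ⟨t, σ₁, pre, mid, post, hR, ht, hF, hend, hk, ho⟩ := Trie.descend hS hqw hql hz T 0 s 0 h
    (((((σ.set 48 (E.query k).length).set 49 root).set 46 (T.entry z s)).set 47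
      (m (T.entry z s))).set 53 1) hV hst hh (by simp) (by simp) (by simp) (by simp)
  refine ⟨_, σ₁, hR.exec hend, ?_⟩
  have hk' : ∀ r, r < 46 → σ₁.reg r = σ.reg r := by
    intro r hr
    rw [hk r (by omega)]
    simp only [State.set_reg]
    rw [if_neg, if_neg, if_neg, if_neg, if_neg] <;> omega
  have e48 : σ₁.reg 48 = (E.query k).length := by rw [hk 48 (by simp)]; simp
  have e53 : σ₁.reg 53 = 1 := by rw [hk 53 (by simp)]; simp
  have ho' : σ₁.out = σ.out := ho
  rw [Nat.sub_zero] at ht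
  clear ho hk
  obtain ⟨hsplit, hpre, hpost, htarget⟩ := hF
  have hcol : ∀ a b : ℕ, a = pre.length → b = a + mid.length →
      (∀ it ∈ mid, E.query k <+: it.str) →
      ∀ i, Occurs (T.items.map Item.color) a b i ↔
          ∃ it ∈ T.items, it.color = i ∧ E.query k <+: it.str := by
    rintro a b rfl rfl hmid i
    rw [hsplit]
    constructor
    · rintro ⟨q, hq, ha, hb⟩
      obtain ⟨hq, hc⟩ := mem_pos.1 hq
      rw [List.mem_singleton] at hc
      have hlt : q < (pre ++ (mid ++ post)).length := by simpa using hq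
      rw [List.getD_eq_getElem _ _ hq, List.getElem_map] at hc
      refine ⟨(pre ++ (mid ++ post))[q], List.getElem_mem _, hc, hmid _ ?_⟩
      rw [List.getElem_append_right (by omega), List.getElem_append_left (by omega)]
      exact List.getElem_mem _
    · rintro ⟨it, hit, rfl, hq⟩
      rcases List.mem_append.1 hit with h | h
      · exact absurd hq (hpre it h)
      rcases List.mem_append.1 h with h | h
      · obtain ⟨j, hj, rfl⟩ := List.getElem_of_mem h
        refine ⟨pre.length + j, mem_pos.2 ⟨by simp; omega, ?_⟩, by omega, by omega⟩
        rw [List.getD_eq_getElem _ _ (by simp; omega), List.getElem_map,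
          List.getElem_append_right (by omega), List.getElem_append_left (by omega)]
        simp
      · exact absurd hq (hpost it h)
  have hempty : ∀ a : ℕ, (∀ it ∈ mid, ¬ E.query k <+: it.str) →
      ∀ i, Occurs (T.items.map Item.color) a a i ↔
          ∃ it ∈ T.items, it.color = i ∧ E.query k <+: it.str := by
    intro a hmid i
    constructor
    · rintro ⟨q, -, h1, h2⟩; omega
    · rintro ⟨it, hit, -, hq⟩
      rw [hsplit] at hit
      rcases List.mem_append.1 hit with h | h
      · exact absurd hq (hpre it h)
      rcases List.mem_append.1 h with h | h
      exacts [absurd hq (hmid it h), absurd hq (hpost it h)]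
  have hkeep : ∀ (τ : State), (∃ x1 x2 x3 x4 x5 x6 x7 : ℕ,
      τ = ((((((σ₁.set 51 x1).set 49 x2).set 55 x3).set 51 x4).set 49 x5).set 56 x6).set 54 x7) →
      (∀ r, r < 46 → τ.reg r = σ.reg r) ∧ τ.out = σ.out := by
    rintro τ ⟨x1, x2, x3, x4, x5, x6, x7, rfl⟩
    refine ⟨fun r hr => ?_, ho'⟩
    simp only [State.set_reg]
    rw [if_neg, if_neg, if_neg, if_neg, if_neg, if_neg, if_neg, hk' r hr] <;> omega
  rcases htarget with ⟨hmid, hv⟩ | ⟨it₀, l, hmid, ⟨ℓ, c, p₁, p₂, p₃, hrec⟩, p, hp, hpp⟩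
  · rw [sentinel] at hz
    simp only [Stored.cons_iff, Nat.add_assoc, Nat.reduceAdd] at hz
    obtain ⟨-, -, -, -, -, -, ⟨m6, h6⟩, ⟨m7, h7⟩, -⟩ := hz
    refine Ev.cons (Ev.const (by omega) ?_)
    refine Ev.cons (Ev.op (z + 6) (by simp [BinOp.eval, hv]) (by omega) ?_)
    refine Ev.cons (Ev.load 0 (by simpa using m6) (by simpa using h6) (by omega) ?_)
    refine Ev.cons (Ev.const (by omega) ?_)
    refine Ev.cons (Ev.op (z + 7) (by simp [BinOp.eval, hv]) (by omega) ?_)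
    refine Ev.cons (Ev.load 0 (by simpa using m7) (by simpa using h7) (by omega) ?_)
    refine Ev.cons (Ev.const (by omega) (Ev.cons (Ev.ite (fun hc => ?_) (fun _ => ?_))))
    · simp at hc
    · obtain ⟨hk2, ho2⟩ := hkeep _ ⟨6, z + 6, 0, 7, z + 7, 0, 0, rfl⟩
      refine Ev.skip (Ev.nil ⟨by omega, ⟨0, 0, by simp, by simp, le_rfl, by omega, ?_⟩, hk2, ho2⟩)
      exact hempty 0 (by simp [hmid])
  · have hit₀ : it₀ ∈ mid := by rw [hmid]; exact List.mem_cons_self ..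
    have hst₀ := hit it₀ (by rw [hsplit]; simp [hit₀])
    have hlen₀ : (E.query k).length ≤ it₀.str.length := hp.trans (hpp it₀ hit₀).length_le
    simp only [Stored.cons_iff, Nat.add_assoc, Nat.reduceAdd] at hrec
    obtain ⟨-, -, -, -, -, ⟨m5, h5⟩, ⟨m6, h6⟩, ⟨m7, h7⟩, -⟩ := hrec
    have w5 := h5 ▸ hS.word _ m5
    have w6 := h6 ▸ hS.word _ m6
    have w7 := h7 ▸ hS.word _ m7
    have hmpos : 0 < mid.length := List.length_pos_of_mem hit₀
    refine Ev.cons (Ev.const (by omega) ?_)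
    refine Ev.cons (Ev.op (σ₁.reg 46 + 6) (by simp [BinOp.eval]) (by omega) ?_)
    refine Ev.cons (Ev.load _ (by simpa using m6) (by simpa using h6) w6 ?_)
    refine Ev.cons (Ev.const (by omega) ?_)
    refine Ev.cons (Ev.op (σ₁.reg 46 + 7) (by simp [BinOp.eval]) (by omega) ?_)
    refine Ev.cons (Ev.load _ (by simpa using m7) (by simpa using h7) w7 ?_)
    obtain ⟨hk2, ho2⟩ := hkeep _ ⟨6, σ₁.reg 46 + 6, 0 + pre.length, 7, σ₁.reg 46 + 7,
      0 + (pre.length + mid.length), 0, rfl⟩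
    refine Ev.cons (Ev.const (by omega) (Ev.cons (Ev.ite (fun _ => ?_) (fun hc => ?_))))
    swap
    · exact absurd (by simp [hmid]) hc
    refine Ev.cons (Ev.const (by omega) ?_)
    refine Ev.cons (Ev.op (σ₁.reg 46 + 5) (by simp [BinOp.eval]) (by omega) ?_)
    refine Ev.cons (Ev.load it₀.addr (by simpa using m5) (by simpa using h5) w5 ?_)
    refine Ev.cons ((verifyCmd_spec hS hqw hst₀ hlen₀ w6 (by simp [e48]) (by simp) (by simp [e53])
      (by simp) (by simp) (by simp; rfl)).mono ?_)
    rintro t2 σ₂ ⟨ht2, e55, e56, hk3, ho3⟩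
    refine Ev.nil (Ev.nil ⟨by linarith, ?_, fun r hr => ?_, by rw [ho3]; exact ho2⟩)
    · by_cases hq : E.query k <+: it₀.str
      · rw [if_pos hq] at e56
        refine ⟨_, _, e55, e56, by omega, by omega, hcol _ _ (by omega) (by omega) ?_⟩
        intro it hit
        exact (List.prefix_of_prefix_length_le hq (hpp it₀ hit₀) hp).trans (hpp it hit)
      · rw [if_neg hq] at e56
        refine ⟨_, _, e55, e56, le_rfl, w6, hempty _ fun it hit h => hq ?_⟩
        exact (List.prefix_of_prefix_length_le h (hpp it hit) hp).trans (hpp it₀ hit₀)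
    · rw [hk3 r hr]
      simp only [State.set_reg] at hk2 ⊢
      rw [if_neg, if_neg, if_neg, hk2 r hr] <;> omega

end SubstringIndexing

namespace SubstringIndexing

open WordRAM

/-! ### The query program -/

/-- The query program: search both strings, and walk through the colour tree. -/
def queryCmd : Cmd := .block [
  searchCmd false 0, .op .or 30 55 55, .op .or 31 56 56,
  searchCmd true 1, .op .or 32 55 55, .op .or 33 56 56,
  .const 28 2, .load 34 28, .const 45 0, .loop 45 34 visitCmd]

/-- The predicate `f` is `common` for the two intervals found by the searches. Translated back to
items, it no longer mentions them. -/
theorem queryCmd_spec {E : Env} {m : ℕ → ℕ} {T₁ T₂ : Trie} {C : List ℕ} {o₁ o₂ : ℕ → ℕ}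
    {z K L s₁ s₂ s : ℕ} {T : ColorTree}
    (H : Indexed E m (T₁.items.map Item.color) (T₂.items.map Item.color) o₁ o₂ C L)
    (hq₁ : FitsWord E.w E.query₁) (hq₂ : FitsWord E.w E.query₂)
    (hl₁ : E.query₁.length < 2 ^ E.w) (hl₂ : E.query₂.length < 2 ^ E.w)
    (hz : Stored m E.M z (sentinel E.w)) (hV₁ : T₁.Valid K 0) (hV₂ : T₂.Valid K 0)
    (hs₁ : Stored m E.M s₁ (T₁.layout z s₁ 0)) (hs₂ : Stored m E.M s₂ (T₂.layout z s₂ 0))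
    (hit₁ : ∀ it ∈ T₁.items, Stored m E.M it.addr it.str)
    (hit₂ : ∀ it ∈ T₂.items, Stored m E.M it.addr it.str) (hTC : T.colors ⊆ C) (hs : 0 < s)
    (hst : Stored m E.M s
      (T.layout (T₁.items.map Item.color) (T₂.items.map Item.color) o₁ o₂ s 0))
    (hroot : Stored m E.M 0 [T₁.entry z s₁, T₂.entry z s₂, T.entry s 0]) :
    ∃ t σ', Exec E m queryCmd ⟨fun _ => 0, []⟩ t σ' ∧ ∃ f : ℕ → Bool,
      (∀ i, f i = true ↔ (∃ it ∈ T₁.items, it.color = i ∧ E.query₁ <+: it.str) ∧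
        ∃ it ∈ T₂.items, it.color = i ∧ E.query₂ <+: it.str) ∧
      σ'.out = (T.colors.filter f).reverse ∧
      t ≤ 23 * (E.query₁.length + E.query₂.length) + 26 * L + 100 +
        T.cost (T₁.items.map Item.color) (T₂.items.map Item.color) f L := by
  have hS := H.sound
  have hw := hS.addr
  have hl := hS.large
  have hA₁ := H.lt₁
  have hA₂ := H.lt₂
  rw [List.length_map] at hA₁ hA₂
  simp only [Stored.cons_iff, Nat.zero_add, Nat.reduceAdd] at hroot
  obtain ⟨⟨r0, hr0⟩, ⟨r1, hr1⟩, ⟨r2, hr2⟩, -⟩ := hroot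
  have hw2 := hr2 ▸ hS.word _ r2
  suffices h : Ev E m queryCmd ⟨fun _ => 0, []⟩ fun t σ' => ∃ f : ℕ → Bool,
      (∀ i, f i = true ↔ (∃ it ∈ T₁.items, it.color = i ∧ E.query₁ <+: it.str) ∧
        ∃ it ∈ T₂.items, it.color = i ∧ E.query₂ <+: it.str) ∧
      σ'.out = (T.colors.filter f).reverse ∧
      t ≤ 23 * (E.query₁.length + E.query₂.length) + 26 * L + 100 +
        T.cost (T₁.items.map Item.color) (T₂.items.map Item.color) f L by
    obtain ⟨t, σ', h, h'⟩ := h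
    exact ⟨t, σ', h, h'⟩
  refine Ev.cons ((searchCmd_spec hS (k := false) hq₁ hl₁ hz hV₁ hs₁ hA₁ hit₁ r0 hr0 _).mono ?_)
  rintro t1 σ1 ⟨ht1, ⟨a₁, b₁, e55, e56, hab₁, hb₁, hocc₁⟩, -, ho1⟩
  refine Ev.cons (Ev.op a₁ (by simp [BinOp.eval, e55]) (by omega) ?_)
  refine Ev.cons (Ev.op b₁ (by simp [BinOp.eval, e56]) (by omega) ?_)
  refine Ev.cons ((searchCmd_spec hS (k := true) hq₂ hl₂ hz hV₂ hs₂ hA₂ hit₂ r1 hr1 _).mono ?_)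
  rintro t2 σ2 ⟨ht2, ⟨a₂, b₂, f55, f56, hab₂, hb₂, hocc₂⟩, hk2, ho2⟩
  have e30 : σ2.reg 30 = a₁ := by rw [hk2 30 (by norm_num)]; simp
  have e31 : σ2.reg 31 = b₁ := by rw [hk2 31 (by norm_num)]; simp
  have hout : σ2.out = [] := by rw [ho2]; exact ho1
  refine Ev.cons (Ev.op a₂ (by simp [BinOp.eval, f55]) (by omega) ?_)
  refine Ev.cons (Ev.op b₂ (by simp [BinOp.eval, f56]) (by omega) ?_)
  refine Ev.cons (Ev.const (by omega) ?_)
  refine Ev.cons (Ev.load (T.entry s 0) (by simpa using r2) (by simpa using hr2) hw2 ?_)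
  refine Ev.cons (Ev.const (by omega) (Ev.cons ?_))
  obtain ⟨t3, σ3, hR, ht3, e34, ho3, hk3⟩ := ColorTree.walk H hab₁ hab₂ hb₁ hb₂ T s 0
    (((((σ2.set 32 a₂).set 33 b₂).set 28 2).set 34 (T.entry s 0)).set 45 0) hTC hs hst (by simp)
    (by simp [e30]) (by simp [e31]) (by simp) (by simp) (by simp)
  refine ⟨_, σ3, hR.exec (by rw [e34]; exact Nat.not_lt_zero _), Ev.nil ⟨common
    (T₁.items.map Item.color) (T₂.items.map Item.color) a₁ b₁ a₂ b₂, ?_, ?_, ?_⟩⟩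
  · intro i
    rw [common, decide_eq_true_eq, hocc₁ i, hocc₂ i]
    rfl
  · rw [ho3]
    simp [hout]
  · simp only [Env.query] at ht1 ht2
    linarith

/-! ### The items of a database -/

/-- The suffixes of a string at address `s`, with colour `i`. -/
def suffixItems (i : ℕ) : List ℕ → ℕ → List Item
  | [], s => [⟨i, s, []⟩]
  | x :: α, s => ⟨i, s, x :: α⟩ :: suffixItems i α (s + 1)

theorem length_suffixItems (i : ℕ) (α : List ℕ) :
    ∀ s, (suffixItems i α s).length = α.length + 1 := by
  induction α with
  | nil => intro s; rfl
  | cons x α ih => intro s; simp [suffixItems, ih]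

theorem of_mem_suffixItems (i : ℕ) (α : List ℕ) : ∀ s, ∀ it ∈ suffixItems i α s,
    it.color = i ∧ it.str <:+ α ∧ it.addr + it.str.length = s + α.length ∧ s ≤ it.addr := by
  induction α with
  | nil =>
    intro s it hit
    obtain rfl : it = ⟨i, s, []⟩ := by simpa [suffixItems] using hit
    simp
  | cons x α ih =>
    intro s it hit
    rcases List.mem_cons.1 hit with rfl | hit
    · simp
    · obtain ⟨h1, h2, h3, h4⟩ := ih (s + 1) it hit
      exact ⟨h1, h2.trans (List.suffix_cons x α), by rw [List.length_cons]; omega, by omega⟩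

theorem exists_mem_suffixItems (i : ℕ) (α : List ℕ) : ∀ s, ∀ t, t <:+ α →
    ∃ it ∈ suffixItems i α s, it.str = t := by
  induction α with
  | nil =>
    intro s t ht
    exact ⟨⟨i, s, []⟩, by simp [suffixItems], (List.suffix_nil.1 ht).symm⟩
  | cons x α ih =>
    intro s t ht
    rcases List.suffix_cons_iff.1 ht with rfl | ht
    · exact ⟨_, List.mem_cons_self .., rfl⟩
    · obtain ⟨it, hit, h⟩ := ih (s + 1) t ht
      exact ⟨it, List.mem_cons_of_mem _ hit, h⟩

/-- The suffixes of strings that are stored one after the other from address `s` on, with colours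
from `i` on. -/
def stringItems : List (List ℕ) → ℕ → ℕ → List Item
  | [], _, _ => []
  | α :: ls, i, s => suffixItems i α s ++ stringItems ls (i + 1) (s + α.length)

/-- A string contributes one suffix more than its length, because the empty suffix is included. It
guarantees that each colour occurs, and it serves the empty query. -/
theorem length_stringItems (ls : List (List ℕ)) :
    ∀ i s, (stringItems ls i s).length = ls.flatten.length + ls.length := by
  induction ls with
  | nil => intro i s; rfl
  | cons α ls ih =>
    intro i s
    rw [stringItems, List.length_append, length_suffixItems, ih, List.flatten_cons,
      List.length_append, List.length_cons]
    omega

theorem of_mem_stringItems (ls : List (List ℕ)) : ∀ i s, ∀ it ∈ stringItems ls i s,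
    (∃ j α, ls[j]? = some α ∧ it.color = i + j ∧ it.str <:+ α) ∧
      it.addr + it.str.length ≤ s + ls.flatten.length := by
  induction ls with
  | nil => intro i s it hit; simp [stringItems] at hit
  | cons α ls ih =>
    intro i s it hit
    rw [List.flatten_cons, List.length_append]
    rcases List.mem_append.1 hit with hit | hit
    · obtain ⟨h1, h2, h3, h4⟩ := of_mem_suffixItems i α s it hit
      exact ⟨⟨0, α, rfl, h1, h2⟩, by omega⟩
    · obtain ⟨⟨j, β, h1, h2, h3⟩, h4⟩ := ih _ _ it hit
      exact ⟨⟨j + 1, β, h1, by omega, h3⟩, by omega⟩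

theorem exists_mem_stringItems (ls : List (List ℕ)) : ∀ i s j α t, ls[j]? = some α → t <:+ α →
    ∃ it ∈ stringItems ls i s, it.color = i + j ∧ it.str = t := by
  induction ls with
  | nil => intro i s j α t h; simp at h
  | cons β ls ih =>
    intro i s j α t h ht
    cases j with
    | zero =>
      obtain rfl : β = α := by simpa using h
      obtain ⟨it, hit, hst⟩ := exists_mem_suffixItems i β s t ht
      exact ⟨it, List.mem_append_left _ hit, (of_mem_suffixItems i β s it hit).1, hst⟩
    | succ j =>
      obtain ⟨it, hit, hc, hst⟩ := ih (i + 1) (s + β.length) j α t (by simpa using h) ht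
      exact ⟨it, List.mem_append_right _ hit, by omega, hst⟩

theorem stored_suffixItems {m : ℕ → ℕ} {M : ℕ} (i : ℕ) (α : List ℕ) : ∀ s, Stored m M s α →
    ∀ it ∈ suffixItems i α s, Stored m M it.addr it.str := by
  induction α with
  | nil =>
    intro s h it hit
    obtain rfl : it = ⟨i, s, []⟩ := by simpa [suffixItems] using hit
    exact h
  | cons x α ih =>
    intro s h it hit
    rcases List.mem_cons.1 hit with rfl | hit
    · exact h
    · exact ih _ (Stored.cons_iff.1 h).2 it hit

theorem stored_stringItems {m : ℕ → ℕ} {M : ℕ} (ls : List (List ℕ)) : ∀ i s,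
    Stored m M s ls.flatten → ∀ it ∈ stringItems ls i s, Stored m M it.addr it.str := by
  induction ls with
  | nil => intro i s _ it hit; simp [stringItems] at hit
  | cons α ls ih =>
    intro i s h it hit
    obtain ⟨h1, h2⟩ := Stored.append_iff.1 (List.flatten_cons ▸ h)
    rcases List.mem_append.1 hit with hit | hit
    · exact stored_suffixItems i α s h1 it hit
    · exact ih _ _ h2 it hit

/-- A substring is a prefix of a suffix, and the colour of an item is the index of its string. -/
theorem exists_stringItems_iff (ls : List (List ℕ)) (s i : ℕ) (q : List ℕ) :
    (∃ it ∈ stringItems ls 0 s, it.color = i ∧ q <+: it.str) ↔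
      ∃ α, ls[i]? = some α ∧ q <:+: α := by
  constructor
  · rintro ⟨it, hit, rfl, hq⟩
    obtain ⟨⟨j, α, h1, h2, h3⟩, -⟩ := of_mem_stringItems ls 0 s it hit
    rw [Nat.zero_add] at h2
    exact ⟨α, h2 ▸ h1, hq.isInfix.trans h3.isInfix⟩
  · rintro ⟨α, h, u, v, rfl⟩
    obtain ⟨it, hit, hc, hst⟩ := exists_mem_stringItems ls 0 s i _ (q ++ v) h
      ⟨u, (List.append_assoc ..).symm⟩
    exact ⟨it, hit, by omega, hst ▸ List.prefix_append q v⟩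

/-! ### The lists of positions of all colours -/

/-- Distinct colours have disjoint sets of positions. -/
theorem sum_length_pos_le (A : List ℕ) {Γ : List ℕ} (h : Γ.Nodup) :
    (Γ.map fun x => (pos A [x]).length).sum ≤ (pos A Γ).length := by
  induction Γ with
  | nil => simp
  | cons x Γ ih =>
    rw [List.nodup_cons] at h
    rw [List.map_cons, List.sum_cons]
    refine (Nat.add_le_add_left (ih h.2) _).trans ?_
    have key : ∀ (f g : ℕ → Bool) (l : List ℕ), (∀ p, f p = true → g p = false) →
        (l.filter f).length + (l.filter g).length ≤ (l.filter fun p => f p || g p).length := by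
      intro f g l hfg
      induction l with
      | nil => simp
      | cons y l ih =>
        cases hf : f y
        · cases hg : g y <;> simp [hf, hg] <;> omega
        · have := hfg y hf
          simp [hf, this]; omega
    have := key (fun p => decide (A.getD p 0 ∈ [x])) (fun p => decide (A.getD p 0 ∈ Γ))
      (List.range A.length) (by
        intro p hp
        simp only [List.mem_singleton, decide_eq_true_eq] at hp
        simp only [decide_eq_false_iff_not, hp, h.1, not_false_eq_true])
    simp only [← Bool.decide_or, List.mem_singleton] at this
    simpa only [pos, List.mem_cons, List.not_mem_nil, or_false] using this

theorem sum_weight_le (A₁ A₂ : List ℕ) {Γ : List ℕ} (h : Γ.Nodup) :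
    (Γ.map (weight A₁ A₂)).sum ≤ A₁.length + A₂.length := by
  have : (Γ.map (weight A₁ A₂)).sum = (Γ.map fun x => (pos A₁ [x]).length).sum +
      (Γ.map fun x => (pos A₂ [x]).length).sum := by
    clear h
    induction Γ with
    | nil => rfl
    | cons x Γ ih => simp only [List.map_cons, List.sum_cons, ih, weight]; omega
  rw [this]
  exact Nat.add_le_add ((sum_length_pos_le A₁ h).trans (length_pos_le _ _))
    ((sum_length_pos_le A₂ h).trans (length_pos_le _ _))

/-- The lists of positions of the colours below `c`, each preceded by its length. -/
def occLists (A : List ℕ) (c : ℕ) : List (List ℕ) :=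
  (List.range c).map fun x => (pos A [x]).length :: pos A [x]

/-- The address of the list of positions of the colour `x`. -/
def occAddr (A : List ℕ) (c s x : ℕ) : ℕ := s + ((occLists A c).take x).flatten.length

theorem stored_flatten {m : ℕ → ℕ} {M s i : ℕ} {ls : List (List ℕ)} {l : List ℕ}
    (h : Stored m M s ls.flatten) (hi : ls[i]? = some l) :
    Stored m M (s + (ls.take i).flatten.length) l := by
  obtain ⟨hlt, rfl⟩ := List.getElem?_eq_some_iff.1 hi
  have hsplit : ls = ls.take i ++ ls[i] :: ls.drop (i + 1) := by
    rw [List.cons_getElem_drop_succ, List.take_append_drop]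
  rw [hsplit, List.flatten_append, List.flatten_cons] at h
  exact (Stored.append_iff.1 (Stored.append_iff.1 h).2).1

theorem sortedAt_occAddr {m : ℕ → ℕ} {M : ℕ} {A : List ℕ} {c s x : ℕ}
    (h : Stored m M s (occLists A c).flatten) (hx : x < c) :
    SortedAt m M (occAddr A c s x) (pos A [x]) := by
  refine ⟨stored_flatten h ?_, pairwise_pos A [x]⟩
  simp [occLists, hx]

theorem length_flatten_occLists_le (A : List ℕ) (c : ℕ) :
    (occLists A c).flatten.length ≤ A.length + c := by
  have h1 : ((occLists A c).map List.length).sum =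
      ((List.range c).map fun x => (pos A [x]).length).sum + c := by
    rw [occLists, List.map_map]
    induction c with
    | zero => rfl
    | succ c ih =>
      simp only [List.range_succ, List.map_append, List.sum_append, ih]
      simp; omega
  rw [List.length_flatten, h1]
  exact Nat.add_le_add_right
    ((sum_length_pos_le A List.nodup_range).trans (length_pos_le _ _)) _

theorem occAddr_le (A : List ℕ) (c s x : ℕ) :
    occAddr A c s x ≤ s + (occLists A c).flatten.length := by
  refine Nat.add_le_add_left ?_ _
  conv_rhs => rw [← List.take_append_drop x (occLists A c), List.flatten_append,
    List.length_append]
  exact Nat.le_add_right _ _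

theorem forall_mem_flatten_occLists_lt {A : List ℕ} {c K : ℕ} (h : A.length < K) :
    ∀ v ∈ (occLists A c).flatten, v < K := by
  intro v hv
  obtain ⟨l, hl, hv⟩ := List.mem_flatten.1 hv
  obtain ⟨x, -, rfl⟩ := List.mem_map.1 hl
  rcases List.mem_cons.1 hv with rfl | hv
  · exact (length_pos_le _ _).trans_lt h
  · exact (mem_pos.1 hv).1.trans h

end SubstringIndexing

/-! ### Assembling the memory of the index -/

namespace SubstringIndexing

open WordRAM

theorem stored_getD (l : List ℕ) : Stored (fun a => l.getD a 0) l.length 0 l := by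
  refine ⟨by omega, fun i hi => ?_⟩
  rw [Nat.zero_add]
  exact List.getD_eq_getElem _ _ hi

theorem length_fst_add_length_snd (D : Database) :
    (D.map Prod.fst).flatten.length + (D.map Prod.snd).flatten.length = D.size := by
  induction D with
  | nil => rfl
  | cons p D ih =>
    simp only [Database.size, List.map_cons, List.flatten_cons, List.length_append,
      List.sum_cons] at ih ⊢
    omega

theorem one_le_weight {A₁ A₂ : List ℕ} {x : ℕ} (h : x ∈ A₁) : 1 ≤ weight A₁ A₂ x := by
  obtain ⟨i, hi, rfl⟩ := List.getElem_of_mem h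
  have : i ∈ pos A₁ [A₁[i]] := mem_pos.2 ⟨hi, by rw [List.getD_eq_getElem _ _ hi]; simp⟩
  have := List.length_pos_of_mem this
  rw [weight]
  omega

theorem mem_answer_iff (D : Database) (σ₁ σ₂ : List ℕ) (i : ℕ) :
    i ∈ answer D σ₁ σ₂ ↔ i < D.length ∧ (∃ α, (D.map Prod.fst)[i]? = some α ∧ σ₁ <:+: α) ∧
      ∃ α, (D.map Prod.snd)[i]? = some α ∧ σ₂ <:+: α := by
  rw [answer, Finset.mem_filter, Finset.mem_range, List.getElem?_map, List.getElem?_map]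
  refine and_congr_right fun hi => ?_
  rw [List.getElem?_eq_getElem hi]
  simp

/-- The memory of an index: the header, the leaf that stops the search in a trie, the strings, the
two tries, the lists of positions and the records of the colour tree. -/
theorem exists_memory (D : Database) (w L : ℕ) (hL : 0 < L)
    (hlt : D.size + 2 * D.length < 2 ^ L)
    (hw : 2 * (11 + 19 * (D.size + 2 * D.length) + 120 * (L * (D.size + 2 * D.length))) < 2 ^ w)
    (hw' : 2 * (D.size + 2 * D.length) ^ 2 < 2 ^ w)
    (hD : ∀ p ∈ D, FitsWord w p.1 ∧ FitsWord w p.2) :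
    ∃ mem : List ℕ,
      mem.length ≤ 11 + 19 * (D.size + 2 * D.length) + 120 * (L * (D.size + 2 * D.length)) ∧
      (∀ v ∈ mem, v < 2 ^ w) ∧
      ∀ σ₁ σ₂ : List ℕ, FitsWord w σ₁ → FitsWord w σ₂ → σ₁.length < 2 ^ w → σ₂.length < 2 ^ w →
        ∃ (t : ℕ) (c : Config),
          HaltsIn queryCmd.program ⟨w, mem.length, σ₁, σ₂⟩
            (Config.start fun a => mem.getD a 0) t c ∧
          c.out.Nodup ∧ c.out.toFinset = answer D σ₁ σ₂ ∧
          (t : ℝ) ≤ 23 * (σ₁.length + σ₂.length) + 26 * L + 100 +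
            1204 * L * (3 * L * √((D.size + 2 * D.length : ℕ) * (answer D σ₁ σ₂).card) +
              √(D.size + 2 * D.length : ℕ)) ∧
          c.mem = fun a => mem.getD a 0 := by
  have hK : 0 < 2 ^ w := Nat.two_pow_pos w
  have hsz := length_fst_add_length_snd D
  -- The strings start at address `11`, after three header cells and the eight cells of the
  -- sentinel.
  obtain ⟨T₁, hp₁, hV₁, hn₁⟩ := Trie.exists_trie hK _ (stringItems (D.map Prod.fst) 0 11) rfl
    (fun it hit x hx => by
      obtain ⟨⟨j, α, h1, -, h3⟩, -⟩ := of_mem_stringItems _ _ _ it hit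
      obtain ⟨p, hp, rfl⟩ := List.mem_map.1 (List.mem_of_getElem? h1)
      exact (hD p hp).1 x (h3.subset hx)) [] fun it _ => List.nil_prefix
  obtain ⟨T₂, hp₂, hV₂, hn₂⟩ := Trie.exists_trie hK _
    (stringItems (D.map Prod.snd) 0 (11 + (D.map Prod.fst).flatten.length)) rfl
    (fun it hit x hx => by
      obtain ⟨⟨j, α, h1, -, h3⟩, -⟩ := of_mem_stringItems _ _ _ it hit
      obtain ⟨p, hp, rfl⟩ := List.mem_map.1 (List.mem_of_getElem? h1)
      exact (hD p hp).2 x (h3.subset hx)) [] fun it _ => List.nil_prefix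
  have hlen₁ := hp₁.length_eq
  have hlen₂ := hp₂.length_eq
  have ha₁ : ∀ it ∈ T₁.items,
      it.addr + it.str.length ≤ 11 + (D.map Prod.fst).flatten.length := fun it hit =>
    (of_mem_stringItems _ _ _ it (hp₁.subset hit)).2
  have ha₂ : ∀ it ∈ T₂.items, it.addr + it.str.length ≤
      11 + (D.map Prod.fst).flatten.length + (D.map Prod.snd).flatten.length := fun it hit =>
    (of_mem_stringItems _ _ _ it (hp₂.subset hit)).2
  have hex₁ : ∀ i q, (∃ it ∈ T₁.items, it.color = i ∧ q <+: it.str) ↔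
      ∃ α, (D.map Prod.fst)[i]? = some α ∧ q <:+: α := fun i q => by
    rw [← exists_stringItems_iff _ 11]; simp only [hp₁.mem_iff]
  have hex₂ : ∀ i q, (∃ it ∈ T₂.items, it.color = i ∧ q <+: it.str) ↔
      ∃ α, (D.map Prod.snd)[i]? = some α ∧ q <:+: α := fun i q => by
    rw [← exists_stringItems_iff _ (11 + (D.map Prod.fst).flatten.length)]
    simp only [hp₂.mem_iff]
  rw [length_stringItems, List.length_map] at hlen₁ hlen₂ hn₁ hn₂
  obtain ⟨A₁, hA₁⟩ : ∃ A, A = T₁.items.map Item.color := ⟨_, rfl⟩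
  obtain ⟨A₂, hA₂⟩ : ∃ A, A = T₂.items.map Item.color := ⟨_, rfl⟩
  have hAl₁ : A₁.length = T₁.items.length := by rw [hA₁, List.length_map]
  have hAl₂ : A₂.length = T₂.items.length := by rw [hA₂, List.length_map]
  -- The empty suffix of the first component is an occurrence of the colour `x`.
  have hweight : ∀ x < D.length, 1 ≤ weight A₁ A₂ x := fun x hx => by
    refine one_le_weight ?_
    obtain ⟨it, hit, hc, -⟩ := exists_mem_stringItems (D.map Prod.fst) 0 11 x _ []
      (List.getElem?_eq_getElem (by simpa using hx)) List.nil_suffix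
    rw [hA₁]
    exact List.mem_map.2 ⟨it, hp₁.symm.subset hit, by omega⟩
  have hsum := sum_weight_le A₁ A₂ (List.nodup_range (n := D.length))
  obtain ⟨T, hT, hh⟩ := ColorTree.exists_colorTree (weight A₁ A₂) L (List.range D.length)
    (fun x hx => hweight x (List.mem_range.1 hx)) (by omega)
  have hsumT := (hT.map (weight A₁ A₂)).sum_eq
  have hweightT : ∀ x ∈ T.colors, 1 ≤ weight A₁ A₂ x := fun x hx =>
    hweight x (List.mem_range.1 (hT.subset hx))
  have hspace : T.space A₁ A₂ ≤ 120 * (L * (D.size + 2 * D.length)) :=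
    (T.space_le A₁ A₂ hweightT).trans
      (Nat.mul_le_mul_left _ (Nat.mul_le_mul hh (by omega)))
  have hO₁ := length_flatten_occLists_le A₁ D.length
  have hO₂ := length_flatten_occLists_le A₂ D.length
  obtain ⟨s₁, hs₁⟩ : ∃ s, s = 11 + (D.map Prod.fst).flatten.length +
    (D.map Prod.snd).flatten.length := ⟨_, rfl⟩
  obtain ⟨s₂, hs₂⟩ : ∃ s, s = s₁ + 8 * T₁.nodes := ⟨_, rfl⟩
  obtain ⟨u₁, hu₁⟩ : ∃ s, s = s₂ + 8 * T₂.nodes := ⟨_, rfl⟩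
  obtain ⟨u₂, hu₂⟩ : ∃ s, s = u₁ + (occLists A₁ D.length).flatten.length := ⟨_, rfl⟩
  obtain ⟨s, hs⟩ : ∃ s, s = u₂ + (occLists A₂ D.length).flatten.length := ⟨_, rfl⟩
  obtain ⟨mem, hmem⟩ : ∃ mem, mem = [T₁.entry 3 s₁, T₂.entry 3 s₂, T.entry s 0] ++
      (sentinel w ++ ((D.map Prod.fst).flatten ++ ((D.map Prod.snd).flatten ++
      (T₁.layout 3 s₁ 0 ++ (T₂.layout 3 s₂ 0 ++ ((occLists A₁ D.length).flatten ++
      ((occLists A₂ D.length).flatten ++ T.layout A₁ A₂ (occAddr A₁ D.length u₁)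
        (occAddr A₂ D.length u₂) s 0))))))) := ⟨_, rfl⟩
  have hM : mem.length = s + T.space A₁ A₂ := by
    rw [hmem]
    simp only [List.length_append, Trie.length_layout, ColorTree.length_layout, sentinel,
      List.length_cons, List.length_nil]
    omega
  have hst := stored_getD mem
  -- With `W = D.size + 2 * D.length` items in total: at most `2 * W` trie nodes of `8` cells, the
  -- strings with `D.size` cells, and lists of positions with at most `W + 2 * D.length` cells. This
  -- makes at most `19 * W` next to the header and the colour tree.
  have hMle : mem.length ≤
      11 + 19 * (D.size + 2 * D.length) + 120 * (L * (D.size + 2 * D.length)) := by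
    omega
  have hsq : 2 * (A₁.length * A₂.length) < 2 ^ w := by
    refine lt_of_le_of_lt (Nat.mul_le_mul_left 2 ?_) hw'
    rw [sq]
    exact Nat.mul_le_mul (by omega) (by omega)
  have hword : ∀ v ∈ mem, v < 2 ^ w := by
    have hoc : ∀ y ∈ T.colors, y < 2 ^ w ∧ occAddr A₁ D.length u₁ y < 2 ^ w ∧
        occAddr A₂ D.length u₂ y < 2 ^ w := by
      intro y hy
      have h1 := List.mem_range.1 (hT.subset hy)
      have h2 := occAddr_le A₁ D.length u₁ y
      have h3 := occAddr_le A₂ D.length u₂ y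
      omega
    intro v hv
    simp only [hmem, List.mem_append] at hv
    rcases hv with hv | hv | hv | hv | hv | hv | hv | hv | hv
    · simp only [List.mem_cons, List.not_mem_nil, or_false] at hv
      rcases hv with rfl | rfl | rfl
      · exact Trie.entry_lt T₁ (by omega) (by omega)
      · exact Trie.entry_lt T₂ (by omega) (by omega)
      · exact ColorTree.entry_le A₁ A₂ T (by omega) (by omega)
    · simp only [sentinel, List.mem_cons, List.not_mem_nil, or_false] at hv
      omega
    · obtain ⟨α, hα, hv⟩ := List.mem_flatten.1 hv
      obtain ⟨p, hp, rfl⟩ := List.mem_map.1 hα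
      exact (hD p hp).1 v hv
    · obtain ⟨α, hα, hv⟩ := List.mem_flatten.1 hv
      obtain ⟨p, hp, rfl⟩ := List.mem_map.1 hα
      exact (hD p hp).2 v hv
    · refine Trie.forall_mem_layout_lt (by omega) T₁ s₁ 0 _ hV₁ (by omega) (by omega)
        (fun it hit => ?_) v hv
      have := ha₁ it hit
      omega
    · refine Trie.forall_mem_layout_lt (by omega) T₂ s₂ 0 _ hV₂ (by omega) (by omega)
        (fun it hit => ?_) v hv
      have := ha₂ it hit
      omega
    · exact forall_mem_flatten_occLists_lt (by omega) v hv
    · exact forall_mem_flatten_occLists_lt (by omega) v hv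
    · exact ColorTree.forall_mem_layout_lt (by omega) (by omega) (by omega) T s 0 (by omega)
        hK hoc v hv
  refine ⟨mem, hMle, hword, fun σ₁ σ₂ hf₁ hf₂ hl₁ hl₂ => ?_⟩
  nth_rewrite 3 [hmem] at hst
  simp only [Stored.append_iff, Trie.length_layout, sentinel, List.length_cons,
    List.length_nil] at hst
  obtain ⟨t0, t1, t2, t3, t4, t5, t6, t7, t8⟩ := hst
  have e11 : 0 + (0 + 1 + 1 + 1) + (0 + 1 + 1 + 1 + 1 + 1 + 1 + 1 + 1) = 11 := rfl
  rw [e11] at t2 t3 t4 t5 t6 t7 t8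
  rw [← hs₁] at t4 t5 t6 t7 t8
  rw [← hs₂] at t5 t6 t7 t8
  rw [← hu₁] at t6 t7 t8
  rw [← hu₂] at t7 t8
  rw [← hs] at t8
  have H : Indexed ⟨w, mem.length, σ₁, σ₂⟩ (fun a => mem.getD a 0) A₁ A₂
      (occAddr A₁ D.length u₁) (occAddr A₂ D.length u₂) (List.range D.length) L :=
    { sound := ⟨fun a ha => by
          show mem.getD a 0 < 2 ^ w
          rw [List.getD_eq_getElem _ _ ha]
          exact hword _ (List.getElem_mem _), by show 2 * mem.length < 2 ^ w; omega,
          by show 8 ≤ mem.length; omega⟩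
      pos_L := hL
      lt₁ := by omega
      lt₂ := by omega
      count := hsq
      occ₁ := fun x hx => sortedAt_occAddr t6 (List.mem_range.1 hx)
      occ₂ := fun x hx => sortedAt_occAddr t7 (List.mem_range.1 hx) }
  subst hA₁ hA₂
  obtain ⟨t, σ', hex, f, hf, hout, ht⟩ := queryCmd_spec H hf₁ hf₂ hl₁ hl₂ t1 hV₁ hV₂ t4 t5
    (fun it hit => stored_stringItems _ _ _ t2 it (hp₁.subset hit))
    (fun it hit => stored_stringItems _ _ _ t3 it (hp₂.subset hit)) hT.subset (by omega) t8 t0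
  have hnd : (T.colors.filter f).Nodup := (hT.nodup_iff.2 List.nodup_range).filter _
  have hans : (T.colors.filter f).toFinset = answer D σ₁ σ₂ := by
    ext i
    rw [List.mem_toFinset, List.mem_filter, hT.mem_iff, List.mem_range, hf, hex₁, hex₂,
      mem_answer_iff]
  have hcard : (answer D σ₁ σ₂).card = (T.colors.filter f).length := by
    rw [← hans, List.toFinset_card_of_nodup hnd]
  refine ⟨t, _, hex.haltsIn, ?_, ?_, ?_, rfl⟩
  · show σ'.out.Nodup
    rw [hout]
    exact List.nodup_reverse.2 hnd
  · show σ'.out.toFinset = _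
    rw [hout, List.toFinset_reverse, hans]
  · have h1 := T.cost_le _ _ f hL hweightT
    have h2 : (t : ℝ) ≤ 23 * (σ₁.length + σ₂.length) + 26 * L + 100 +
        (T.cost (T₁.items.map Item.color) (T₂.items.map Item.color) f L : ℝ) := by
      exact_mod_cast ht
    have h3 : ((T.colors.map (weight (T₁.items.map Item.color)
        (T₂.items.map Item.color))).sum : ℝ) ≤ (D.size + 2 * D.length : ℕ) := by
      exact_mod_cast (by omega)
    have h4 : (T.height : ℝ) ≤ L := by exact_mod_cast hh
    rw [hcard]
    refine h2.trans (add_le_add_right (h1.trans ?_) _)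
    gcongr

end SubstringIndexing

/-! ### Numerical estimates and the theorem -/

namespace SubstringIndexing

open WordRAM

theorem log_add_three_le {N : ℕ} (hN : 2 ≤ N) :
    ((Nat.log 2 N + 3 : ℕ) : ℝ) ≤ 4 * Real.logb 2 N := by
  have h1 : (1 : ℝ) ≤ Real.logb 2 N := by
    rw [Real.le_logb_iff_rpow_le one_lt_two (by positivity)]
    simpa using (by exact_mod_cast hN : (2 : ℝ) ≤ N)
  have h2 : (Nat.log 2 N : ℝ) ≤ Real.logb 2 N := by
    rw [Real.le_logb_iff_rpow_le one_lt_two (by positivity), Real.rpow_natCast]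
    exact_mod_cast Nat.pow_log_le_self 2 (by omega)
  push_cast
  linarith

theorem pow_le_two_pow {N w k : ℕ} (hN : 0 < N) (h : (k : ℝ) * Real.logb 2 N ≤ w) :
    N ^ k ≤ 2 ^ w := by
  rw [← Real.logb_pow, Real.logb_le_iff_le_rpow one_lt_two (by positivity),
    Real.rpow_natCast] at h
  exact_mod_cast h

end SubstringIndexing

theorem mainTheorem5 :
    ∃ (P : WordRAM.Program) (c₀ C : ℝ),
      ∀ (D : SubstringIndexing.Database) (N w : ℕ),
        N = D.size →
        2 ≤ N →
        D.length ≤ N →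
        c₀ * Real.logb 2 N ≤ w →
        (∀ p ∈ D, SubstringIndexing.FitsWord w p.1 ∧ SubstringIndexing.FitsWord w p.2) →
        ∃ (M : ℕ) (S : Set (ℕ → ℕ)),
          (M : ℝ) ≤ C * (N * Real.logb 2 N) ∧
          S.Nonempty ∧
          ∀ m ∈ S,
            SubstringIndexing.IsIndex P D w M
              (fun σ₁ σ₂ =>
                C * (σ₁.length + σ₂.length +
                  (√(N * Real.logb 2 N *
                      (max 1 (SubstringIndexing.answer D σ₁ σ₂).card : ℕ)) +
                    (SubstringIndexing.answer D σ₁ σ₂).card) * Real.logb 2 N ^ 2))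
              S m := by
  -- The exponent `14` gives `2 ^ w ≥ N ^ 14 ≥ 4096 * N ^ 2`, room for twice the memory size and for
  -- sums of two prefix counts. The leading part of `130000` is `1204 * 4 * 24`, which arises from
  -- `L ≤ 4 * ℓ` and `√(W * k) ≤ 2 * R`.
  refine ⟨SubstringIndexing.queryCmd.program, (14 : ℕ), 130000, ?_⟩
  intro D N w hND hN hc hw hD
  have hL4 := SubstringIndexing.log_add_three_le hN
  have hpow := SubstringIndexing.pow_le_two_pow (by omega) hw
  -- The arrays have at most `3 * N` entries in total, and `N < 2 ^ (Nat.log 2 N + 1)`; two more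
  -- bits cover the factor `3`.
  have hlog : 3 * N < 2 ^ (Nat.log 2 N + 3) := by
    have := Nat.lt_pow_succ_log_self one_lt_two N
    rw [pow_succ] at this
    rw [pow_add]
    omega
  have hL3 : Nat.log 2 N + 3 ≤ 3 * N := by
    have := Nat.log_lt_self 2 (show N ≠ 0 by omega)
    omega
  have hL0 : 3 ≤ Nat.log 2 N + 3 := Nat.le_add_left _ _
  have hW : D.size + 2 * D.length ≤ 3 * N := by omega
  generalize Nat.log 2 N + 3 = L at hL4 hlog hL3 hL0
  generalize Real.logb 2 N = ℓ at hL4 hw ⊢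
  have hℓ : 3 / 4 ≤ ℓ := by
    have : (3 : ℝ) ≤ L := by exact_mod_cast hL0
    linarith
  have hbig : 4096 * N ^ 2 ≤ 2 ^ w := by
    refine le_trans ?_ hpow
    rw [show N ^ 14 = N ^ 12 * N ^ 2 by ring]
    exact Nat.mul_le_mul_right _ (Nat.pow_le_pow_left hN 12)
  have hLW : L * (D.size + 2 * D.length) ≤ L * (3 * N) := Nat.mul_le_mul_left _ hW
  obtain ⟨mem, hlen, hword, hquery⟩ := SubstringIndexing.exists_memory D w L (by omega)
    (by omega) (by
      have : L * (3 * N) ≤ 3 * N * (3 * N) := Nat.mul_le_mul_right _ hL3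
      nlinarith) (by nlinarith) hD
  have hN' : (2 : ℝ) ≤ N := by exact_mod_cast hN
  have hW' : ((D.size + 2 * D.length : ℕ) : ℝ) ≤ 3 * N := by exact_mod_cast hW
  -- A single state suffices because queries leave the memory unchanged.
  refine ⟨mem.length, {fun a => mem.getD a 0}, ?_, Set.singleton_nonempty _, ?_⟩
  · have h1 : (mem.length : ℝ) ≤ 11 + 19 * (3 * N) + 120 * (L * (3 * N)) := by
      have : mem.length ≤ 11 + 19 * (3 * N) + 120 * (L * (3 * N)) := by omega
      exact_mod_cast this
    have h2 : (L : ℝ) * (3 * N) ≤ 4 * ℓ * (3 * N) := by gcongr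
    nlinarith
  rintro m rfl
  refine ⟨fun a ha => ?_, fun σ₁ σ₂ hf₁ hf₂ hl₁ hl₂ => ?_⟩
  · rw [List.getD_eq_getElem _ _ ha]
    exact hword _ (List.getElem_mem _)
  obtain ⟨t, c, hrun, hnd, hans, ht, hm⟩ := hquery σ₁ σ₂ hf₁ hf₂ hl₁ hl₂
  refine ⟨t, c, hrun, hnd, hans, ht.trans ?_, hm⟩
  generalize (SubstringIndexing.answer D σ₁ σ₂).card = k
  have hk1 : (1 : ℝ) ≤ (max 1 k : ℕ) := by exact_mod_cast le_max_left 1 k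
  have hk2 : (k : ℝ) ≤ (max 1 k : ℕ) := by exact_mod_cast le_max_right 1 k
  generalize ((max 1 k : ℕ) : ℝ) = K at hk1 hk2
  have hR1 : (1 : ℝ) ≤ √(N * ℓ * K) := by
    rw [Real.one_le_sqrt]
    exact one_le_mul_of_one_le_of_one_le (by nlinarith) hk1
  -- Used for `x = k` and, to bound the cost of the root when nothing is reported, for `x = 1`. Of
  -- the factor `ℓ` under the root only `3 ≤ 4 * ℓ` is needed.
  have hR2 : ∀ x : ℝ, x ≤ K → 0 ≤ x →
      √((D.size + 2 * D.length : ℕ) * x) ≤ 2 * √(N * ℓ * K) := by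
    intro x hx hx0
    rw [← Real.sqrt_sq (zero_le_two (α := ℝ)), ← Real.sqrt_mul (sq_nonneg _)]
    refine Real.sqrt_le_sqrt ?_
    calc ((D.size + 2 * D.length : ℕ) : ℝ) * x ≤ 3 * N * K := by gcongr
      _ ≤ 2 ^ 2 * (N * ℓ * K) := by
        have : (0 : ℝ) ≤ N * K := by positivity
        nlinarith
  have h1 := hR2 k hk2 (Nat.cast_nonneg _)
  have h2 := hR2 1 hk1 zero_le_one
  rw [mul_one] at h2
  generalize √(N * ℓ * K) = R at hR1 h1 h2
  have hR0 : 0 ≤ R := by linarith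
  have hℓ0 : 0 ≤ ℓ := by linarith
  have hk0 : (0 : ℝ) ≤ k := Nat.cast_nonneg _
  calc _ ≤ 23 * ((σ₁.length : ℝ) + σ₂.length) + 26 * (4 * ℓ) + 100 +
        1204 * (4 * ℓ) * (3 * (4 * ℓ) * (2 * R) + 2 * R) := by gcongr
    _ ≤ 130000 * (σ₁.length + σ₂.length + R * ℓ ^ 2) := by
      have e1 : ℓ * R ≤ 4 / 3 * (R * ℓ ^ 2) := by nlinarith [mul_nonneg hℓ0 hR0]
      have e2 : ℓ ≤ ℓ * R := by nlinarith
      have e3 : (1 : ℝ) ≤ 4 / 3 * ℓ := by linarith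
      have e4 : (0 : ℝ) ≤ (σ₁.length : ℝ) + σ₂.length := by positivity
      nlinarith
    -- The separate output term is not needed for the estimate; it is nonnegative and merely added.
    _ ≤ _ := by gcongr; linarith
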